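/- **Setting.** A g-prime system is an unbounded sequence $1<p_0\le p_1\le\cdots$ of reals. Its g-integers are the products $\prod_i p_i^{a_i}$ over finitely supported exponent vectors $(a_i)$, counted with multiplicity (one for each exponent vector). Let $\pi(x)$ and $N(x)$ count the g-primes and the g-integers not exceeding $x$ (with multiplicity), let $\psi(x)=\sum_{p_i^{\alpha}\le x,\ \alpha\ge1}\log p_i$, and let $M(x)$ be the sum, over the g-integers not exceeding $x$, of the Moebius function, which is $(-1)^k$ on a product of $k$ g-primes with distinct indices and $0$ otherwise. For a prime measure $\mathrm{d}\Pi$ on $(1,\infty)$ put $\mathrm{d}N=\sum_{n\ge0}\mathrm{d}\Pi^{*n}/n!$ and $\mathrm{d}M=\sum_{n\ge0}(-1)^n\mathrm{d}\Pi^{*n}/n!$, where $*$ is multiplicative convolution and $\mathrm{d}\Pi^{*0}=\delta_1$. Write $N(x)=\int_{1^-}^x\mathrm{d}N$, $M(x)=\int_{1^-}^x\mathrm{d}M$, $\psi(x)=\int_1^x\log u\,\mathrm{d}\Pi(u)$ and $\zeta(s)=\int_{1^-}^\infty u^{-s}\,\mathrm{d}N(u)$. The notation $M(x)=\Omega(x)$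 means $\limsup_{x\to\infty}|M(x)|/x>0$. The notation $f\asymp g$ means $f=O(g)$ and $g=O(f)$ as $x\to\infty$. **Statement.** Let $$\Pi_B(x)=\int_1^x\frac{1-\cos(\log u)}{\log u}\,\mathrm{d}u\quad(x\ge1),\qquad q_k=\Pi_B^{-1}(k)\quad(k=1,2,\dots),$$ and let $\mathcal D=\{q_1,q_2,q_3,\dots\}$, $\mathcal P=\{q_1,q_1,q_2,q_2,q_3,q_3,\dots\}$ and $\mathrm{d}\Pi_C=2\,\mathrm{d}\Pi_B$. Write subscripts $\mathcal D,\mathcal P,C$ for the associated functions. Then the following hold. 0. $\Pi_B$ is strictly increasing on $[1,\infty)$, $q_k>1$ with $\Pi_B(q_k)=k$ for every $k\ge1$, and $\mathcal D$ and $\mathcal P$ are g-prime systems. The measure $\mathrm{d}\Pi_C$ has distribution function $\Pi_C(x)=2\Pi_B(x)$ for $x\ge1$. Both $\mathrm{d}M_C$ and $\mathrm{d}M_{\mathcal P}$ are the multiplicative convolution inverses of $\mathrm{d}N_C$ and $\mathrm{d}N_{\mathcal P}$ respectively. 1. As $x\to\infty$, both $\Pi_C(x)$ and $\pi_{\mathcal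 P}(x)$ equal $$\frac{x}{\log x}\Bigl(2-\sqrt2\cos\bigl(\log x-\tfrac{\pi}{4}\bigr)\Bigr)+O\Bigl(\frac{x}{\log^2x}\Bigr).$$ 2. Both systems satisfy two-sided Chebyshev bounds: $\Pi_C(x)\asymp x/\log x$, $\pi_{\mathcal P}(x)\asymp x/\log x$, $\psi_C(x)\asymp x$ and $\psi_{\mathcal P}(x)\asymp x$. 3. $M_C(x)=\Omega(x)$ and $M_{\mathcal P}(x)=\Omega(x)$. 4. For $\Re s>1$ the integral defining $\zeta_C(s)$ converges absolutely and $\zeta_C(s)=1+(s-1)^{-2}$. For all $x\ge1$, $N_C(x)=x\log x-x+2$. 5. There is $c_0>0$ with $N_{\mathcal P}(x)\ge c_0\,x\log x$ for all $x\ge1$. Moreover there are constants $c>0$ and $b\in\mathbb R$ such that, as $x\to\infty$, $$N_{\mathcal D}(x)=cx+O\Bigl(\frac{x}{\log^{3/2}x}\Bigr),\qquad N_{\mathcal P}(x)=c^2x\log x+bx+O\Bigl(\frac{x}{\log^{1/2}x}\Bigr).$$ In particular neither $N_C(x)$ nor $N_{\mathcal P}(x)$ is $O(x)$. -/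

import Mathlib

open Filter Asymptotics MeasureTheory

noncomputable section

namespace Beurling

/-! ## Generalized prime systems given by a sequence -/

/-- A g-prime system `1 < p 0 ≤ p 1 ≤ …`, unbounded. Repetitions are allowed. -/
def IsGPrimeSystem (p : ℕ → ℝ) : Prop :=
  1 < p 0 ∧ Monotone p ∧ Tendsto p atTop atTop

/-- The g-integer with exponent vector `a`, i.e. `∏ i, p i ^ a i`. The g-integers are counted with
multiplicity, one for each exponent vector. -/
def gInt (p : ℕ → ℝ) (a : ℕ →₀ ℕ) : ℝ := a.prod fun i e => p i ^ e

/-- The g-prime counting function `π(x)` (with multiplicity). -/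
def primeCount (p : ℕ → ℝ) (x : ℝ) : ℝ := ({i : ℕ | p i ≤ x}.ncard : ℝ)

/-- The g-Chebyshev function `ψ(x) = ∑_{p i ^ α ≤ x, α ≥ 1} log (p i)`. -/
def psi (p : ℕ → ℝ) (x : ℝ) : ℝ :=
  ∑ᶠ j ∈ {j : ℕ × ℕ | 1 ≤ j.2 ∧ p j.1 ^ j.2 ≤ x}, Real.log (p j.1)

/-- The g-integer counting function `N(x)` (with multiplicity). -/
def intCount (p : ℕ → ℝ) (x : ℝ) : ℝ := ({a : ℕ →₀ ℕ | gInt p a ≤ x}.ncard : ℝ)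

/-- The measure `dN` of a discrete system: a unit mass at each g-integer. -/
def intMeasure (p : ℕ → ℝ) : Measure ℝ := Measure.sum fun a : ℕ →₀ ℕ => Measure.dirac (gInt p a)

open Classical in
/-- The Moebius function on exponent vectors: `(-1)^k` on products of `k` g-primes with distinct
indices, and `0` otherwise. -/
def moebius (a : ℕ →₀ ℕ) : ℝ := if ∀ i, a i ≤ 1 then (-1) ^ a.support.card else 0

/-- `M(x)`, the sum function of the Moebius function over the g-integers not exceeding `x`. -/
def moebiusSum (p : ℕ → ℝ) (x : ℝ) : ℝ := ∑ᶠ a ∈ {a : ℕ →₀ ℕ | gInt p a ≤ x}, moebius a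

/-! ## Generalized number systems given by a prime measure `dΠ` on `(1, ∞)` -/

/-- The `n`-th power of a measure for multiplicative convolution; the `0`-th one is the unit mass
at `1`. -/
def convPow (P : Measure ℝ) : ℕ → Measure ℝ
  | 0 => Measure.dirac 1
  | n + 1 => Measure.mconv (convPow P n) P

/-- The measure `dN = exp^*(dΠ) = ∑ dΠ^{*n} / n!`. -/
def convExp (P : Measure ℝ) : Measure ℝ :=
  Measure.sum fun n : ℕ => ((n.factorial : ENNReal)⁻¹) • convPow P n

/-- The even part of `exp^*(dΠ)`. -/
def convCosh (P : Measure ℝ) : Measure ℝ :=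
  Measure.sum fun n : ℕ => (((2 * n).factorial : ENNReal)⁻¹) • convPow P (2 * n)

/-- The odd part of `exp^*(dΠ)`. -/
def convSinh (P : Measure ℝ) : Measure ℝ :=
  Measure.sum fun n : ℕ => (((2 * n + 1).factorial : ENNReal)⁻¹) • convPow P (2 * n + 1)

/-- The distribution function `x ↦ ∫_{1-}^x dN` of a measure on `[1, ∞)`. -/
def distFun (μ : Measure ℝ) (x : ℝ) : ℝ := μ.real (Set.Iic x)

/-- `M(x)`, the distribution function of
`dM = exp^*(-dΠ) = ∑ (-1)^n dΠ^{*n} / n!` (even part minus odd part). -/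
def measureMoebiusSum (P : Measure ℝ) (x : ℝ) : ℝ :=
  distFun (convCosh P) x - distFun (convSinh P) x

/-- `ψ(x) = ∫_1^x log u dΠ(u)`. -/
def measurePsi (P : Measure ℝ) (x : ℝ) : ℝ := ∫ u in Set.Iic x, Real.log u ∂P

/-- The zeta function `ζ(s) = ∫_{1-}^∞ u^{-s} dN(u)`. -/
def zeta (dN : Measure ℝ) (s : ℂ) : ℂ := ∫ u : ℝ, (u : ℂ) ^ (-s) ∂dN

/-- `M` is the distribution function of a (locally finite, signed) measure `dM = dA - dB` on
`[1, ∞)` that is the inverse of `dN` for multiplicative convolution: `dM * dN = δ_1`. -/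
def IsConvInverse (dN : Measure ℝ) (M : ℝ → ℝ) : Prop :=
  ∃ A B : Measure ℝ, A (Set.Iio 1) = 0 ∧ B (Set.Iio 1) = 0 ∧
    (∀ x : ℝ, A (Set.Iic x) < ⊤ ∧ B (Set.Iic x) < ⊤) ∧
    (∀ x : ℝ, M x = distFun A x - distFun B x) ∧
    Measure.mconv A dN = Measure.mconv B dN + Measure.dirac 1

/-- `F(x) = Ω(x)`, i.e. `limsup |F(x)| / x > 0` as `x → ∞`. -/
def IsOmegaId (F : ℝ → ℝ) : Prop := ∃ c : ℝ, 0 < c ∧ ∃ᶠ x in atTop, c * x ≤ |F x|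

/-! ## The example -/

/-- The density `(1 - cos (log u)) / log u` of `dΠ_B`. -/
def densityB (u : ℝ) : ℝ := (1 - Real.cos (Real.log u)) / Real.log u

/-- `Π_B(x)`, for `x ≥ 1`. -/
def PiB (x : ℝ) : ℝ := ∫ u in (1 : ℝ)..x, densityB u

/-- The measure `dΠ_B` on `(1, ∞)`. -/
def dPiB : Measure ℝ :=
  (volume.restrict (Set.Ioi 1)).withDensity fun u => ENNReal.ofReal (densityB u)

/-- `Π_C(x) = 2 Π_B(x)`, for `x ≥ 1`. -/
def PiC (x : ℝ) : ℝ := 2 * PiB x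

/-- The measure `dΠ_C = 2 dΠ_B`. -/
def dPiC : Measure ℝ := (2 : ENNReal) • dPiB

/-- `q_k = Π_B^{-1}(k)`, where `Π_B` is regarded as a function on `[1, ∞)`. -/
def q (k : ℕ) : ℝ := Function.invFunOn PiB (Set.Ici 1) (k : ℝ)

/-- The g-prime system `q_1, q_2, q_3, …`. -/
def sysD (i : ℕ) : ℝ := q (i + 1)

/-- The g-prime system `q_1, q_1, q_2, q_2, q_3, q_3, …`. -/
def sysP (i : ℕ) : ℝ := q (i / 2 + 1)

/-- The measure `dN_C`. -/
def dNC : Measure ℝ := convExp dPiC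

end Beurling

end

/-!
With `t = log x` as variable, multiplicative convolution becomes additive convolution on the
half-line, and a prime measure enters through its logarithmic derivative: multiplication by `t` is a
derivation of the convolution algebra.

*The continuous system.* The zeta function `exp (∫ u^{-s} dΠ_C)` and `1 + (s - 1)⁻²` have the same
logarithmic derivative and the same limit at `+∞` (`exp_two_mul_lap_rho`). Measures on `[1, ∞)` are
determined by their zeta functions (`HasZeta.ext`, from the injectivity of the Fourier transform),
so `dN_C = δ_1 + log u du` (`dNC_eq`), and the convolution identities between `dN`, `dM` and `δ_1`
follow from identities between zeta functions.

*The discrete systems.* The `q_k` discretize `dΠ_B` with an error of at most one prime, so that sums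
over the `q_k` differ from integrals against `dΠ_B` by at most the total variation of the summand
(`norm_sum_q_sub_integral_le`). This gives the prime number formula and the Chebyshev bounds.

*Counting integers.* Let masses at `u = e^t` be divided by `u`, which is compatible with convolution.
Then `exp^*(dΠ_B)` becomes `δ + h(t) dt` and its inverse `δ - J₁(t) dt`, where `J₁` is the Bessel function and `h` is the integral of `J₁(t) / t`; both facts
are linear differential equations (`mul_bh`, `mul_bj`). An energy estimate for the Bessel equation
gives `h(t) = H + O(t^{-3/2})` (`bh_asymptotic`). Let `quot` be the function `e^{-t} F(e^t)` for the
distribution function `F` of `dN_D * exp^*(-dΠ_B)`. It satisfies a functional equation (`mul_quot`)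
in which only the difference of the two Chebyshev functions occurs; that difference is about the
square root of `x`, so the larger primes contribute almost nothing, and the equation yields the
decay of `quot` by a bootstrap (`quot_bound`). Convolving back with `δ + h` gives
`N_D(x) = c x + O(x / log^{3/2} x)`. The constant is positive because `∑ 1 / q_k` diverges
(`density_pos`). The g-integers of the doubled system are pairs of g-integers of `q_1, q_2, …`, and
the hyperbola method gives `N_P` (`sysP_count_asymptotic`).

*The Möbius function.* The zeta function of the continuous system vanishes at `1 + i`, hence
`∫ u^{-s} dM_C` is of size `1 / ε` at `s = 1 + ε + i`. By comparison of the Euler product with the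
exponential of an integral, the same holds for the discrete system (`le_norm_prod_sysP`). If `M(x)`
were `o(x)`, the Mellin transform of `M` would be `o(1 / ε)` there (`isOmegaId_of_le_norm_zeta`).
-/

namespace Beurling

/-! ### Convolution on the half-line -/

/-- The convolution `∫₀ᵗ f(u) g(t - u) du` on the half-line. It is used for continuous functions on
`ℝ`, and is defined for every real `t` by the oriented integral. -/
noncomputable def cv (f g : ℝ → ℝ) (t : ℝ) : ℝ := ∫ u in (0 : ℝ)..t, f u * g (t - u)

theorem cv_comm (f g : ℝ → ℝ) : cv f g = cv g f := by
  funext t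
  have := intervalIntegral.integral_comp_sub_left (fun u => f u * g (t - u)) (a := 0) (b := t) t
  simp only [sub_sub_cancel, sub_self, sub_zero] at this
  unfold cv
  rw [← this]
  exact intervalIntegral.integral_congr fun u _ => mul_comm _ _

theorem continuous_cv {f g : ℝ → ℝ} (hf : Continuous f) (hg : Continuous g) :
    Continuous (cv f g) := by
  unfold cv
  exact intervalIntegral.continuous_parametric_intervalIntegral_of_continuous
    (f := fun t u => f u * g (t - u)) (by fun_prop) continuous_id

theorem cv_intervalIntegrable {f g : ℝ → ℝ} (hf : Continuous f) (hg : Continuous g) (t a b : ℝ) :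
    IntervalIntegrable (fun u => f u * g (t - u)) volume a b := by
  apply Continuous.intervalIntegrable; fun_prop

theorem cv_add_right {f g g' : ℝ → ℝ} (hf : Continuous f) (hg : Continuous g)
    (hg' : Continuous g') : cv f (g + g') = cv f g + cv f g' := by
  funext t
  simp only [cv, Pi.add_apply, mul_add]
  exact intervalIntegral.integral_add (cv_intervalIntegrable hf hg _ _ _)
    (cv_intervalIntegrable hf hg' _ _ _)

theorem cv_sub_right {f g g' : ℝ → ℝ} (hf : Continuous f) (hg : Continuous g)
    (hg' : Continuous g') : cv f (g - g') = cv f g - cv f g' := by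
  funext t
  simp only [cv, Pi.sub_apply, mul_sub]
  exact intervalIntegral.integral_sub (cv_intervalIntegrable hf hg _ _ _)
    (cv_intervalIntegrable hf hg' _ _ _)

/-- Fubini's theorem on the triangle `0 ≤ v ≤ u ≤ t`. -/
theorem integral_integral_swap_triangle {F : ℝ → ℝ → ℝ} (hF : Continuous (Function.uncurry F))
    {t : ℝ} (ht : 0 ≤ t) :
    ∫ u in (0 : ℝ)..t, ∫ v in (0 : ℝ)..u, F u v = ∫ v in (0 : ℝ)..t, ∫ u in v..t, F u v := by
  set S : Set (ℝ × ℝ) := {p | p.2 ≤ p.1} with hS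
  have hSm : MeasurableSet S := measurableSet_le measurable_snd measurable_fst
  have hint : IntegrableOn (Function.uncurry F) (Set.Icc 0 t ×ˢ Set.Icc 0 t)
      (volume.prod volume) :=
    hF.continuousOn.integrableOn_compact (isCompact_Icc.prod isCompact_Icc)
  have hint' : Integrable (Function.uncurry fun u v => S.indicator (Function.uncurry F) (u, v))
      ((volume.restrict (Set.uIoc 0 t)).prod (volume.restrict (Set.uIoc 0 t))) := by
    rw [Measure.prod_restrict, Set.uIoc_of_le ht]
    exact (hint.mono_set (Set.prod_mono Set.Ioc_subset_Icc_self
      Set.Ioc_subset_Icc_self)).indicator hSm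
  rw [Measure.prod_restrict] at hint'
  have key := intervalIntegral_intervalIntegral_swap hint'
  have h1 : ∀ u ∈ Set.uIcc 0 t, ∫ v in (0 : ℝ)..u, F u v =
      ∫ v in (0 : ℝ)..t, S.indicator (Function.uncurry F) (u, v) := by
    intro u hu
    rw [Set.uIcc_of_le ht] at hu
    rw [intervalIntegral.integral_of_le hu.1, intervalIntegral.integral_of_le ht]
    have : (fun v => S.indicator (Function.uncurry F) (u, v)) =
        (Set.Iic u).indicator (fun v => F u v) := by
      funext v
      simp only [Set.indicator_apply, hS, Set.mem_ofPred_eq, Set.mem_Iic, Function.uncurry]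
    rw [this, setIntegral_indicator measurableSet_Iic]
    congr 2
    ext v; simp only [Set.mem_Ioc, Set.mem_inter_iff, Set.mem_Iic]
    constructor
    · rintro ⟨h1, h2⟩; exact ⟨⟨h1, h2.trans hu.2⟩, h2⟩
    · rintro ⟨h1, h2⟩; exact ⟨h1.1, h2⟩
  have h2 : ∀ v ∈ Set.uIcc 0 t, ∫ u in v..t, F u v =
      ∫ u in (0 : ℝ)..t, S.indicator (Function.uncurry F) (u, v) := by
    intro v hv
    rw [Set.uIcc_of_le ht] at hv
    rw [intervalIntegral.integral_of_le hv.2, intervalIntegral.integral_of_le ht]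
    have : (fun u => S.indicator (Function.uncurry F) (u, v)) =
        (Set.Ici v).indicator (fun u => F u v) := by
      funext u
      simp only [Set.indicator_apply, hS, Set.mem_ofPred_eq, Set.mem_Ici, Function.uncurry]
    rw [this, setIntegral_indicator measurableSet_Ici, ← integral_Icc_eq_integral_Ioc,
      setIntegral_congr_set (Ioo_ae_eq_Icc (μ := volume) (a := v) (b := t)).symm]
    refine setIntegral_congr_set ?_
    refine (Ioo_ae_eq_Icc (μ := volume)).trans ?_
    have hne : ∀ᵐ u : ℝ, u ≠ 0 := by
      simp [ae_iff]
    filter_upwards [hne] with u hu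
    refine propext ⟨fun h => ⟨⟨lt_of_le_of_ne (hv.1.trans h.1) (Ne.symm hu), h.2⟩, h.1⟩,
      fun h => ⟨h.2, h.1.2⟩⟩
  rw [intervalIntegral.integral_congr h1, intervalIntegral.integral_congr h2, key]

theorem cv_assoc_of_nonneg {f g h : ℝ → ℝ} (hf : Continuous f) (hg : Continuous g)
    (hh : Continuous h) {t : ℝ} (ht : 0 ≤ t) : cv (cv f g) h t = cv f (cv g h) t := by
  have hF : Continuous (Function.uncurry fun u v => f v * g (u - v) * h (t - u)) := by
    unfold Function.uncurry; fun_prop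
  have := integral_integral_swap_triangle hF ht
  unfold cv
  simp only [← intervalIntegral.integral_mul_const, ← intervalIntegral.integral_const_mul]
  rw [this]
  refine intervalIntegral.integral_congr fun v _ => ?_
  have := intervalIntegral.integral_comp_sub_right
    (fun w => f v * (g w * h (t - v - w))) (a := v) (b := t) v
  rw [sub_self] at this
  rw [← this]
  refine intervalIntegral.integral_congr fun u _ => ?_
  rw [show t - v - (u - v) = t - u by ring]; ring

/-- Reflecting both factors reflects the convolution up to sign. -/
theorem cv_neg (f g : ℝ → ℝ) (t : ℝ) :
    cv f g (-t) = -cv (fun u => f (-u)) (fun u => g (-u)) t := by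
  unfold cv
  have := intervalIntegral.integral_comp_neg (fun u => f u * g (-t - u)) (a := 0) (b := t)
  rw [neg_zero] at this
  rw [intervalIntegral.integral_symm, ← this]
  congr 1
  refine intervalIntegral.integral_congr fun u _ => ?_
  congr 2; ring

theorem cv_assoc {f g h : ℝ → ℝ} (hf : Continuous f) (hg : Continuous g)
    (hh : Continuous h) : cv (cv f g) h = cv f (cv g h) := by
  funext t
  rcases le_total 0 t with ht | ht
  · exact cv_assoc_of_nonneg hf hg hh ht
  · obtain ⟨s, rfl⟩ : ∃ s, t = -s := ⟨-t, by ring⟩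
    have key := cv_assoc_of_nonneg (hf.comp continuous_neg) (hg.comp continuous_neg)
      (hh.comp continuous_neg) (t := s) (by linarith)
    rw [cv_neg, cv_neg]
    simp only [cv_neg]
    simp only [Function.comp_def] at key
    have e1 : cv (fun u => -cv (fun u => f (-u)) (fun u => g (-u)) u) (fun u => h (-u)) s =
        -cv (cv (fun u => f (-u)) (fun u => g (-u))) (fun u => h (-u)) s := by
      simp only [cv, neg_mul, intervalIntegral.integral_neg]
    have e2 : cv (fun u => f (-u)) (fun u => -cv (fun u => g (-u)) (fun u => h (-u)) u) s =
        -cv (fun u => f (-u)) (cv (fun u => g (-u)) (fun u => h (-u))) s := by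
      simp only [cv, mul_neg, intervalIntegral.integral_neg]
    rw [e1, e2, key]

/-- Multiplication by the variable is a derivation for convolution. -/
theorem mul_cv {f g : ℝ → ℝ} (hf : Continuous f) (hg : Continuous g) :
    (fun t => t * cv f g t) = cv (fun t => t * f t) g + cv f (fun t => t * g t) := by
  funext t
  have h1 : Continuous fun t => t * f t := by fun_prop
  have h2 : Continuous fun t => t * g t := by fun_prop
  simp only [Pi.add_apply]
  unfold cv
  rw [← intervalIntegral.integral_const_mul,
    ← intervalIntegral.integral_add (cv_intervalIntegrable h1 hg _ _ _)
      (cv_intervalIntegrable hf h2 _ _ _)]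
  refine intervalIntegral.integral_congr fun u _ => ?_
  ring

/-! ### The Bessel kernels -/

/-- The function `J₁(t) / t`, by Poisson's integral. -/
noncomputable def bk (t : ℝ) : ℝ :=
  Real.pi⁻¹ * ∫ θ in (0 : ℝ)..Real.pi, Real.cos (t * Real.cos θ) * Real.sin θ ^ 2

/-- The derivative of `bk`. -/
noncomputable def bk' (t : ℝ) : ℝ :=
  Real.pi⁻¹ * ∫ θ in (0 : ℝ)..Real.pi,
    -(Real.sin (t * Real.cos θ) * Real.cos θ * Real.sin θ ^ 2)

theorem hasDerivAt_integral_param {F F' : ℝ → ℝ → ℝ} (hF : Continuous (Function.uncurry F))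
    (hF' : Continuous (Function.uncurry F')) {C : ℝ} (hC : ∀ x θ, |F' x θ| ≤ C)
    (hd : ∀ x θ, HasDerivAt (fun x => F x θ) (F' x θ) x) (a b t : ℝ) :
    HasDerivAt (fun x => ∫ θ in a..b, F x θ) (∫ θ in a..b, F' t θ) t := by
  have hc : ∀ x, Continuous (F x) := fun x => hF.comp (by fun_prop : Continuous fun θ => (x, θ))
  have hc' : ∀ x, Continuous (F' x) := fun x =>
    hF'.comp (by fun_prop : Continuous fun θ => (x, θ))
  exact (intervalIntegral.hasDerivAt_integral_of_dominated_loc_of_deriv_le (bound := fun _ => C)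
    (s := Set.univ) Filter.univ_mem
    (Eventually.of_forall fun x => (hc x).aestronglyMeasurable)
    ((hc t).intervalIntegrable _ _) (hc' t).aestronglyMeasurable
    (Eventually.of_forall fun θ _ x _ => hC x θ) intervalIntegrable_const
    (Eventually.of_forall fun θ _ x _ => hd x θ)).2

theorem hasDerivAt_bk (t : ℝ) : HasDerivAt bk (bk' t) t := by
  unfold bk bk'
  refine HasDerivAt.const_mul _ (hasDerivAt_integral_param
    (F := fun x θ => Real.cos (x * Real.cos θ) * Real.sin θ ^ 2)
    (F' := fun x θ => -(Real.sin (x * Real.cos θ) * Real.cos θ * Real.sin θ ^ 2))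
    (C := 1) ?_ ?_ ?_ ?_ 0 Real.pi t)
  · unfold Function.uncurry; fun_prop
  · unfold Function.uncurry; fun_prop
  · intro x θ
    rw [abs_neg, abs_mul, abs_mul, abs_of_nonneg (sq_nonneg (Real.sin θ))]
    have h1 := Real.abs_sin_le_one (x * Real.cos θ)
    have h2 := Real.abs_cos_le_one θ
    have h3 := Real.sin_sq_le_one θ
    have h4 := sq_nonneg (Real.sin θ)
    exact mul_le_one₀ (mul_le_one₀ h1 (abs_nonneg _) h2) h4 h3
  · intro x θ
    have := ((hasDerivAt_id x).mul_const (Real.cos θ)).cos.mul_const (Real.sin θ ^ 2)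
    refine this.congr_deriv ?_
    simp only [id]; ring

/-- The second derivative of `bk`, in the form given by the differential equation
`t k'' + 3 k' + t k = 0`. -/
theorem hasDerivAt_mul_bk' (t : ℝ) :
    HasDerivAt (fun t => t * bk' t) (-2 * bk' t - t * bk t) t := by
  have h : HasDerivAt bk' (Real.pi⁻¹ * ∫ θ in (0 : ℝ)..Real.pi,
      -(Real.cos (t * Real.cos θ) * Real.cos θ ^ 2 * Real.sin θ ^ 2)) t := by
    unfold bk'
    refine HasDerivAt.const_mul _ (hasDerivAt_integral_param
      (F := fun x θ => -(Real.sin (x * Real.cos θ) * Real.cos θ * Real.sin θ ^ 2))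
      (F' := fun x θ => -(Real.cos (x * Real.cos θ) * Real.cos θ ^ 2 * Real.sin θ ^ 2))
      (C := 1) ?_ ?_ ?_ ?_ 0 Real.pi t)
    · unfold Function.uncurry; fun_prop
    · unfold Function.uncurry; fun_prop
    · intro x θ
      rw [abs_neg, abs_mul, abs_mul, abs_of_nonneg (sq_nonneg (Real.sin θ)),
        abs_of_nonneg (sq_nonneg (Real.cos θ))]
      have h1 := Real.abs_cos_le_one (x * Real.cos θ)
      exact mul_le_one₀ (mul_le_one₀ h1 (sq_nonneg _) (Real.cos_sq_le_one θ)) (sq_nonneg _)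
        (Real.sin_sq_le_one θ)
    · intro x θ
      have := (((hasDerivAt_id x).mul_const (Real.cos θ)).sin.mul_const
        (Real.cos θ * Real.sin θ ^ 2)).neg
      refine (this.congr_deriv ?_).congr_of_eventuallyEq (Eventually.of_forall fun y => ?_)
      · simp only [id]; ring
      · simp only [id, Pi.neg_apply]; ring
  -- integration by parts in `θ`, through the derivative of `sin (t cos θ) sin³ θ`
  have hparts : ∫ θ in (0 : ℝ)..Real.pi,
      (3 * (Real.sin (t * Real.cos θ) * Real.cos θ * Real.sin θ ^ 2) -
        t * (Real.cos (t * Real.cos θ) * Real.sin θ ^ 4)) = 0 := by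
    rw [intervalIntegral.integral_eq_sub_of_hasDerivAt
      (f := fun θ => Real.sin (t * Real.cos θ) * Real.sin θ ^ 3)]
    · simp
    · intro θ _
      have := (((Real.hasDerivAt_cos θ).const_mul t).sin).mul ((Real.hasDerivAt_sin θ).pow 3)
      refine this.congr_deriv ?_
      simp only [Pi.pow_apply]
      push_cast; ring
    · apply Continuous.intervalIntegrable; fun_prop
  refine ((hasDerivAt_id t).mul h).congr_deriv ?_
  have e : ∫ θ in (0 : ℝ)..Real.pi,
      (3 * (Real.sin (t * Real.cos θ) * Real.cos θ * Real.sin θ ^ 2) -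
        t * (Real.cos (t * Real.cos θ) * Real.sin θ ^ 4)) =
      -3 * (∫ θ in (0 : ℝ)..Real.pi,
        -(Real.sin (t * Real.cos θ) * Real.cos θ * Real.sin θ ^ 2)) -
      t * (∫ θ in (0 : ℝ)..Real.pi, Real.cos (t * Real.cos θ) * Real.sin θ ^ 2) -
      t * (∫ θ in (0 : ℝ)..Real.pi,
        -(Real.cos (t * Real.cos θ) * Real.cos θ ^ 2 * Real.sin θ ^ 2)) := by
    rw [← intervalIntegral.integral_const_mul, ← intervalIntegral.integral_const_mul,
      ← intervalIntegral.integral_const_mul, ← intervalIntegral.integral_sub,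
      ← intervalIntegral.integral_sub]
    · refine intervalIntegral.integral_congr fun θ _ => ?_
      have := Real.sin_sq_add_cos_sq θ
      linear_combination (-(t * Real.cos (t * Real.cos θ) * Real.sin θ ^ 2)) * this
    all_goals apply Continuous.intervalIntegrable; fun_prop
  rw [e] at hparts
  simp only [id, bk, bk']
  linear_combination (-Real.pi⁻¹) * hparts

theorem continuous_bk : Continuous bk :=
  continuous_iff_continuousAt.2 fun t => (hasDerivAt_bk t).continuousAt

theorem bk_zero : bk 0 = 1 / 2 := by
  simp [bk, integral_sin_sq]
  field_simp

theorem abs_bk_le (t : ℝ) : |bk t| ≤ 1 / 2 := by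
  rw [bk, abs_mul, abs_of_pos (inv_pos.2 Real.pi_pos)]
  have h1 : |∫ θ in (0 : ℝ)..Real.pi, Real.cos (t * Real.cos θ) * Real.sin θ ^ 2| ≤
      ∫ θ in (0 : ℝ)..Real.pi, Real.sin θ ^ 2 := by
    refine (intervalIntegral.abs_integral_le_integral_abs Real.pi_pos.le).trans ?_
    refine intervalIntegral.integral_mono_on Real.pi_pos.le ?_ ?_ fun θ _ => ?_
    · apply Continuous.intervalIntegrable; fun_prop
    · apply Continuous.intervalIntegrable; fun_prop
    · rw [abs_mul, abs_of_nonneg (sq_nonneg (Real.sin θ))]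
      exact mul_le_of_le_one_left (sq_nonneg _) (Real.abs_cos_le_one _)
  have h2 : ∫ θ in (0 : ℝ)..Real.pi, Real.sin θ ^ 2 = Real.pi / 2 := by simp [integral_sin_sq]
  rw [h2] at h1
  calc Real.pi⁻¹ * _ ≤ Real.pi⁻¹ * (Real.pi / 2) := by gcongr
    _ = 1 / 2 := by field_simp

/-- The Bessel function `J₁`. -/
noncomputable def bj (t : ℝ) : ℝ := t * bk t

/-- The Bessel function `J₀`. -/
noncomputable def bj0 (t : ℝ) : ℝ := 2 * bk t + t * bk' t

/-- The primitive of `J₁(t) / t`. The measure `exp^*(dΠ_B)` is `δ₁ + bh (log u) du`. -/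
noncomputable def bh (t : ℝ) : ℝ := ∫ u in (0 : ℝ)..t, bk u

/-- The density `1 - cos` of `log u dΠ_B(u)` with respect to `du`, as a function of `log u`. -/
noncomputable def qd (t : ℝ) : ℝ := 1 - Real.cos t

theorem continuous_bj : Continuous bj := continuous_id.mul continuous_bk

theorem hasDerivAt_bh (t : ℝ) : HasDerivAt bh (bk t) t :=
  intervalIntegral.integral_hasDerivAt_right (continuous_bk.intervalIntegrable _ _)
    (continuous_bk.stronglyMeasurableAtFilter _ _) continuous_bk.continuousAt

theorem continuous_bh : Continuous bh :=
  continuous_iff_continuousAt.2 fun t => (hasDerivAt_bh t).continuousAt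

theorem continuous_qd : Continuous qd := by unfold qd; fun_prop

theorem hasDerivAt_mul_bj (t : ℝ) : HasDerivAt (fun t => t * bj t) (t * bj0 t) t := by
  have := ((hasDerivAt_id t).mul ((hasDerivAt_id t).mul (hasDerivAt_bk t)))
  refine this.congr_deriv ?_
  simp only [id, bj0]
  simp; ring

theorem hasDerivAt_bj0 (t : ℝ) : HasDerivAt bj0 (-bj t) t := by
  have := ((hasDerivAt_bk t).const_mul 2).add (hasDerivAt_mul_bk' t)
  refine this.congr_deriv ?_
  simp only [bj]; ring

theorem bj0_zero : bj0 0 = 1 := by simp [bj0, bk_zero]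

/-- A solution of `X'' = -X` with vanishing initial values vanishes. -/
theorem eq_zero_of_deriv2_eq_neg {X Y : ℝ → ℝ} (hX : ∀ t, HasDerivAt X (Y t) t)
    (hY : ∀ t, HasDerivAt Y (-X t) t) (hX0 : X 0 = 0) (hY0 : Y 0 = 0) (t : ℝ) : X t = 0 := by
  have hd : ∀ t, HasDerivAt (fun t => X t ^ 2 + Y t ^ 2) 0 t := fun t => by
    refine (((hX t).pow 2).add ((hY t).pow 2)).congr_deriv ?_
    push_cast; ring
  have := is_const_of_deriv_eq_zero (fun t => (hd t).differentiableAt) (fun t => (hd t).deriv) t 0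
  simp only [hX0, hY0] at this
  nlinarith [sq_nonneg (X t), sq_nonneg (Y t)]

/-- The derivative of `(1 - cos) * g`, which is `sin * g`. -/
noncomputable def qd' (g : ℝ → ℝ) (t : ℝ) : ℝ :=
  Real.sin t * (∫ u in (0 : ℝ)..t, g u * Real.cos u) -
    Real.cos t * (∫ u in (0 : ℝ)..t, g u * Real.sin u)

theorem cv_qd_eq {g : ℝ → ℝ} (hg : Continuous g) (t : ℝ) :
    cv qd g t = (∫ u in (0 : ℝ)..t, g u) - Real.cos t * (∫ u in (0 : ℝ)..t, g u * Real.cos u) -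
      Real.sin t * (∫ u in (0 : ℝ)..t, g u * Real.sin u) := by
  rw [cv_comm, ← intervalIntegral.integral_const_mul, ← intervalIntegral.integral_const_mul,
    ← intervalIntegral.integral_sub, ← intervalIntegral.integral_sub]
  · refine intervalIntegral.integral_congr fun u _ => ?_
    simp only [qd, Real.cos_sub]; ring
  all_goals apply Continuous.intervalIntegrable; fun_prop

theorem hasDerivAt_integral_right {g : ℝ → ℝ} (hg : Continuous g) (t : ℝ) :
    HasDerivAt (fun t => ∫ u in (0 : ℝ)..t, g u) (g t) t :=
  intervalIntegral.integral_hasDerivAt_right (hg.intervalIntegrable _ _)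
    (hg.stronglyMeasurableAtFilter _ _) hg.continuousAt

theorem hasDerivAt_cv_qd {g : ℝ → ℝ} (hg : Continuous g) (t : ℝ) :
    HasDerivAt (cv qd g) (qd' g t) t := by
  have e : cv qd g = _ := funext fun t => cv_qd_eq hg t
  rw [e]
  have hc : Continuous fun u => g u * Real.cos u := by fun_prop
  have hs : Continuous fun u => g u * Real.sin u := by fun_prop
  refine (((hasDerivAt_integral_right hg t).sub ((Real.hasDerivAt_cos t).mul
    (hasDerivAt_integral_right hc t))).sub ((Real.hasDerivAt_sin t).mul
    (hasDerivAt_integral_right hs t))).congr_deriv ?_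
  simp only [qd']
  linear_combination (-g t) * Real.sin_sq_add_cos_sq t

theorem hasDerivAt_qd' {g : ℝ → ℝ} (hg : Continuous g) (t : ℝ) :
    HasDerivAt (qd' g) ((∫ u in (0 : ℝ)..t, g u) - cv qd g t) t := by
  unfold qd'
  have hc : Continuous fun u => g u * Real.cos u := by fun_prop
  have hs : Continuous fun u => g u * Real.sin u := by fun_prop
  refine (((Real.hasDerivAt_sin t).mul
    (hasDerivAt_integral_right hc t)).sub ((Real.hasDerivAt_cos t).mul
    (hasDerivAt_integral_right hs t))).congr_deriv ?_
  rw [cv_qd_eq hg]; ring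

/-- The identity `L j = Q - Q * j`, where `L` is multiplication by the variable: the measure
`δ - j` is the convolution exponential of `-Q(t) / t dt`. -/
theorem mul_bj : (fun t => t * bj t) = qd - cv qd bj := by
  have hI : ∀ t, ∫ u in (0 : ℝ)..t, bj u = 1 - bj0 t := fun t => by
    rw [intervalIntegral.integral_eq_sub_of_hasDerivAt (f := fun t => -bj0 t)
      (fun u _ => (hasDerivAt_bj0 u).neg.congr_deriv (neg_neg _))
      (continuous_bj.intervalIntegrable _ _), bj0_zero]
    ring
  have key := eq_zero_of_deriv2_eq_neg (X := fun t => t * bj t + cv qd bj t - (1 - Real.cos t))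
    (Y := fun t => t * bj0 t + qd' bj t - Real.sin t)
    (fun t => (((hasDerivAt_mul_bj t).add (hasDerivAt_cv_qd continuous_bj t)).sub
      ((Real.hasDerivAt_cos t).const_sub 1)).congr_deriv (by ring))
    (fun t => ((((hasDerivAt_id t).mul (hasDerivAt_bj0 t)).add
      (hasDerivAt_qd' continuous_bj t)).sub (Real.hasDerivAt_sin t)).congr_deriv (by
        rw [hI]; simp only [id]; ring))
    (by simp [cv]) (by simp [qd'])
  funext t
  simp only [Pi.sub_apply]
  have := key t
  simp only [qd]; linarith

/-- The identity `L h = Q + Q * h`: the measure `δ + h` is the convolution exponential of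
`Q(t) / t dt`. -/
theorem mul_bh : (fun t => t * bh t) = qd + cv qd bh := by
  have hI : ∀ t, bj0 t - (∫ u in (0 : ℝ)..t, bh u) = 1 - t * bh t := fun t => by
    have hd : ∀ t, HasDerivAt
        (fun t => bj0 t - (∫ u in (0 : ℝ)..t, bh u) + t * bh t) 0 t := fun t =>
      ((((hasDerivAt_bj0 t).sub (hasDerivAt_integral_right continuous_bh t)).add
        ((hasDerivAt_id t).mul (hasDerivAt_bh t)))).congr_deriv (by simp [bj]; ring)
    have := is_const_of_deriv_eq_zero (fun t => (hd t).differentiableAt)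
      (fun t => (hd t).deriv) t 0
    simp [bj0_zero] at this
    linarith
  have key := eq_zero_of_deriv2_eq_neg (X := fun t => t * bh t - cv qd bh t - (1 - Real.cos t))
    (Y := fun t => bh t + t * bk t - qd' bh t - Real.sin t)
    (fun t => ((((hasDerivAt_id t).mul (hasDerivAt_bh t)).sub
      (hasDerivAt_cv_qd continuous_bh t)).sub
      ((Real.hasDerivAt_cos t).const_sub 1)).congr_deriv (by simp))
    (fun t => (((((hasDerivAt_bh t).add ((hasDerivAt_id t).mul (hasDerivAt_bk t))).sub
      (hasDerivAt_qd' continuous_bh t))).sub (Real.hasDerivAt_sin t)).congr_deriv (by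
        have := hI t
        simp only [bj0] at this
        simp only [id]; linarith))
    (by simp [cv]) (by simp [qd', bh])
  funext t
  simp only [Pi.add_apply]
  have := key t
  simp only [qd]; linarith

/-- The measures `δ + h` and `δ - j` are inverse to each other. -/
theorem bh_eq : bh = bj + cv bh bj := by
  have hj := continuous_bj
  have hh := continuous_bh
  have hq := continuous_qd
  have h1 := mul_cv hh hj
  rw [mul_bj, mul_bh, cv_sub_right hh hq (continuous_cv hq hj), cv_comm (qd + cv qd bh) bj,
    cv_add_right hj hq (continuous_cv hq hh), cv_comm bj (cv qd bh), cv_assoc hq hh hj,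
    cv_comm bh (cv qd bj), cv_assoc hq hj hh, cv_comm bj bh, cv_comm bj qd, cv_comm bh qd] at h1
  have hpt : ∀ t, t * (bh t - bj t - cv bh bj t) = 0 := fun t => by
    have e1 := congrFun h1 t
    have e2 := congrFun mul_bj t
    have e3 := congrFun mul_bh t
    simp only [Pi.add_apply, Pi.sub_apply] at e1 e2 e3
    rw [mul_sub, mul_sub, e1, e2, e3]; ring
  funext t
  simp only [Pi.add_apply]
  by_cases ht : t = 0
  · simp [ht, bh, bj, cv]
  · have := (mul_eq_zero.1 (hpt t)).resolve_left ht
    linarith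

/-- The function `e^{-t}`. -/
noncomputable def ek (t : ℝ) : ℝ := Real.exp (-t)

/-- The kernel `e - e * j`, where `e(t) = e^{-t}`. Summed over the g-integers it gives the
normalized distribution function of the quotient of the discrete and the continuous system. -/
noncomputable def wk : ℝ → ℝ := ek - cv ek bj

theorem continuous_ek : Continuous ek := by unfold ek; fun_prop

theorem continuous_wk : Continuous wk :=
  continuous_ek.sub (continuous_cv continuous_ek continuous_bj)

theorem mul_ek : (fun t => t * ek t) = cv ek ek := by
  funext t
  have : ∀ u, ek u * ek (t - u) = ek t := fun u => by
    simp only [ek, ← Real.exp_add]; congr 1; ring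
  simp only [cv, this]; simp

/-- The logarithmic derivative of `e * (δ - j)`: it is that of `e` minus `Q`. -/
theorem mul_wk : (fun t => t * wk t) = cv ek wk - cv qd wk := by
  have hj := continuous_bj
  have he := continuous_ek
  have hq := continuous_qd
  have h1 : (fun t => t * wk t) = (fun t => t * ek t) - fun t => t * cv ek bj t := by
    funext t; simp only [wk, Pi.sub_apply]; ring
  rw [h1, mul_cv he hj, mul_ek, mul_bj, wk, cv_sub_right he he (continuous_cv he hj),
    cv_sub_right hq he (continuous_cv he hj), cv_sub_right he hq (continuous_cv hq hj),
    cv_assoc he he hj, ← cv_assoc hq he hj, cv_comm qd ek, cv_assoc he hq hj]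
  abel

/-- Convolution with `δ + h` undoes the convolution with `δ - j`. -/
theorem wk_add : wk + cv bh wk = ek := by
  have hj := continuous_bj
  have he := continuous_ek
  have hh := continuous_bh
  have h1 : cv ek bh = cv ek bj + cv ek (cv bh bj) := by
    conv_lhs => rw [bh_eq]
    exact cv_add_right he hj (continuous_cv hh hj)
  rw [wk, cv_sub_right hh he (continuous_cv he hj), cv_comm bh ek, ← cv_assoc hh he hj,
    cv_comm bh ek, cv_assoc he hh hj, h1]
  abel

theorem hasDerivAt_wk (t : ℝ) : HasDerivAt wk (-wk t - bj t) t := by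
  have h1 : cv ek bj = fun t => Real.exp (-t) * ∫ u in (0 : ℝ)..t, Real.exp u * bj u := by
    funext t
    rw [cv_comm, cv, ← intervalIntegral.integral_const_mul]
    refine intervalIntegral.integral_congr fun u _ => ?_
    rw [ek, neg_sub, show u - t = -t + u by ring, Real.exp_add]; ring
  have hc : Continuous fun u => Real.exp u * bj u := Real.continuous_exp.mul continuous_bj
  have he : HasDerivAt (fun t => Real.exp (-t)) (-Real.exp (-t)) t := by
    simpa using (hasDerivAt_neg t).exp
  unfold wk
  rw [h1]
  refine (he.sub (he.mul (hasDerivAt_integral_right hc t))).congr_deriv ?_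
  simp only [Pi.sub_apply, ek]
  have : Real.exp (-t) * Real.exp t = 1 := by rw [← Real.exp_add]; simp
  linear_combination (-bj t) * this

theorem abs_bj_le {t : ℝ} (ht : 0 ≤ t) : |bj t| ≤ t := by
  rw [bj, abs_mul, abs_of_nonneg ht]
  have := abs_bk_le t
  nlinarith

theorem abs_wk_le {t : ℝ} (ht : 0 ≤ t) : |wk t| ≤ (1 + t) ^ 2 := by
  have h1 : |cv ek bj t| ≤ t * t := by
    have := intervalIntegral.norm_integral_le_of_norm_le_const (a := 0) (b := t) (C := t)
      (f := fun u => ek u * bj (t - u)) (fun u hu => by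
        rw [Set.uIoc_of_le ht] at hu
        have h2 := abs_bj_le (t := t - u) (by linarith [hu.2])
        have h3 : ek u ≤ 1 := Real.exp_le_one_iff.2 (by linarith [hu.1])
        have h4 : 0 ≤ ek u := (Real.exp_pos _).le
        rw [Real.norm_eq_abs, abs_mul, abs_of_nonneg h4]
        have := hu.1
        nlinarith [abs_nonneg (bj (t - u))])
    rw [sub_zero, abs_of_nonneg ht] at this
    exact this
  have h2 : |ek t| ≤ 1 := by
    rw [ek, abs_of_pos (Real.exp_pos _)]; exact Real.exp_le_one_iff.2 (by linarith)
  have := abs_sub (ek t) (cv ek bj t)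
  simp only [wk, Pi.sub_apply]
  nlinarith

theorem wk_zero : wk 0 = 1 := by simp [wk, ek, cv]

/-- The energy of the solution `t ^ (3/2) k(t)` of `y'' + (1 - 3 / (4 t²)) y = 0`. -/
noncomputable def bkEnergy (t : ℝ) : ℝ := t ^ 3 * bk t ^ 2 + t * (t * bk' t + 3 / 2 * bk t) ^ 2

theorem hasDerivAt_bkEnergy (t : ℝ) :
    HasDerivAt bkEnergy (3 / 2 * (t * bk' t + 3 / 2 * bk t) * bk t) t := by
  have h1 := (((hasDerivAt_id t).pow 3).mul ((hasDerivAt_bk t).pow 2)).add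
    ((hasDerivAt_id t).mul
      (((hasDerivAt_mul_bk' t).add ((hasDerivAt_bk t).const_mul (3 / 2))).pow 2))
  refine h1.congr_deriv ?_
  simp only [id, Pi.add_apply, Pi.pow_apply]
  push_cast
  ring

/-- The energy is bounded: its logarithmic derivative is at most `3 / (4 t²)`. -/
theorem bkEnergy_le : ∃ C : ℝ, 0 < C ∧ ∀ t, 1 ≤ t → bkEnergy t ≤ C := by
  set g : ℝ → ℝ := fun t => bkEnergy t * Real.exp (3 / 4 * t⁻¹) with hg
  have hd : ∀ t : ℝ, 1 ≤ t → HasDerivAt g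
      ((3 / 2 * (t * bk' t + 3 / 2 * bk t) * bk t - bkEnergy t * (3 / 4 * (t ^ 2)⁻¹)) *
        Real.exp (3 / 4 * t⁻¹)) t := fun t ht => by
    refine ((hasDerivAt_bkEnergy t).mul
      (((hasDerivAt_inv (by linarith : t ≠ 0)).const_mul (3 / 4)).exp)).congr_deriv ?_
    ring
  have hnn : ∀ t, 0 ≤ t → 0 ≤ bkEnergy t := fun t ht => by unfold bkEnergy; positivity
  have hanti : AntitoneOn g (Set.Ici 1) := by
    refine antitoneOn_of_deriv_nonpos (convex_Ici 1)
      (fun t ht => (hd t ht).continuousAt.continuousWithinAt) (fun t ht => ?_) (fun t ht => ?_)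
    · rw [interior_Ici] at ht
      exact (hd t (le_of_lt ht)).differentiableAt.differentiableWithinAt
    · rw [interior_Ici] at ht
      have ht : 1 < t := ht
      rw [(hd t ht.le).deriv]
      refine mul_nonpos_of_nonpos_of_nonneg ?_ (Real.exp_pos _).le
      have hsplit : bkEnergy t * (3 / 4 * (t ^ 2)⁻¹) -
          3 / 2 * (t * bk' t + 3 / 2 * bk t) * bk t =
          3 / 4 * t⁻¹ * (t * bk t - (t * bk' t + 3 / 2 * bk t)) ^ 2 := by
        unfold bkEnergy
        have : t ≠ 0 := by linarith
        field_simp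
        ring
      have : 0 ≤ 3 / 4 * t⁻¹ * (t * bk t - (t * bk' t + 3 / 2 * bk t)) ^ 2 := by positivity
      linarith
  refine ⟨g 1 + 1, ?_, fun t ht => ?_⟩
  · have : 0 ≤ g 1 := mul_nonneg (hnn 1 (by norm_num)) (Real.exp_pos _).le
    linarith
  · have h1 := hanti (Set.self_mem_Ici) ht ht
    have h2 : bkEnergy t ≤ g t := le_mul_of_one_le_right (hnn t (by linarith))
      (Real.one_le_exp (by positivity))
    linarith

theorem bk_bounds : ∃ C : ℝ, 0 < C ∧ ∀ t, 1 ≤ t → |bk t| ≤ C * t ^ (-(3 / 2) : ℝ) ∧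
    |bk' t| ≤ C * t ^ (-(3 / 2) : ℝ) := by
  obtain ⟨C, hC, h⟩ := bkEnergy_le
  have key : ∀ t : ℝ, 1 ≤ t → ∀ z : ℝ, t ^ 3 * z ^ 2 ≤ C →
      |z| ≤ Real.sqrt C * t ^ (-(3 / 2) : ℝ) := fun t ht z hz => by
    have ht0 : 0 < t := by linarith
    refine abs_le_of_sq_le_sq ?_ (by positivity)
    rw [mul_pow, Real.sq_sqrt hC.le, ← Real.rpow_natCast (t ^ (-(3 / 2) : ℝ)),
      ← Real.rpow_mul ht0.le]
    have : (-(3 / 2) * (2 : ℕ) : ℝ) = -(3 : ℕ) := by norm_num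
    rw [this, Real.rpow_neg ht0.le, Real.rpow_natCast, ← div_eq_mul_inv, le_div_iff₀ (by positivity)]
    linarith
  refine ⟨5 / 2 * Real.sqrt C, by positivity, fun t ht => ?_⟩
  have ht0 : 0 < t := by linarith
  have hE := h t ht
  unfold bkEnergy at hE
  have h1 : |bk t| ≤ Real.sqrt C * t ^ (-(3 / 2) : ℝ) := by
    refine key t ht _ ?_
    have : 0 ≤ t * (t * bk' t + 3 / 2 * bk t) ^ 2 := by positivity
    linarith
  have h2 : |(t * bk' t + 3 / 2 * bk t) / t| ≤ Real.sqrt C * t ^ (-(3 / 2) : ℝ) := by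
    refine key t ht _ ?_
    have : t ^ 3 * ((t * bk' t + 3 / 2 * bk t) / t) ^ 2 =
      t * (t * bk' t + 3 / 2 * bk t) ^ 2 := by field_simp
    have h3 : 0 ≤ t ^ 3 * bk t ^ 2 := by positivity
    linarith
  have hpos : 0 ≤ Real.sqrt C * t ^ (-(3 / 2) : ℝ) := by positivity
  refine ⟨by linarith, ?_⟩
  have e : bk' t = (t * bk' t + 3 / 2 * bk t) / t - 3 / 2 * (bk t / t) := by field_simp; ring
  have h4 : |bk t / t| ≤ |bk t| := by
    rw [abs_div, abs_of_pos ht0]; exact div_le_self (abs_nonneg _) ht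
  have h5 := abs_sub ((t * bk' t + 3 / 2 * bk t) / t) (3 / 2 * (bk t / t))
  rw [← e, abs_mul, abs_of_pos (by norm_num : (0 : ℝ) < 3 / 2)] at h5
  linarith

/-- The density `bh` tends to a limit, with the rate `t ^ (-3/2)`. The rate comes from
`h + k' + 3 k / t`, whose derivative is `-3 k / t²`. -/
theorem bh_asymptotic :
    ∃ H C : ℝ, 0 < C ∧ ∀ t, 0 ≤ t → |bh t - H| ≤ C * (1 + t) ^ (-(3 / 2) : ℝ) := by
  obtain ⟨C, hC, hb⟩ := bk_bounds
  set B : ℝ → ℝ := fun t => bh t + bk' t + 3 * (bk t / t) with hB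
  have hd : ∀ t : ℝ, t ∈ Set.Ici (1 : ℝ) → HasDerivAt B (-3 * (bk t / t ^ 2)) t := fun t ht => by
    have ht : 1 ≤ t := ht
    have ht0 : t ≠ 0 := by linarith
    have h1 : HasDerivAt bk' (-3 * bk' t / t - bk t) t := by
      have := (hasDerivAt_mul_bk' t).mul (hasDerivAt_inv ht0)
      refine (this.congr_deriv ?_).congr_of_eventuallyEq ?_
      · field_simp; ring
      · filter_upwards [eventually_ne_nhds ht0] with y hy
        simp only [Pi.mul_apply]
        field_simp
    refine (((hasDerivAt_bh t).add h1).add (((hasDerivAt_bk t).div (hasDerivAt_id t)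
      ht0).const_mul 3)).congr_deriv ?_
    simp only [id]
    field_simp
    ring
  have hbd : ∀ t ∈ Set.Ioi (1 : ℝ), ‖-3 * (bk t / t ^ 2)‖ ≤ 3 * C * t ^ (-(5 / 2) : ℝ) := by
    intro t ht
    have ht : 1 < t := ht
    have ht0 : 0 < t := by linarith
    have h1 := (hb t ht.le).1
    rw [Real.norm_eq_abs, abs_mul, abs_div, abs_of_pos (by positivity : 0 < t ^ 2)]
    have h2 : t ^ (-(5 / 2) : ℝ) = t ^ (-(3 / 2) : ℝ) * t ^ (-1 : ℝ) := by
      rw [← Real.rpow_add ht0]; norm_num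
    rw [h2, Real.rpow_neg_one]
    have h3 : |bk t| / t ^ 2 ≤ |bk t| / t := by
      gcongr
      nlinarith
    have h4 : |bk t| / t ≤ C * t ^ (-(3 / 2) : ℝ) / t := by gcongr
    rw [show |(-3 : ℝ)| = 3 by norm_num]
    rw [div_eq_mul_inv (C * _)] at h4
    linarith
  have hint5 : IntegrableOn (fun t : ℝ => 3 * C * t ^ (-(5 / 2) : ℝ)) (Set.Ioi 1) :=
    (integrableOn_Ioi_rpow_of_lt (by norm_num) zero_lt_one).const_mul _
  have hint : IntegrableOn (fun t => -3 * (bk t / t ^ 2)) (Set.Ioi 1) := by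
    refine Integrable.mono' hint5 ?_ ((ae_restrict_iff' measurableSet_Ioi).2
      (Eventually.of_forall hbd))
    refine ContinuousOn.aestronglyMeasurable (fun t ht => ?_) measurableSet_Ioi
    have : t ^ 2 ≠ 0 := by have : (1 : ℝ) < t := ht; positivity
    exact ((continuous_bk.continuousAt.div (continuous_pow 2).continuousAt this).const_mul
      (-3)).continuousWithinAt
  have hlim := tendsto_limUnder_of_hasDerivAt_of_integrableOn_Ioi
    (fun t ht => hd t (Set.Ioi_subset_Ici_self ht)) hint
  set H := limUnder atTop B
  have htail : ∀ t : ℝ, 1 ≤ t → |B t - H| ≤ 2 * C * t ^ (-(3 / 2) : ℝ) := fun t ht => by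
    have ht0 : 0 < t := by linarith
    have hsub : Set.Ioi t ⊆ Set.Ioi 1 := Set.Ioi_subset_Ioi ht
    have h1 := integral_Ioi_of_hasDerivAt_of_tendsto' (a := t)
      (fun x hx => hd x (ht.trans hx)) (hint.mono_set hsub) hlim
    have h2 : ‖∫ x in Set.Ioi t, -3 * (bk x / x ^ 2)‖ ≤
        ∫ x in Set.Ioi t, 3 * C * x ^ (-(5 / 2) : ℝ) :=
      norm_integral_le_of_norm_le (hint5.mono_set hsub)
        ((ae_restrict_iff' measurableSet_Ioi).2 (Eventually.of_forall fun x hx => hbd x (hsub hx)))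
    rw [h1, integral_const_mul, integral_Ioi_rpow_of_lt (by norm_num) ht0, Real.norm_eq_abs,
      abs_sub_comm] at h2
    refine h2.trans (le_of_eq ?_)
    rw [show (-(5 / 2) + 1 : ℝ) = -(3 / 2) by norm_num]; ring
  have hmain : ∀ t : ℝ, 1 ≤ t → |bh t - H| ≤ 6 * C * t ^ (-(3 / 2) : ℝ) := fun t ht => by
    have ht0 : 0 < t := by linarith
    have h1 := htail t ht
    have h2 := hb t ht
    have h4 : |bk t / t| ≤ |bk t| := by
      rw [abs_div, abs_of_pos ht0]; exact div_le_self (abs_nonneg _) ht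
    have e : bh t - H = (B t - H) - bk' t - 3 * (bk t / t) := by simp only [hB]; ring
    rw [e]
    have h5 := abs_sub (B t - H - bk' t) (3 * (bk t / t))
    have h6 := abs_sub (B t - H) (bk' t)
    rw [abs_mul, abs_of_pos (by norm_num : (0 : ℝ) < 3)] at h5
    linarith
  -- on `[0, 1]` the function is bounded, and on `[1, ∞)` the powers of `t` and `1 + t` are comparable
  obtain ⟨K, hK⟩ := isCompact_Icc.exists_bound_of_continuousOn (s := Set.Icc (0 : ℝ) 1)
    (f := fun t => bh t - H) (continuous_bh.sub continuous_const).continuousOn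
  have hK0 : 0 ≤ K := (norm_nonneg _).trans (hK 0 (by simp))
  have h8 : ∀ t : ℝ, 0 < t → 1 ≤ t → t ^ (-(3 / 2) : ℝ) ≤ 4 * (1 + t) ^ (-(3 / 2) : ℝ) :=
    fun t ht0 ht => by
    have h1 : (2 * t) ^ (-(3 / 2) : ℝ) ≤ (1 + t) ^ (-(3 / 2) : ℝ) :=
      Real.rpow_le_rpow_of_nonpos (by linarith) (by linarith) (by norm_num)
    rw [Real.mul_rpow (by norm_num) ht0.le] at h1
    have h2 : (4 : ℝ)⁻¹ ≤ 2 ^ (-(3 / 2) : ℝ) := by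
      have : (2 : ℝ) ^ (-2 : ℝ) ≤ 2 ^ (-(3 / 2) : ℝ) :=
        Real.rpow_le_rpow_of_exponent_le (by norm_num) (by norm_num)
      refine le_trans (le_of_eq ?_) this
      rw [Real.rpow_neg (by norm_num), Real.rpow_two]; norm_num
    have h3 : 0 ≤ t ^ (-(3 / 2) : ℝ) := by positivity
    nlinarith
  refine ⟨H, 24 * C + 4 * K, by positivity, fun t ht => ?_⟩
  have hp : 0 ≤ (1 + t) ^ (-(3 / 2) : ℝ) := by positivity
  rcases le_total 1 t with h1 | h1
  · have := hmain t h1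
    have := h8 t (by linarith) h1
    nlinarith
  · have h2 := hK t ⟨ht, h1⟩
    rw [Real.norm_eq_abs] at h2
    have h3 : (1 : ℝ) ≤ 4 * (1 + t) ^ (-(3 / 2) : ℝ) := by
      have h4 := h8 1 one_pos le_rfl
      have h5 : ((1 : ℝ) + 1) ^ (-(3 / 2) : ℝ) ≤ (1 + t) ^ (-(3 / 2) : ℝ) :=
        Real.rpow_le_rpow_of_nonpos (by linarith) (by linarith) (by norm_num)
      rw [Real.one_rpow] at h4
      linarith
    nlinarith

/-! ### The function `Π_B` and the numbers `q_k` -/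

/-- The density of `dΠ_B` in the variable `v = log u`. -/
noncomputable def rho (v : ℝ) : ℝ := (1 - Real.cos v) / v

theorem densityB_eq (u : ℝ) : densityB u = rho (Real.log u) := rfl

theorem rho_eq_sinc (v : ℝ) : rho v = v / 2 * Real.sinc (v / 2) ^ 2 := by
  rcases eq_or_ne v 0 with rfl | hv
  · simp [rho]
  · rw [Real.sinc_of_ne_zero (by simpa using hv), rho]
    have : Real.cos v = 1 - 2 * Real.sin (v / 2) ^ 2 := by
      have := Real.cos_two_mul (v / 2)
      rw [mul_div_cancel₀ v two_ne_zero] at this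
      rw [this, Real.cos_sq']; ring
    rw [this]; field_simp; ring

theorem continuous_rho : Continuous rho := by
  have : rho = fun v => v / 2 * Real.sinc (v / 2) ^ 2 := funext rho_eq_sinc
  rw [this]
  have := Real.continuous_sinc
  fun_prop

theorem rho_nonneg {v : ℝ} (hv : 0 ≤ v) : 0 ≤ rho v :=
  div_nonneg (by linarith [Real.cos_le_one v]) hv

theorem rho_le_two_div {v : ℝ} (hv : 0 ≤ v) : rho v ≤ 2 / v :=
  div_le_div_of_nonneg_right (by linarith [Real.neg_one_le_cos v]) hv

theorem rho_le_one {v : ℝ} (hv : 0 ≤ v) : rho v ≤ 1 := by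
  rcases le_total v 2 with h | h
  · rw [rho_eq_sinc]
    have h1 := Real.sinc_le_one (v / 2)
    have h2 := Real.neg_one_le_sinc (v / 2)
    have : Real.sinc (v / 2) ^ 2 ≤ 1 := by nlinarith
    nlinarith [sq_nonneg (Real.sinc (v / 2))]
  · exact (rho_le_two_div hv).trans ((div_le_one (by linarith)).2 h)

theorem mul_rho (v : ℝ) : v * rho v = qd v := by
  rcases eq_or_ne v 0 with rfl | hv
  · simp [rho, qd]
  · rw [rho, qd]; field_simp

theorem continuousAt_densityB {u : ℝ} (hu : 0 < u) : ContinuousAt densityB u :=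
  continuous_rho.continuousAt.comp (Real.continuousAt_log hu.ne')

theorem continuousOn_densityB : ContinuousOn densityB (Set.Ici 1) := fun _ hu =>
  (continuousAt_densityB (lt_of_lt_of_le one_pos hu)).continuousWithinAt

theorem densityB_nonneg {u : ℝ} (hu : 1 ≤ u) : 0 ≤ densityB u :=
  rho_nonneg (Real.log_nonneg hu)

theorem densityB_le_one {u : ℝ} (hu : 1 ≤ u) : densityB u ≤ 1 := rho_le_one (Real.log_nonneg hu)

theorem uIcc_subset_Ici {a b : ℝ} (ha : 1 ≤ a) (hb : 1 ≤ b) : Set.uIcc a b ⊆ Set.Ici 1 :=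
  fun _ hu => (le_min ha hb).trans hu.1

theorem intervalIntegrable_densityB {a b : ℝ} (ha : 1 ≤ a) (hb : 1 ≤ b) :
    IntervalIntegrable densityB volume a b :=
  (continuousOn_densityB.mono (uIcc_subset_Ici ha hb)).intervalIntegrable

theorem PiB_one : PiB 1 = 0 := by simp [PiB]

theorem PiB_sub {a b : ℝ} (ha : 1 ≤ a) (hb : 1 ≤ b) :
    PiB b - PiB a = ∫ u in a..b, densityB u :=
  intervalIntegral.integral_interval_sub_left (intervalIntegrable_densityB le_rfl hb)
    (intervalIntegrable_densityB le_rfl ha)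

theorem hasDerivAt_PiB {x : ℝ} (hx : 1 ≤ x) : HasDerivAt PiB (densityB x) x := by
  have hx0 : 0 < x := by linarith
  refine intervalIntegral.integral_hasDerivAt_right (intervalIntegrable_densityB le_rfl hx) ?_
    (continuousAt_densityB hx0)
  exact ContinuousOn.stronglyMeasurableAtFilter isOpen_Ioi
    (fun u hu => (continuousAt_densityB hu).continuousWithinAt) x hx0

theorem strictMonoOn_PiB : StrictMonoOn PiB (Set.Ici 1) := by
  intro a ha b hb hab
  have ha : 1 ≤ a := ha
  have hb : 1 ≤ b := hb
  rw [← sub_pos, PiB_sub ha hb]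
  refine intervalIntegral.integral_pos hab
    (continuousOn_densityB.mono fun u hu => ha.trans hu.1)
    (fun u hu => densityB_nonneg (ha.trans hu.1.le)) ?_
  -- the zeros `log u ∈ 2πℤ` of the density are isolated
  have hpos : ∀ c, 1 < c → Real.cos (Real.log c) ≠ 1 → 0 < densityB c := fun c hc h =>
    div_pos (sub_pos.2 (lt_of_le_of_ne (Real.cos_le_one _) h)) (Real.log_pos hc)
  by_cases h : Real.cos (Real.log b) = 1
  · have hl : Real.log a < Real.log b := Real.log_lt_log (by linarith) hab
    set δ := min 1 ((Real.log b - Real.log a) / 2) with hδ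
    have hδ0 : 0 < δ := lt_min one_pos (by linarith)
    have hδ1 : δ ≤ 1 := min_le_left _ _
    have hδ2 : δ ≤ (Real.log b - Real.log a) / 2 := min_le_right _ _
    refine ⟨Real.exp (Real.log b - δ), ⟨?_, ?_⟩, hpos _ ?_ ?_⟩
    · rw [← Real.log_le_iff_le_exp (by linarith)]; linarith
    · rw [← Real.le_log_iff_exp_le (by linarith)]; linarith
    · rw [Real.one_lt_exp_iff]
      have := Real.log_nonneg ha
      linarith
    · rw [Real.log_exp, Real.cos_sub, h, Real.sin_eq_zero_iff_cos_eq.2 (Or.inl h)]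
      intro h'
      have := (Real.cos_eq_one_iff_of_lt_of_lt (x := δ) (by linarith [Real.pi_gt_three])
        (by linarith [Real.pi_gt_three])).1 (by linarith)
      linarith
  · exact ⟨b, ⟨hab.le, le_rfl⟩, hpos b (by linarith) h⟩

theorem PiB_le {x : ℝ} (hx : 1 ≤ x) : PiB x ≤ x - 1 := by
  have : PiB x ≤ ∫ _ in (1 : ℝ)..x, (1 : ℝ) :=
    intervalIntegral.integral_mono_on hx (intervalIntegrable_densityB le_rfl hx)
      intervalIntegrable_const fun _ hu => densityB_le_one hu.1
  simpa using this

theorem PiB_nonneg {x : ℝ} (hx : 1 ≤ x) : 0 ≤ PiB x := by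
  rw [← PiB_one]; exact strictMonoOn_PiB.monotoneOn Set.self_mem_Ici hx hx

/-- The main term of `Π_C(x)`. -/
noncomputable def mainC (x : ℝ) : ℝ :=
  x / Real.log x * (2 - √2 * Real.cos (Real.log x - Real.pi / 4))

theorem sqrt_two_mul_cos (v : ℝ) : √2 * Real.cos (v - Real.pi / 4) = Real.cos v + Real.sin v := by
  rw [Real.cos_sub, Real.cos_pi_div_four, Real.sin_pi_div_four]
  have : √2 * √2 = 2 := Real.mul_self_sqrt (by norm_num)
  linear_combination (Real.cos v + Real.sin v) / 2 * this

theorem hasDerivAt_PiC_sub {x : ℝ} (hx : 1 < x) : HasDerivAt (fun x => PiC x - mainC x)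
    ((2 - (Real.cos (Real.log x) + Real.sin (Real.log x))) / Real.log x ^ 2) x := by
  have hx0 : x ≠ 0 := by linarith
  have hl : Real.log x ≠ 0 := (Real.log_pos hx).ne'
  have h1 : mainC = fun x => x / Real.log x *
      (2 - (Real.cos (Real.log x) + Real.sin (Real.log x))) := by
    funext y; rw [mainC, sqrt_two_mul_cos]
  rw [h1]
  have hL := Real.hasDerivAt_log hx0
  refine (((hasDerivAt_PiB hx.le).const_mul 2).sub (((hasDerivAt_id x).div hL hl).mul
    ((hL.cos.add hL.sin).const_sub 2))).congr_deriv ?_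
  simp only [densityB, Pi.add_apply, Pi.div_apply, id]
  field_simp
  ring

/-- The asymptotic formula for `Π_C`: the derivative of the error is at most `4 / log² x`, which
is at most `8` times the derivative of `x / log² x`. -/
theorem PiC_asymptotic :
    (fun x => PiC x - mainC x) =O[atTop] fun x : ℝ => x / Real.log x ^ 2 := by
  set a := Real.exp 4
  set H := fun x => PiC x - mainC x
  set U := fun x : ℝ => x / Real.log x ^ 2
  have hlog : ∀ x, a ≤ x → 1 < x ∧ 4 ≤ Real.log x := fun x hx => by
    have hx0 : 0 < x := (Real.exp_pos 4).trans_le hx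
    have h4 : 4 ≤ Real.log x := (Real.le_log_iff_exp_le hx0).2 hx
    exact ⟨(Real.log_pos_iff hx0.le).1 (by linarith), h4⟩
  have hdU : ∀ x, a ≤ x → HasDerivAt U (1 / Real.log x ^ 2 - 2 / Real.log x ^ 3) x := fun x hx => by
    obtain ⟨h1, h4⟩ := hlog x hx
    have hx0 : x ≠ 0 := by linarith
    have hl : Real.log x ≠ 0 := by linarith
    refine ((hasDerivAt_id x).div ((Real.hasDerivAt_log hx0).pow 2)
      (pow_ne_zero 2 hl)).congr_deriv ?_
    simp only [id, Pi.pow_apply]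
    push_cast
    field_simp
  have hH : ∀ x, a ≤ x → HasDerivAt H
      ((2 - (Real.cos (Real.log x) + Real.sin (Real.log x))) / Real.log x ^ 2) x := fun x hx =>
    hasDerivAt_PiC_sub (hlog x hx).1
  have hb : ∀ x : ℝ, -4 ≤ 2 - (Real.cos x + Real.sin x) ∧
      2 - (Real.cos x + Real.sin x) ≤ 4 := fun x => by
    constructor <;> linarith [Real.cos_le_one x, Real.sin_le_one x, Real.neg_one_le_cos x,
      Real.neg_one_le_sin x]
  have hU' : ∀ x, a ≤ x → 4 / Real.log x ^ 2 ≤ 8 * (1 / Real.log x ^ 2 - 2 / Real.log x ^ 3) :=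
    fun x hx => by
    have h4 := (hlog x hx).2
    have hl : Real.log x ≠ 0 := by linarith
    have e : 8 * (1 / Real.log x ^ 2 - 2 / Real.log x ^ 3) - 4 / Real.log x ^ 2 =
      4 * (Real.log x - 4) / Real.log x ^ 3 := by field_simp; ring
    have : 0 ≤ 4 * (Real.log x - 4) / Real.log x ^ 3 :=
      div_nonneg (by linarith) (by positivity)
    linarith
  have hm1 : MonotoneOn (fun x => 8 * U x - H x) (Set.Ici a) := by
    refine monotoneOn_of_deriv_nonneg (convex_Ici a)
      (fun x hx => (((hdU x hx).const_mul 8).sub (hH x hx)).continuousAt.continuousWithinAt)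
      (fun x hx => ?_) (fun x hx => ?_)
    · rw [interior_Ici] at hx
      exact (((hdU x (le_of_lt hx)).const_mul 8).sub
        (hH x (le_of_lt hx))).differentiableAt.differentiableWithinAt
    · rw [interior_Ici] at hx
      have hx : a ≤ x := le_of_lt hx
      have hdx : HasDerivAt (fun x => 8 * U x - H x) _ x :=
        ((hdU x hx).const_mul 8).sub (hH x hx)
      rw [hdx.deriv]
      have := div_le_div_of_nonneg_right (hb (Real.log x)).2 (sq_nonneg (Real.log x))
      linarith [hU' x hx]
  have hm2 : MonotoneOn (fun x => 8 * U x + H x) (Set.Ici a) := by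
    refine monotoneOn_of_deriv_nonneg (convex_Ici a)
      (fun x hx => (((hdU x hx).const_mul 8).add (hH x hx)).continuousAt.continuousWithinAt)
      (fun x hx => ?_) (fun x hx => ?_)
    · rw [interior_Ici] at hx
      exact (((hdU x (le_of_lt hx)).const_mul 8).add
        (hH x (le_of_lt hx))).differentiableAt.differentiableWithinAt
    · rw [interior_Ici] at hx
      have hx : a ≤ x := le_of_lt hx
      have hdx : HasDerivAt (fun x => 8 * U x + H x) _ x :=
        ((hdU x hx).const_mul 8).add (hH x hx)
      rw [hdx.deriv]
      have := div_le_div_of_nonneg_right (hb (Real.log x)).1 (sq_nonneg (Real.log x))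
      rw [neg_div] at this
      linarith [hU' x hx]
  have hmU : MonotoneOn U (Set.Ici a) := fun x hx y hy hxy => by
    have h1 := hm1 hx hy hxy
    have h2 := hm2 hx hy hxy
    simp only at h1 h2
    linarith
  have hUa : 0 < U a := div_pos (Real.exp_pos 4) (by simp [a])
  refine IsBigO.of_bound (8 + |H a| / U a) ?_
  filter_upwards [eventually_ge_atTop a] with x hx
  have h1 := hm1 Set.self_mem_Ici hx hx
  have h2 := hm2 Set.self_mem_Ici hx hx
  have h3 := hmU Set.self_mem_Ici hx hx
  simp only at h1 h2
  rw [Real.norm_eq_abs, Real.norm_eq_abs, abs_of_pos (hUa.trans_le h3)]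
  have h4 : |H a| ≤ |H a| / U a * U x := by
    rw [div_mul_eq_mul_div, le_div_iff₀ hUa]; gcongr
  have h5 := neg_abs_le (H a)
  have h6 := le_abs_self (H a)
  change |H x| ≤ (8 + |H a| / U a) * U x
  rw [abs_le]
  constructor <;> nlinarith

theorem mainC_bounds {x : ℝ} (hx : 1 < x) :
    1 / 2 * (x / Real.log x) ≤ mainC x ∧ mainC x ≤ 4 * (x / Real.log x) := by
  have hp : 0 < x / Real.log x := div_pos (by linarith) (Real.log_pos hx)
  have h1 := Real.cos_le_one (Real.log x - Real.pi / 4)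
  have h2 := Real.neg_one_le_cos (Real.log x - Real.pi / 4)
  have h3 : √2 ≤ 3 / 2 := by
    rw [Real.sqrt_le_left (by norm_num)]; norm_num
  have h4 : 0 ≤ √2 := Real.sqrt_nonneg 2
  rw [mainC]
  constructor
  · rw [mul_comm]; gcongr; nlinarith
  · rw [mul_comm]; gcongr; nlinarith

/-- A function with the same asymptotic formula as `Π_C` satisfies Chebyshev bounds. -/
theorem isTheta_of_asymptotic {F : ℝ → ℝ}
    (h : (fun x => F x - mainC x) =O[atTop] fun x : ℝ => x / Real.log x ^ 2) :
    F =Θ[atTop] fun x : ℝ => x / Real.log x := by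
  obtain ⟨K, hK0, hK⟩ := h.exists_pos
  have hK := hK.bound
  have hev : ∀ᶠ x : ℝ in atTop, 1 / 4 * (x / Real.log x) ≤ F x ∧ F x ≤ 5 * (x / Real.log x) ∧
      0 < x / Real.log x := by
    filter_upwards [hK, Real.tendsto_log_atTop.eventually_ge_atTop (4 * K + 1),
      eventually_gt_atTop 1] with x hx hl hx1
    have hlp := Real.log_pos hx1
    have hp : 0 < x / Real.log x := div_pos (by linarith) hlp
    have hU : x / Real.log x ^ 2 = x / Real.log x / Real.log x := by field_simp
    rw [Real.norm_eq_abs, Real.norm_eq_abs, hU, abs_of_pos (div_pos hp hlp)] at hx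
    have h1 : K * (x / Real.log x / Real.log x) ≤ 1 / 4 * (x / Real.log x) := by
      rw [← mul_div_assoc, div_le_iff₀ hlp]
      nlinarith
    have h2 := abs_le.1 hx
    have h3 := mainC_bounds hx1
    exact ⟨by linarith, by linarith, hp⟩
  constructor
  · refine IsBigO.of_bound 5 ?_
    filter_upwards [hev] with x hx
    rw [Real.norm_eq_abs, Real.norm_eq_abs, abs_of_pos hx.2.2, abs_of_nonneg (by linarith)]
    exact hx.2.1
  · refine IsBigO.of_bound 4 ?_
    filter_upwards [hev] with x hx
    rw [Real.norm_eq_abs, Real.norm_eq_abs, abs_of_pos hx.2.2, abs_of_nonneg (by linarith)]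
    linarith

theorem tendsto_div_log_pow (n : ℕ) :
    Tendsto (fun x : ℝ => x / Real.log x ^ n) atTop atTop := by
  have h := (Real.isLittleO_pow_log_id_atTop (n := n)).tendsto_div_nhds_zero
  have h2 : Tendsto (fun x : ℝ => Real.log x ^ n / x) atTop (nhdsWithin 0 (Set.Ioi 0)) := by
    refine tendsto_nhdsWithin_iff.2 ⟨h, ?_⟩
    filter_upwards [eventually_gt_atTop 1] with x hx
    exact div_pos (pow_pos (Real.log_pos hx) n) (by linarith)
  refine h2.inv_tendsto_nhdsGT_zero.congr fun x => ?_
  simp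

theorem tendsto_PiB : Tendsto PiB atTop atTop := by
  have h := (isTheta_of_asymptotic PiC_asymptotic).2
  obtain ⟨K, hK0, hK⟩ := h.exists_pos
  have hb := hK.bound
  have ht : Tendsto (fun x : ℝ => x / Real.log x) atTop atTop := by
    simpa using tendsto_div_log_pow 1
  refine tendsto_atTop_mono' _ ?_ (ht.atTop_div_const (show 0 < 2 * K by positivity))
  filter_upwards [hb, eventually_ge_atTop 1] with x hx h1
  rw [PiC, Real.norm_eq_abs, Real.norm_eq_abs,
    abs_of_nonneg (by linarith [PiB_nonneg h1] : 0 ≤ 2 * PiB x)] at hx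
  rw [div_le_iff₀ (by positivity)]
  have := le_abs_self (x / Real.log x)
  linarith

theorem exists_PiB_eq (k : ℕ) : ∃ x ∈ Set.Ici (1 : ℝ), PiB x = k := by
  obtain ⟨b, hb1, hb⟩ := ((eventually_ge_atTop 1).and
    (tendsto_PiB.eventually_ge_atTop (k : ℝ))).exists
  have hc : ContinuousOn PiB (Set.Icc 1 b) := fun x hx =>
    (hasDerivAt_PiB hx.1).continuousAt.continuousWithinAt
  obtain ⟨x, hx, hxk⟩ := intermediate_value_Icc hb1 hc
    (show (k : ℝ) ∈ Set.Icc (PiB 1) (PiB b) by rw [PiB_one]; exact ⟨Nat.cast_nonneg k, hb⟩)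
  exact ⟨x, hx.1, hxk⟩

theorem one_le_q (k : ℕ) : 1 ≤ q k := Function.invFunOn_mem (exists_PiB_eq k)

theorem PiB_q (k : ℕ) : PiB (q k) = k := Function.invFunOn_eq (exists_PiB_eq k)

theorem q_le_iff {k : ℕ} {x : ℝ} (hx : 1 ≤ x) : q k ≤ x ↔ (k : ℝ) ≤ PiB x := by
  rw [← PiB_q k]; exact (strictMonoOn_PiB.le_iff_le (one_le_q k) hx).symm

theorem strictMono_q : StrictMono q := fun i j hij => by
  rw [← strictMonoOn_PiB.lt_iff_lt (one_le_q i) (one_le_q j), PiB_q, PiB_q]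
  exact_mod_cast hij

theorem q_zero : q 0 = 1 :=
  strictMonoOn_PiB.injOn (one_le_q 0) Set.self_mem_Ici (by rw [PiB_q, PiB_one]; simp)

theorem add_one_le_q (k : ℕ) : (k : ℝ) + 1 ≤ q k := by
  have := PiB_le (one_le_q k)
  rw [PiB_q] at this; linarith

theorem tendsto_q : Tendsto q atTop atTop :=
  tendsto_atTop_mono (fun k => (by linarith [add_one_le_q k] : (k : ℝ) ≤ q k))
    tendsto_natCast_atTop_atTop

theorem two_le_sysD (i : ℕ) : 2 ≤ sysD i := by
  have := add_one_le_q (i + 1)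
  push_cast at this
  rw [sysD]; linarith [(Nat.cast_nonneg i : (0 : ℝ) ≤ i)]

theorem isGPrimeSystem_sysD : IsGPrimeSystem sysD :=
  ⟨by linarith [two_le_sysD 0], fun i j h => strictMono_q.monotone (by omega),
    tendsto_q.comp (tendsto_add_atTop_nat 1)⟩

theorem sysP_eq (i : ℕ) : sysP i = sysD (i / 2) := rfl

theorem isGPrimeSystem_sysP : IsGPrimeSystem sysP :=
  ⟨by linarith [two_le_sysD 0, sysP_eq 0], fun i j h => isGPrimeSystem_sysD.2.1 (by omega),
    isGPrimeSystem_sysD.2.2.comp (Nat.tendsto_div_const_atTop two_ne_zero)⟩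

theorem sysD_le_iff {i : ℕ} {x : ℝ} (hx : 1 ≤ x) : sysD i ≤ x ↔ i < ⌊PiB x⌋₊ := by
  rw [sysD, q_le_iff hx, ← Nat.le_floor_iff (PiB_nonneg hx)]; rfl

theorem primeCount_sysP {x : ℝ} (hx : 1 ≤ x) : primeCount sysP x = 2 * ⌊PiB x⌋₊ := by
  have : {i : ℕ | sysP i ≤ x} = (Finset.range (2 * ⌊PiB x⌋₊) : Set ℕ) := by
    ext i
    simp only [Set.mem_ofPred_eq, sysP_eq, sysD_le_iff hx, Finset.coe_range, Set.mem_Iio]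
    omega
  rw [primeCount, this, Set.ncard_coe_finset, Finset.card_range]
  push_cast; rfl

theorem primeCount_sysP_asymptotic :
    (fun x => primeCount sysP x - mainC x) =O[atTop] fun x : ℝ => x / Real.log x ^ 2 := by
  have h : (fun x => primeCount sysP x - PiC x) =O[atTop] fun x : ℝ => x / Real.log x ^ 2 := by
    refine IsBigO.of_bound 2 ?_
    filter_upwards [(tendsto_div_log_pow 2).eventually_ge_atTop 1, eventually_ge_atTop 1]
      with x hx h1
    rw [primeCount_sysP h1, PiC, Real.norm_eq_abs, Real.norm_eq_abs,
      abs_of_pos (show 0 < x / Real.log x ^ 2 by linarith)]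
    have h2 := Nat.floor_le (PiB_nonneg h1)
    have h3 := Nat.lt_floor_add_one (PiB x)
    rw [abs_le]; constructor <;> linarith
  refine (h.add PiC_asymptotic).congr_left fun x => ?_
  ring

/-- Comparison of a sum over the `q_k` with an integral against `dΠ_B`. Each interval
`(q_{k-1}, q_k]` has mass `1` for `dΠ_B`. -/
theorem norm_sum_q_sub_integral_le {E : Type*} [NormedAddCommGroup E] [NormedSpace ℝ E]
    [CompleteSpace E] {φ φ' : ℝ → E} (hd : ∀ u, 1 ≤ u → HasDerivAt φ (φ' u) u)
    (hc : ContinuousOn φ' (Set.Ici 1)) (n : ℕ) :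
    ‖∑ i ∈ Finset.range n, φ (sysD i) - ∫ u in (1 : ℝ)..q n, densityB u • φ u‖ ≤
      ∫ u in (1 : ℝ)..q n, ‖φ' u‖ := by
  have hφ : ContinuousOn φ (Set.Ici 1) := fun u hu => (hd u hu).continuousAt.continuousWithinAt
  have hint : ∀ a b : ℝ, 1 ≤ a → 1 ≤ b →
      IntervalIntegrable (fun u => densityB u • φ u) volume a b := fun a b ha hb =>
    ((continuousOn_densityB.smul hφ).mono (uIcc_subset_Ici ha hb)).intervalIntegrable
  have hint' : ∀ a b : ℝ, 1 ≤ a → 1 ≤ b →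
      IntervalIntegrable (fun u => ‖φ' u‖) volume a b := fun a b ha hb =>
    (hc.norm.mono (uIcc_subset_Ici ha hb)).intervalIntegrable
  induction n with
  | zero => simp [q_zero]
  | succ n ih =>
    have ha := one_le_q n
    have hb := one_le_q (n + 1)
    have hab : q n ≤ q (n + 1) := (strictMono_q (Nat.lt_succ_self n)).le
    set V := ∫ u in q n..q (n + 1), ‖φ' u‖
    have hmass : ∫ u in q n..q (n + 1), densityB u = 1 := by
      rw [← PiB_sub ha hb, PiB_q, PiB_q]; push_cast; ring
    have hstep : ‖φ (q (n + 1)) - ∫ u in q n..q (n + 1), densityB u • φ u‖ ≤ V := by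
      have e : φ (q (n + 1)) - ∫ u in q n..q (n + 1), densityB u • φ u =
          ∫ u in q n..q (n + 1), densityB u • (φ (q (n + 1)) - φ u) := by
        have hconst : IntervalIntegrable (fun u => densityB u • φ (q (n + 1))) volume
            (q n) (q (n + 1)) := ((continuousOn_densityB.smul
          continuousOn_const).mono (uIcc_subset_Ici ha hb)).intervalIntegrable
        simp only [smul_sub]
        rw [intervalIntegral.integral_sub hconst (hint _ _ ha hb),
          intervalIntegral.integral_smul_const, hmass, one_smul]
      have hV : ∫ u in q n..q (n + 1), densityB u * V = V := by
        rw [intervalIntegral.integral_mul_const, hmass, one_mul]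
      rw [e, ← hV]
      refine intervalIntegral.norm_integral_le_of_norm_le hab (Eventually.of_forall fun u hu => ?_)
        ((intervalIntegrable_densityB ha hb).mul_const _)
      have hu1 : 1 ≤ u := ha.trans hu.1.le
      rw [norm_smul, Real.norm_of_nonneg (densityB_nonneg hu1)]
      refine mul_le_mul_of_nonneg_left ?_ (densityB_nonneg hu1)
      rw [← intervalIntegral.integral_eq_sub_of_hasDerivAt (f := φ) (f' := φ')
        (fun v hv => hd v (uIcc_subset_Ici hu1 hb hv))
        (hc.mono (uIcc_subset_Ici hu1 hb)).intervalIntegrable]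
      refine (intervalIntegral.norm_integral_le_integral_norm hu.2).trans ?_
      exact intervalIntegral.integral_mono_interval hu.1.le hu.2 le_rfl
        (Eventually.of_forall fun v => norm_nonneg _) (hint' _ _ ha hb)
    rw [Finset.sum_range_succ, ← intervalIntegral.integral_add_adjacent_intervals
      (hint 1 _ le_rfl ha) (hint _ _ ha hb), ← intervalIntegral.integral_add_adjacent_intervals
      (hint' 1 _ le_rfl ha) (hint' _ _ ha hb)]
    refine le_trans (le_of_eq ?_) ((norm_add_le _ _).trans (add_le_add ih hstep))
    rw [sysD]; congr 1; abel

theorem integral_densityB_div {x : ℝ} (hx : 1 ≤ x) :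
    ∫ u in (1 : ℝ)..x, densityB u * u⁻¹ = ∫ v in (0 : ℝ)..Real.log x, rho v := by
  have := intervalIntegral.integral_comp_mul_deriv (a := 1) (b := x) (f := Real.log)
    (f' := fun u => u⁻¹) (g := rho)
    (fun u hu => Real.hasDerivAt_log (by linarith [uIcc_subset_Ici le_rfl hx hu |>.out]))
    (fun u hu => (continuousAt_inv₀ (by
      linarith [uIcc_subset_Ici le_rfl hx hu |>.out])).continuousWithinAt) continuous_rho
  rw [Real.log_one] at this
  exact this

theorem integral_inv_sq_le {x : ℝ} (hx : 1 ≤ x) : ∫ u in (1 : ℝ)..x, (u ^ 2)⁻¹ ≤ 1 := by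
  rw [intervalIntegral.integral_eq_sub_of_hasDerivAt (f := fun u : ℝ => -u⁻¹)
    (fun u hu => by
      have : (1 : ℝ) ≤ u := uIcc_subset_Ici le_rfl hx hu
      exact (hasDerivAt_inv (by linarith)).neg.congr_deriv (neg_neg _))]
  · have : 0 ≤ x⁻¹ := by positivity
    simp; linarith
  · refine ContinuousOn.intervalIntegrable fun u hu => ?_
    have : (1 : ℝ) ≤ u := uIcc_subset_Ici le_rfl hx hu
    exact ((continuous_pow 2).continuousAt.inv₀ (by positivity)).continuousWithinAt

/-- Mertens' estimate for the `q_k`, with a bounded error. -/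
theorem abs_sum_inv_sysD_sub_le (n : ℕ) :
    |∑ i ∈ Finset.range n, (sysD i)⁻¹ - ∫ v in (0 : ℝ)..Real.log (q n), rho v| ≤ 1 := by
  have h := norm_sum_q_sub_integral_le (φ := fun u : ℝ => u⁻¹) (φ' := fun u => -(u ^ 2)⁻¹)
    (fun u hu => hasDerivAt_inv (by linarith))
    (fun u hu => by
      have : (1 : ℝ) ≤ u := hu
      exact ((continuous_pow 2).continuousAt.inv₀ (by positivity)).neg.continuousWithinAt) n
  simp only [smul_eq_mul, Real.norm_eq_abs, abs_neg] at h
  rw [integral_densityB_div (one_le_q n)] at h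
  refine h.trans (le_trans (le_of_eq ?_) (integral_inv_sq_le (one_le_q n)))
  refine intervalIntegral.integral_congr fun u _ => ?_
  rw [abs_of_nonneg (by positivity)]

theorem integral_rho_le {t : ℝ} (ht : 0 ≤ t) :
    ∫ v in (0 : ℝ)..t, rho v ≤ 4 * Real.log (1 + t) := by
  have h1 : ∀ v, 0 ≤ v → rho v ≤ 4 * (1 + v)⁻¹ := fun v hv => by
    rcases le_total v 1 with h | h
    · have := rho_le_one hv
      have h2 : (1 : ℝ) ≤ 4 * (1 + v)⁻¹ := by
        rw [← div_eq_mul_inv, le_div_iff₀ (by linarith)]; linarith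
      linarith
    · refine (rho_le_two_div hv).trans ?_
      rw [← div_eq_mul_inv, div_le_div_iff₀ (by linarith) (by linarith)]; linarith
  have hd : ∀ v ∈ Set.uIcc 0 t,
      HasDerivAt (fun v => 4 * Real.log (1 + v)) (4 * (1 + v)⁻¹) v := fun v hv => by
    rw [Set.uIcc_of_le ht] at hv
    refine ((((hasDerivAt_id v).const_add 1).log
      (by have := hv.1; simp only [id]; linarith)).const_mul 4).congr_deriv ?_
    simp
  have hi : IntervalIntegrable (fun v : ℝ => 4 * (1 + v)⁻¹) volume 0 t := by
    refine ContinuousOn.intervalIntegrable fun v hv => ?_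
    rw [Set.uIcc_of_le ht] at hv
    refine ContinuousAt.continuousWithinAt (ContinuousAt.const_mul ?_ 4)
    exact ContinuousAt.inv₀ (by fun_prop) (by linarith [hv.1])
  have h2 := intervalIntegral.integral_eq_sub_of_hasDerivAt hd hi
  have h3 := intervalIntegral.integral_mono_on ht (continuous_rho.intervalIntegrable _ _) hi
    fun v hv => h1 v hv.1
  rw [h2] at h3
  simpa using h3

theorem le_integral_rho {t : ℝ} (ht : 1 ≤ t) :
    Real.log t - 3 ≤ ∫ v in (0 : ℝ)..t, rho v := by
  have hne : ∀ v ∈ Set.uIcc 1 t, 1 ≤ v := fun v hv => uIcc_subset_Ici le_rfl ht hv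
  have hd : ∀ v ∈ Set.uIcc 1 t, HasDerivAt (fun v => Real.log v - Real.sin v / v + v⁻¹)
      (rho v + (Real.sin v - 1) / v ^ 2) v := fun v hv => by
    have hv0 : v ≠ 0 := by linarith [hne v hv]
    refine (((Real.hasDerivAt_log hv0).sub ((Real.hasDerivAt_sin v).div (hasDerivAt_id v)
      hv0)).add (hasDerivAt_inv hv0)).congr_deriv ?_
    simp only [rho, id]
    field_simp
    ring
  have hi : IntervalIntegrable (fun v => rho v + (Real.sin v - 1) / v ^ 2) volume 1 t := by
    refine ContinuousOn.intervalIntegrable fun v hv => ?_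
    have hv0 := hne v hv
    exact (continuous_rho.continuousAt.add (ContinuousAt.div (by fun_prop)
      (continuous_pow 2).continuousAt (by positivity))).continuousWithinAt
  have h2 := intervalIntegral.integral_eq_sub_of_hasDerivAt hd hi
  have h3 := intervalIntegral.integral_mono_on ht hi (continuous_rho.intervalIntegrable 1 t)
    fun v hv => by
      have : (Real.sin v - 1) / v ^ 2 ≤ 0 :=
        div_nonpos_of_nonpos_of_nonneg (by linarith [Real.sin_le_one v]) (sq_nonneg v)
      linarith
  have h4 := intervalIntegral.integral_add_adjacent_intervals
    (continuous_rho.intervalIntegrable 0 1) (continuous_rho.intervalIntegrable (μ := volume) 1 t)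
  have h5 : 0 ≤ ∫ v in (0 : ℝ)..1, rho v :=
    intervalIntegral.integral_nonneg zero_le_one fun v hv => rho_nonneg hv.1
  have h6 : Real.sin t / t ≤ 1 := by
    rw [div_le_one (by linarith)]; linarith [Real.sin_le_one t]
  have h7 := Real.neg_one_le_sin 1
  have h8 : 0 ≤ t⁻¹ := by positivity
  rw [h2] at h3
  simp at h3
  linarith

theorem tendsto_sum_inv_sysD :
    Tendsto (fun n => ∑ i ∈ Finset.range n, (sysD i)⁻¹) atTop atTop := by
  have h : Tendsto (fun n => Real.log (Real.log (q n)) - 4) atTop atTop :=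
    tendsto_atTop_add_const_right _ (-4)
      (Real.tendsto_log_atTop.comp (Real.tendsto_log_atTop.comp tendsto_q))
  refine tendsto_atTop_mono' _ ?_ h
  filter_upwards [(Real.tendsto_log_atTop.comp tendsto_q).eventually_ge_atTop 1] with n hn
  have h1 := le_integral_rho hn
  have h2 := abs_le.1 (abs_sum_inv_sysD_sub_le n)
  simp only [Function.comp_apply] at h1
  linarith

theorem q_floor_le {x : ℝ} (hx : 1 ≤ x) : q ⌊PiB x⌋₊ ≤ x :=
  (q_le_iff hx).2 (Nat.floor_le (PiB_nonneg hx))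

theorem sum_inv_sysD_le {x : ℝ} (hx : 1 ≤ x) :
    ∑ i ∈ Finset.range ⌊PiB x⌋₊, (sysD i)⁻¹ ≤ 1 + 4 * Real.log (1 + Real.log x) := by
  have h1 := abs_le.1 (abs_sum_inv_sysD_sub_le ⌊PiB x⌋₊)
  have h2 := integral_rho_le (Real.log_nonneg (one_le_q ⌊PiB x⌋₊))
  have h0 := Real.log_nonneg (one_le_q ⌊PiB x⌋₊)
  have h3 : Real.log (q ⌊PiB x⌋₊) ≤ Real.log x :=
    Real.log_le_log (by linarith [one_le_q ⌊PiB x⌋₊]) (q_floor_le hx)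
  have h4 : Real.log (1 + Real.log (q ⌊PiB x⌋₊)) ≤ Real.log (1 + Real.log x) :=
    Real.log_le_log (by linarith) (by linarith)
  linarith

theorem log_mul_densityB (u : ℝ) : densityB u * Real.log u = qd (Real.log u) := by
  rw [densityB_eq, mul_comm, mul_rho]

theorem continuousOn_qd_log : ContinuousOn (fun u => qd (Real.log u)) (Set.Ici 1) := fun u hu =>
  (continuous_qd.continuousAt.comp (Real.continuousAt_log (by
    have : (1 : ℝ) ≤ u := hu
    linarith))).continuousWithinAt

/-- Comparison of the Chebyshev function `∑_{q_k ≤ x} log q_k` with `∫ log u dΠ_B(u)`. -/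
theorem abs_sum_log_sysD_sub_le {x : ℝ} (hx : 1 ≤ x) :
    |∑ i ∈ Finset.range ⌊PiB x⌋₊, Real.log (sysD i) - ∫ u in (1 : ℝ)..x, qd (Real.log u)| ≤
      2 * Real.log x := by
  set n := ⌊PiB x⌋₊
  have hn := one_le_q n
  have hnx := q_floor_le hx
  have h := norm_sum_q_sub_integral_le (φ := Real.log) (φ' := fun u => u⁻¹)
    (fun u hu => Real.hasDerivAt_log (by linarith))
    (fun u hu => by
      have : (1 : ℝ) ≤ u := hu
      exact (continuousAt_inv₀ (by linarith)).continuousWithinAt) n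
  simp only [smul_eq_mul, Real.norm_eq_abs, log_mul_densityB] at h
  have h1 : ∫ u in (1 : ℝ)..q n, |u⁻¹| ≤ Real.log x := by
    have : ∫ u in (1 : ℝ)..q n, |u⁻¹| = ∫ u in (1 : ℝ)..q n, u⁻¹ :=
      intervalIntegral.integral_congr fun u hu => abs_of_nonneg (by
        have : (1 : ℝ) ≤ u := uIcc_subset_Ici le_rfl hn hu
        positivity)
    rw [this, integral_inv_of_pos one_pos (by linarith), div_one]
    exact Real.log_le_log (by linarith) hnx
  have hi : ∀ a b : ℝ, 1 ≤ a → 1 ≤ b →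
      IntervalIntegrable (fun u => qd (Real.log u)) volume a b := fun a b ha hb =>
    (continuousOn_qd_log.mono (uIcc_subset_Ici ha hb)).intervalIntegrable
  have h2 : |∫ u in q n..x, qd (Real.log u)| ≤ Real.log x := by
    have hle : ∫ u in q n..x, qd (Real.log u) ≤ ∫ u in q n..x, densityB u * Real.log x := by
      refine intervalIntegral.integral_mono_on hnx (hi _ _ hn hx)
        ((intervalIntegrable_densityB hn hx).mul_const _) fun u hu => ?_
      rw [← log_mul_densityB]
      exact mul_le_mul_of_nonneg_left (Real.log_le_log (by linarith [hu.1]) hu.2)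
        (densityB_nonneg (hn.trans hu.1))
    have hnn : 0 ≤ ∫ u in q n..x, qd (Real.log u) :=
      intervalIntegral.integral_nonneg hnx fun u _ => by
        rw [qd]; linarith [Real.cos_le_one (Real.log u)]
    rw [abs_of_nonneg hnn]
    refine hle.trans ?_
    rw [intervalIntegral.integral_mul_const, ← PiB_sub hn hx, PiB_q]
    have : PiB x - n ≤ 1 := by linarith [Nat.lt_floor_add_one (PiB x)]
    exact mul_le_of_le_one_left (Real.log_nonneg hx) this
  rw [← intervalIntegral.integral_add_adjacent_intervals (hi 1 _ le_rfl hn) (hi _ _ hn hx)]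
  have h3 := abs_sub (∑ i ∈ Finset.range n, Real.log (sysD i) - ∫ u in (1 : ℝ)..q n, qd (Real.log u))
    (∫ u in q n..x, qd (Real.log u))
  rw [sub_sub] at h3
  linarith

/-! ### Sums over g-integers and over powers of g-primes -/

section System

variable {p : ℕ → ℝ}

theorem IsGPrimeSystem.one_lt (hp : IsGPrimeSystem p) (i : ℕ) : 1 < p i :=
  hp.1.trans_le (hp.2.1 (Nat.zero_le i))

theorem IsGPrimeSystem.log_pos (hp : IsGPrimeSystem p) (i : ℕ) : 0 < Real.log (p i) :=
  Real.log_pos (hp.one_lt i)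

/-- The logarithm of a g-integer. -/
noncomputable def lg (p : ℕ → ℝ) (a : ℕ →₀ ℕ) : ℝ := Real.log (gInt p a)

theorem gInt_pos (hp : IsGPrimeSystem p) (a : ℕ →₀ ℕ) : 0 < gInt p a :=
  Finset.prod_pos fun i _ => pow_pos (zero_lt_one.trans (hp.one_lt i)) _

theorem one_le_gInt (hp : IsGPrimeSystem p) (a : ℕ →₀ ℕ) : 1 ≤ gInt p a :=
  Finset.one_le_prod fun i _ => one_le_pow₀ (hp.one_lt i).le

theorem gInt_zero : gInt p 0 = 1 := Finsupp.prod_zero_index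

theorem gInt_add (a b : ℕ →₀ ℕ) : gInt p (a + b) = gInt p a * gInt p b :=
  Finsupp.prod_add_index' (fun _ => pow_zero _) fun _ _ _ => pow_add _ _ _

theorem gInt_single (i m : ℕ) : gInt p (Finsupp.single i m) = p i ^ m :=
  Finsupp.prod_single_index (pow_zero _)

theorem lg_nonneg (hp : IsGPrimeSystem p) (a : ℕ →₀ ℕ) : 0 ≤ lg p a :=
  Real.log_nonneg (one_le_gInt hp a)

theorem lg_add (hp : IsGPrimeSystem p) (a b : ℕ →₀ ℕ) : lg p (a + b) = lg p a + lg p b := by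
  rw [lg, gInt_add, Real.log_mul (gInt_pos hp a).ne' (gInt_pos hp b).ne']; rfl

theorem lg_single (i m : ℕ) : lg p (Finsupp.single i m) = m * Real.log (p i) := by
  rw [lg, gInt_single, Real.log_pow]

theorem lg_eq_sum (hp : IsGPrimeSystem p) (a : ℕ →₀ ℕ) :
    lg p a = ∑ i ∈ a.support, a i * Real.log (p i) := by
  rw [lg, gInt, Finsupp.prod, Real.log_prod]
  · simp only [Real.log_pow]
  · exact fun i _ => (pow_pos (zero_lt_one.trans (hp.one_lt i)) _).ne'

theorem mul_log_le_lg (hp : IsGPrimeSystem p) (a : ℕ →₀ ℕ) (i : ℕ) :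
    a i * Real.log (p i) ≤ lg p a := by
  by_cases h : i ∈ a.support
  · rw [lg_eq_sum hp]
    exact Finset.single_le_sum (f := fun i => (a i : ℝ) * Real.log (p i))
      (fun j _ => mul_nonneg (Nat.cast_nonneg _) (hp.log_pos j).le) h
  · rw [Finsupp.notMem_support_iff.1 h]; simpa using lg_nonneg hp a

theorem exists_lt_log (hp : IsGPrimeSystem p) (t : ℝ) : ∃ n, ∀ i, n ≤ i → t < Real.log (p i) :=
  eventually_atTop.1 ((Real.tendsto_log_atTop.comp hp.2.2).eventually_gt_atTop t)

theorem le_floor_of_mul_log_le (hp : IsGPrimeSystem p) {m i : ℕ} {t : ℝ}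
    (h : m * Real.log (p i) ≤ t) : m ≤ ⌊t / Real.log (p 0)⌋₊ := by
  refine Nat.le_floor ?_
  rw [le_div_iff₀ (hp.log_pos 0)]
  refine le_trans ?_ h
  gcongr
  · exact zero_lt_one.trans hp.1
  · exact hp.2.1 (Nat.zero_le i)

theorem finite_lg_le (hp : IsGPrimeSystem p) (t : ℝ) : {a | lg p a ≤ t}.Finite := by
  obtain ⟨n, hn⟩ := exists_lt_log hp t
  refine (Finset.finite_toSet ((Finset.range n).finsupp
    fun _ => Finset.range (⌊t / Real.log (p 0)⌋₊ + 1))).subset fun a ha => ?_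
  have ha : lg p a ≤ t := ha
  rw [Finset.mem_coe, Finset.mem_finsupp_iff]
  refine ⟨fun i hi => ?_, fun i _ => ?_⟩
  · by_contra h
    have h1 := hn i (by simpa using h)
    have h2 := mul_log_le_lg hp a i
    have h3 : (1 : ℝ) ≤ a i := by
      exact_mod_cast Nat.one_le_iff_ne_zero.2 (Finsupp.mem_support_iff.1 hi)
    nlinarith [hp.log_pos i]
  · exact Finset.mem_range_succ_iff.2 (le_floor_of_mul_log_le hp ((mul_log_le_lg hp a i).trans ha))

theorem finite_mul_log_le (hp : IsGPrimeSystem p) (t : ℝ) :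
    {j : ℕ × ℕ | 1 ≤ j.2 ∧ j.2 * Real.log (p j.1) ≤ t}.Finite := by
  obtain ⟨n, hn⟩ := exists_lt_log hp t
  refine (Finset.finite_toSet (Finset.range n ×ˢ
    Finset.range (⌊t / Real.log (p 0)⌋₊ + 1))).subset fun j hj => ?_
  obtain ⟨h1, h2⟩ := hj
  rw [Finset.mem_coe, Finset.mem_product]
  refine ⟨?_, Finset.mem_range_succ_iff.2 (le_floor_of_mul_log_le hp h2)⟩
  by_contra h
  have h3 := hn j.1 (by simpa using h)
  have h4 : (1 : ℝ) ≤ j.2 := by exact_mod_cast h1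
  nlinarith [hp.log_pos j.1]

open Classical in
/-- The finite set of the g-integers (as exponent vectors) that are at most `e^t`. -/
noncomputable def intsBelow (p : ℕ → ℝ) (t : ℝ) : Finset (ℕ →₀ ℕ) :=
  if h : {a | lg p a ≤ t}.Finite then h.toFinset else ∅

open Classical in
/-- The finite set of the pairs `(i, m)` with `m ≥ 1` and `p i ^ m ≤ e^t`. -/
noncomputable def powersBelow (p : ℕ → ℝ) (t : ℝ) : Finset (ℕ × ℕ) :=
  if h : {j : ℕ × ℕ | 1 ≤ j.2 ∧ j.2 * Real.log (p j.1) ≤ t}.Finite then h.toFinset else ∅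

theorem mem_intsBelow (hp : IsGPrimeSystem p) {t : ℝ} {a : ℕ →₀ ℕ} :
    a ∈ intsBelow p t ↔ lg p a ≤ t := by
  rw [intsBelow, dif_pos (finite_lg_le hp t)]; simp

theorem mem_powersBelow (hp : IsGPrimeSystem p) {t : ℝ} {j : ℕ × ℕ} :
    j ∈ powersBelow p t ↔ 1 ≤ j.2 ∧ j.2 * Real.log (p j.1) ≤ t := by
  rw [powersBelow, dif_pos (finite_mul_log_le hp t)]; simp

/-- The convolution of the measure with mass `1 / n` at `log n`, for each g-integer `n`, with the
function `W` on the half-line. For `W = exp (-·)` it is `e^{-t} N(e^t)`. -/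
noncomputable def intSum (p : ℕ → ℝ) (W : ℝ → ℝ) (t : ℝ) : ℝ :=
  ∑ a ∈ intsBelow p t, Real.exp (-lg p a) * W (t - lg p a)

/-- The convolution of the measure with mass `log (p i) / p i ^ m` at `m log (p i)`, for each power
of a g-prime, with a function on the half-line. -/
noncomputable def powerSum (p : ℕ → ℝ) (φ : ℝ → ℝ) (t : ℝ) : ℝ :=
  ∑ j ∈ powersBelow p t, Real.log (p j.1) * Real.exp (-(j.2 * Real.log (p j.1))) *
    φ (t - j.2 * Real.log (p j.1))

theorem lg_eq_sum_powersBelow (hp : IsGPrimeSystem p) {t : ℝ} {a : ℕ →₀ ℕ} (ha : lg p a ≤ t) :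
    lg p a = ∑ j ∈ powersBelow p t, if j.2 ≤ a j.1 then Real.log (p j.1) else 0 := by
  rw [← Finset.sum_filter, Finset.sum_finset_product _ a.support (fun i => Finset.Icc 1 (a i)),
    lg_eq_sum hp]
  · simp
  · intro j
    rw [Finset.mem_filter, mem_powersBelow hp, Finset.mem_Icc, Finsupp.mem_support_iff]
    constructor
    · rintro ⟨⟨h1, -⟩, h3⟩
      exact ⟨by omega, h1, h3⟩
    · rintro ⟨-, h1, h3⟩
      refine ⟨⟨h1, le_trans ?_ ((mul_log_le_lg hp a j.1).trans ha)⟩, h3⟩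
      have := (hp.log_pos j.1).le
      gcongr

/-- The identity `log = Λ * 1` for g-integers: multiplication by the variable acts on sums over
g-integers as a derivation. -/
theorem mul_intSum (hp : IsGPrimeSystem p) (W : ℝ → ℝ) (t : ℝ) :
    t * intSum p W t = intSum p (fun s => s * W s) t + powerSum p (intSum p W) t := by
  have key : ∑ a ∈ intsBelow p t, lg p a * (Real.exp (-lg p a) * W (t - lg p a)) =
      powerSum p (intSum p W) t := by
    have h1 : ∀ a ∈ intsBelow p t, lg p a * (Real.exp (-lg p a) * W (t - lg p a)) =
        ∑ j ∈ powersBelow p t, if j.2 ≤ a j.1 then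
          Real.log (p j.1) * (Real.exp (-lg p a) * W (t - lg p a)) else 0 := fun a ha => by
      conv_lhs => enter [1]; rw [lg_eq_sum_powersBelow hp ((mem_intsBelow hp).1 ha)]
      rw [Finset.sum_mul]
      exact Finset.sum_congr rfl fun j _ => by split_ifs <;> simp
    rw [Finset.sum_congr rfl h1, Finset.sum_comm, powerSum]
    refine Finset.sum_congr rfl fun j _ => ?_
    rw [← Finset.sum_filter, ← Finset.mul_sum, mul_assoc]
    congr 1
    rw [intSum, Finset.mul_sum]
    have hl : lg p (Finsupp.single j.1 j.2) = j.2 * Real.log (p j.1) := lg_single _ _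
    have hsub : ∀ a ∈ (intsBelow p t).filter fun a : ℕ →₀ ℕ => j.2 ≤ a j.1,
        a - Finsupp.single j.1 j.2 + Finsupp.single j.1 j.2 = a := fun a ha =>
      tsub_add_cancel_of_le (Finsupp.single_le_iff.2 (Finset.mem_filter.1 ha).2)
    refine Finset.sum_nbij' (fun a : ℕ →₀ ℕ => a - Finsupp.single j.1 j.2)
      (fun b : ℕ →₀ ℕ => b + Finsupp.single j.1 j.2) ?_ ?_ hsub ?_ ?_
    · intro a ha
      have h2 := (mem_intsBelow hp).1 (Finset.mem_filter.1 ha).1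
      rw [← hsub a ha, lg_add hp, hl] at h2
      rw [mem_intsBelow hp]; linarith
    · intro b hb
      rw [mem_intsBelow hp] at hb
      rw [Finset.mem_filter, mem_intsBelow hp, lg_add hp, hl]
      exact ⟨by linarith, by simp⟩
    · intro b _
      exact add_tsub_cancel_right _ _
    · intro a ha
      have h2 : lg p a = lg p (a - Finsupp.single j.1 j.2) + j.2 * Real.log (p j.1) := by
        conv_lhs => rw [← hsub a ha]
        rw [lg_add hp, hl]
      rw [h2, neg_add, Real.exp_add,
        show t - (lg p (a - Finsupp.single j.1 j.2) + j.2 * Real.log (p j.1)) =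
          t - j.2 * Real.log (p j.1) - lg p (a - Finsupp.single j.1 j.2) by ring]
      ring
  rw [← key, intSum, intSum, Finset.mul_sum, ← Finset.sum_add_distrib]
  exact Finset.sum_congr rfl fun a _ => by ring

theorem intSum_add (W V : ℝ → ℝ) (t : ℝ) : intSum p (W + V) t = intSum p W t + intSum p V t := by
  simp only [intSum, Pi.add_apply, mul_add, Finset.sum_add_distrib]

theorem intSum_sub (W V : ℝ → ℝ) (t : ℝ) : intSum p (W - V) t = intSum p W t - intSum p V t := by
  simp only [intSum, Pi.sub_apply, mul_sub, Finset.sum_sub_distrib]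

theorem intSum_eq_of_le (hp : IsGPrimeSystem p) (W : ℝ → ℝ) {s t : ℝ} (hst : s ≤ t) :
    intSum p W s = ∑ a ∈ intsBelow p t, Real.exp (-lg p a) *
      (if lg p a ≤ s then W (s - lg p a) else 0) := by
  have : intsBelow p s = (intsBelow p t).filter fun a => lg p a ≤ s := by
    ext a
    rw [Finset.mem_filter, mem_intsBelow hp, mem_intsBelow hp]
    exact ⟨fun h => ⟨h.trans hst, h⟩, fun h => h.2⟩
  rw [intSum, this, Finset.sum_filter]
  exact Finset.sum_congr rfl fun a _ => by split_ifs <;> simp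

theorem intervalIntegrable_ite_le {f : ℝ → ℝ} (hf : Continuous f) (s a b : ℝ) :
    IntervalIntegrable (fun u => if u ≤ s then f u else 0) volume a b := by
  have : (fun u => if u ≤ s then f u else 0) = (Set.Iic s).indicator f := by
    funext u; simp [Set.indicator_apply]
  rw [this, intervalIntegrable_iff]
  exact (intervalIntegrable_iff.1 (hf.intervalIntegrable a b)).indicator measurableSet_Iic

theorem integral_ite_le (f : ℝ → ℝ) {s a b : ℝ} (h1 : a ≤ s) (h2 : s ≤ b) :
    ∫ u in a..b, (if u ≤ s then f u else 0) = ∫ u in a..s, f u := by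
  have : (fun u => if u ≤ s then f u else 0) = (Set.Iic s).indicator f := by
    funext u; simp [Set.indicator_apply]
  rw [this, intervalIntegral.integral_of_le (h1.trans h2), intervalIntegral.integral_of_le h1,
    setIntegral_indicator measurableSet_Iic]
  congr 2
  ext u; simp only [Set.mem_Ioc, Set.mem_inter_iff, Set.mem_Iic]
  constructor
  · rintro ⟨h3, h4⟩; exact ⟨h3.1, h4⟩
  · rintro ⟨h3, h4⟩; exact ⟨⟨h3, h4.trans h2⟩, h4⟩

theorem integral_ite_ge (f : ℝ → ℝ) {s a b : ℝ} (h1 : a < s) (h2 : s ≤ b) :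
    ∫ u in a..b, (if s ≤ u then f u else 0) = ∫ u in s..b, f u := by
  have : (fun u => if s ≤ u then f u else 0) = (Set.Ici s).indicator f := by
    funext u; simp [Set.indicator_apply]
  rw [this, intervalIntegral.integral_of_le (h1.le.trans h2), intervalIntegral.integral_of_le h2,
    setIntegral_indicator measurableSet_Ici, ← integral_Icc_eq_integral_Ioc]
  congr 2
  ext u; simp only [Set.mem_Ioc, Set.mem_inter_iff, Set.mem_Ici, Set.mem_Icc]
  constructor
  · rintro ⟨h3, h4⟩; exact ⟨h4, h3.2⟩
  · rintro ⟨h3, h4⟩; exact ⟨⟨h1.trans_le h3, h4⟩, h3⟩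

theorem intervalIntegrable_ite_ge {f : ℝ → ℝ} (hf : Continuous f) (s a b : ℝ) :
    IntervalIntegrable (fun u => if s ≤ u then f u else 0) volume a b := by
  have : (fun u => if s ≤ u then f u else 0) = (Set.Ici s).indicator f := by
    funext u; simp [Set.indicator_apply]
  rw [this, intervalIntegrable_iff]
  exact (intervalIntegrable_iff.1 (hf.intervalIntegrable a b)).indicator measurableSet_Ici

theorem mul_intSum_sub_eq (hp : IsGPrimeSystem p) (κ W : ℝ → ℝ) {t u : ℝ} (hu : 0 ≤ u) :
    κ u * intSum p W (t - u) = ∑ a ∈ intsBelow p t, Real.exp (-lg p a) *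
      (if u ≤ t - lg p a then κ u * W (t - lg p a - u) else 0) := by
  rw [intSum_eq_of_le hp W (show t - u ≤ t by linarith), Finset.mul_sum]
  refine Finset.sum_congr rfl fun a _ => ?_
  have : lg p a ≤ t - u ↔ u ≤ t - lg p a := by constructor <;> intro <;> linarith
  simp only [this]
  split_ifs
  · rw [show t - u - lg p a = t - lg p a - u by ring]; ring
  · simp

theorem intervalIntegrable_mul_intSum_sub (hp : IsGPrimeSystem p) {κ W : ℝ → ℝ}
    (hκ : Continuous κ) (hW : Continuous W) {t a b : ℝ} (ha : 0 ≤ a) (hb : 0 ≤ b) :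
    IntervalIntegrable (fun u => κ u * intSum p W (t - u)) volume a b := by
  have h : IntervalIntegrable (fun u => ∑ a ∈ intsBelow p t, Real.exp (-lg p a) *
      (if u ≤ t - lg p a then κ u * W (t - lg p a - u) else 0)) volume a b := by
    have := IntervalIntegrable.sum (μ := volume) (a := a) (b := b) (intsBelow p t)
      (f := fun a u => Real.exp (-lg p a) *
      (if u ≤ t - lg p a then κ u * W (t - lg p a - u) else 0)) fun c _ =>
      (intervalIntegrable_ite_le (f := fun u => κ u * W (t - lg p c - u))
        (by fun_prop) _ _ _).const_mul _
    refine this.congr fun u _ => ?_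
    simp
  refine h.congr fun u hu => ?_
  exact (mul_intSum_sub_eq hp κ W ((le_min ha hb).trans hu.1.le)).symm

/-- Convolution with a continuous function on the tail `[ℓ, ∞)`. -/
theorem integral_mul_intSum_sub (hp : IsGPrimeSystem p) {κ W : ℝ → ℝ}
    (hκ : Continuous κ) (hW : Continuous W) {ℓ t : ℝ} (hℓt : ℓ ≤ t) :
    ∫ u in ℓ..t, κ u * intSum p W (t - u) = ∑ a ∈ intsBelow p (t - ℓ), Real.exp (-lg p a) *
      ∫ u in ℓ..(t - lg p a), κ u * W (t - lg p a - u) := by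
  have h1 : ∫ u in ℓ..t, κ u * intSum p W (t - u) =
      ∫ u in ℓ..t, ∑ a ∈ intsBelow p (t - ℓ), Real.exp (-lg p a) *
      (if u ≤ t - lg p a then κ u * W (t - lg p a - u) else 0) := by
    refine intervalIntegral.integral_congr fun u hu => ?_
    rw [Set.uIcc_of_le hℓt] at hu
    rw [intSum_eq_of_le hp W (show t - u ≤ t - ℓ by linarith [hu.1]), Finset.mul_sum]
    refine Finset.sum_congr rfl fun a _ => ?_
    have : lg p a ≤ t - u ↔ u ≤ t - lg p a := by constructor <;> intro <;> linarith
    simp only [this]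
    split_ifs
    · rw [show t - u - lg p a = t - lg p a - u by ring]; ring
    · simp
  rw [h1, intervalIntegral.integral_finsetSum]
  · refine Finset.sum_congr rfl fun a ha => ?_
    rw [mem_intsBelow hp] at ha
    rw [intervalIntegral.integral_const_mul,
      integral_ite_le _ (by linarith) (by linarith [lg_nonneg hp a])]
  · exact fun a _ => (intervalIntegrable_ite_le (f := fun u => κ u * W (t - lg p a - u))
      (by fun_prop) _ _ _).const_mul _

theorem intSum_cv (hp : IsGPrimeSystem p) {κ W : ℝ → ℝ}
    (hκ : Continuous κ) (hW : Continuous W) {t : ℝ} (ht : 0 ≤ t) :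
    intSum p (cv κ W) t = ∫ u in (0 : ℝ)..t, κ u * intSum p W (t - u) := by
  rw [integral_mul_intSum_sub hp hκ hW ht, sub_zero]; rfl

/-- The Chebyshev function `ψ(e^t)`. -/
noncomputable def chebyshev (p : ℕ → ℝ) (t : ℝ) : ℝ := ∑ j ∈ powersBelow p t, Real.log (p j.1)

theorem powersBelow_mono (hp : IsGPrimeSystem p) {s t : ℝ} (h : s ≤ t) :
    powersBelow p s ⊆ powersBelow p t := fun j hj => by
  rw [mem_powersBelow hp] at hj ⊢
  exact ⟨hj.1, hj.2.trans h⟩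

theorem monotone_chebyshev (hp : IsGPrimeSystem p) : Monotone (chebyshev p) := fun _ _ h =>
  Finset.sum_le_sum_of_subset_of_nonneg (powersBelow_mono hp h) fun j _ _ => (hp.log_pos j.1).le

/-- Abel summation against the Chebyshev function, between `ℓ` and `s`. -/
theorem sum_log_mul_eq (hp : IsGPrimeSystem p) {g g' : ℝ → ℝ} (hg : ∀ u, HasDerivAt g (g' u) u)
    (hg' : Continuous g') {ℓ s : ℝ} (hℓs : ℓ ≤ s) :
    ∑ j ∈ powersBelow p s \ powersBelow p ℓ,
        Real.log (p j.1) * g (j.2 * Real.log (p j.1)) =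
      (chebyshev p s - chebyshev p ℓ) * g s -
        ∫ u in ℓ..s, (chebyshev p u - chebyshev p ℓ) * g' u := by
  have hmem : ∀ j ∈ powersBelow p s \ powersBelow p ℓ,
      ℓ < j.2 * Real.log (p j.1) ∧ j.2 * Real.log (p j.1) ≤ s := fun j hj => by
    rw [Finset.mem_sdiff, mem_powersBelow hp, mem_powersBelow hp, not_and] at hj
    exact ⟨not_le.1 (hj.2 hj.1.1), hj.1.2⟩
  have hcheb : ∀ u, ℓ ≤ u → u ≤ s → chebyshev p u - chebyshev p ℓ =
      ∑ j ∈ powersBelow p s \ powersBelow p ℓ,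
        if j.2 * Real.log (p j.1) ≤ u then Real.log (p j.1) else 0 := fun u h1 h2 => by
    rw [chebyshev, chebyshev, ← Finset.sum_sdiff_eq_sub (powersBelow_mono hp h1),
      ← Finset.sum_filter]
    refine Finset.sum_congr ?_ fun _ _ => rfl
    ext j
    simp only [Finset.mem_filter, Finset.mem_sdiff, mem_powersBelow hp]
    constructor
    · rintro ⟨⟨h3, h4⟩, h5⟩; exact ⟨⟨⟨h3, h4.trans h2⟩, h5⟩, h4⟩
    · rintro ⟨⟨⟨h3, h4⟩, h5⟩, h6⟩; exact ⟨⟨h3, h6⟩, h5⟩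
  have h1 : ∫ u in ℓ..s, (chebyshev p u - chebyshev p ℓ) * g' u =
      ∫ u in ℓ..s, ∑ j ∈ powersBelow p s \ powersBelow p ℓ,
        Real.log (p j.1) * if j.2 * Real.log (p j.1) ≤ u then g' u else 0 := by
    refine intervalIntegral.integral_congr fun u hu => ?_
    rw [Set.uIcc_of_le hℓs] at hu
    rw [hcheb u hu.1 hu.2, Finset.sum_mul]
    exact Finset.sum_congr rfl fun j _ => by split_ifs <;> simp
  rw [h1, intervalIntegral.integral_finsetSum fun j _ =>
    (intervalIntegrable_ite_ge hg' _ _ _).const_mul _, hcheb s hℓs le_rfl, Finset.sum_mul,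
    ← Finset.sum_sub_distrib]
  refine Finset.sum_congr rfl fun j hj => ?_
  obtain ⟨h2, h3⟩ := hmem j hj
  rw [intervalIntegral.integral_const_mul, integral_ite_ge _ h2 h3, if_pos h3,
    intervalIntegral.integral_eq_sub_of_hasDerivAt (fun u _ => hg u)
      (hg'.intervalIntegrable _ _)]
  ring

end System

/-! ### Estimates for the system `q_1, q_2, …` -/

/-- The part of Euler's product formula for finite sets that is needed for upper bounds. -/
theorem sum_prod_pow_le {x : ℕ → ℝ} (h0 : ∀ i, 0 ≤ x i) (h1 : ∀ i, x i ≤ 1 / 2) {n : ℕ}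
    {A : Finset (ℕ →₀ ℕ)} (hA : ∀ a ∈ A, a.support ⊆ Finset.range n) :
    ∑ a ∈ A, (a.prod fun i e => x i ^ e) ≤ Real.exp (2 * ∑ i ∈ Finset.range n, x i) := by
  set M := A.sup fun a => a.support.sup a
  set res : (ℕ →₀ ℕ) → (Fin n → ℕ) := fun a i => a i
  have hinj : Set.InjOn res A := fun a ha b hb hab => by
    ext i
    by_cases hi : i < n
    · exact congrFun hab ⟨i, hi⟩
    · have h2 : ∀ c ∈ A, c i = 0 := fun c hc =>
        Finsupp.notMem_support_iff.1 fun h => hi (Finset.mem_range.1 (hA c hc h))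
      rw [h2 a ha, h2 b hb]
  have hM : ∀ a ∈ A, ∀ i, a i ≤ M := fun a ha i => by
    by_cases hi : i ∈ a.support
    · exact (Finset.le_sup (f := a) hi).trans
        (Finset.le_sup (f := fun a : ℕ →₀ ℕ => a.support.sup a) ha)
    · rw [Finsupp.notMem_support_iff.1 hi]; exact Nat.zero_le _
  have hprod : ∀ a ∈ A, (a.prod fun i e => x i ^ e) = ∏ i : Fin n, x i ^ res a i := fun a ha => by
    rw [Finsupp.prod_of_support_subset a (hA a ha) _ (fun i _ => pow_zero _), Finset.prod_range]
  calc ∑ a ∈ A, (a.prod fun i e => x i ^ e) = ∑ a ∈ A, ∏ i : Fin n, x i ^ res a i :=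
        Finset.sum_congr rfl hprod
    _ = ∑ f ∈ A.image res, ∏ i : Fin n, x i ^ f i :=
        (Finset.sum_image (f := fun f : Fin n → ℕ => ∏ i : Fin n, x i ^ f i) hinj).symm
    _ ≤ ∑ f ∈ Fintype.piFinset fun _ : Fin n => Finset.range (M + 1), ∏ i : Fin n, x i ^ f i := by
        refine Finset.sum_le_sum_of_subset_of_nonneg (fun f hf => ?_) fun f _ _ =>
          Finset.prod_nonneg fun i _ => pow_nonneg (h0 i) _
        obtain ⟨a, ha, rfl⟩ := Finset.mem_image.1 hf
        exact Fintype.mem_piFinset.2 fun i => Finset.mem_range_succ_iff.2 (hM a ha i)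
    _ = ∏ i : Fin n, ∑ m ∈ Finset.range (M + 1), x i ^ m :=
        (Finset.prod_univ_sum _ fun (i : Fin n) m => x i ^ m).symm
    _ ≤ ∏ i : Fin n, Real.exp (2 * x i) := by
        refine Finset.prod_le_prod (fun i _ => Finset.sum_nonneg fun m _ => pow_nonneg (h0 i) _)
          fun i _ => ?_
        have h2 : (∑ m ∈ Finset.range (M + 1), x i ^ m) ≤ (1 - x i)⁻¹ := by
          rw [← tsum_geometric_of_lt_one (h0 i) (by linarith [h1 i])]
          exact (summable_geometric_of_lt_one (h0 i) (by linarith [h1 i])).sum_le_tsum _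
            fun m _ => pow_nonneg (h0 i) _
        have h3 : (1 - x i)⁻¹ ≤ 2 * x i + 1 := by
          rw [inv_le_iff_one_le_mul₀ (by linarith [h1 i])]
          nlinarith [h0 i, h1 i]
        exact h2.trans (h3.trans (Real.add_one_le_exp _))
    _ = Real.exp (2 * ∑ i ∈ Finset.range n, x i) := by
        rw [← Real.exp_sum, ← Finset.mul_sum, Finset.sum_range]

theorem exp_neg_lg {p : ℕ → ℝ} (hp : IsGPrimeSystem p) (a : ℕ →₀ ℕ) :
    Real.exp (-lg p a) = a.prod fun i e => (p i)⁻¹ ^ e := by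
  rw [Real.exp_neg, lg, Real.exp_log (gInt_pos hp a), gInt, Finsupp.prod, Finsupp.prod,
    ← Finset.prod_inv_distrib]
  simp only [inv_pow]

theorem log_sysD_le_iff {i : ℕ} {t : ℝ} (ht : 0 ≤ t) :
    Real.log (sysD i) ≤ t ↔ i < ⌊PiB (Real.exp t)⌋₊ := by
  rw [← sysD_le_iff (Real.one_le_exp ht), Real.log_le_iff_le_exp (by linarith [two_le_sysD i])]

theorem support_subset_of_lg_le {t : ℝ} {a : ℕ →₀ ℕ} (ha : lg sysD a ≤ t) :
    a.support ⊆ Finset.range ⌊PiB (Real.exp t)⌋₊ := fun i hi => by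
  have hp := isGPrimeSystem_sysD
  rw [Finset.mem_range, ← log_sysD_le_iff ((lg_nonneg hp a).trans ha)]
  have h2 := mul_log_le_lg hp a i
  have h3 : (1 : ℝ) ≤ a i := by
    exact_mod_cast Nat.one_le_iff_ne_zero.2 (Finsupp.mem_support_iff.1 hi)
  nlinarith [hp.log_pos i]

theorem inv_sysD_nonneg (i : ℕ) : 0 ≤ (sysD i)⁻¹ := inv_nonneg.2 (by linarith [two_le_sysD i])

theorem inv_sysD_le (i : ℕ) : (sysD i)⁻¹ ≤ 1 / 2 := by
  rw [one_div]; exact inv_anti₀ two_pos (two_le_sysD i)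

theorem exp_log_bound {t : ℝ} (ht : 0 ≤ t) :
    Real.exp (2 * (1 + 4 * Real.log (1 + t))) = Real.exp 2 * (1 + t) ^ 8 := by
  rw [show 2 * (1 + 4 * Real.log (1 + t)) = 2 + (8 : ℕ) * Real.log (1 + t) by push_cast; ring,
    Real.exp_add, Real.exp_nat_mul, Real.exp_log (by linarith)]

/-- The sum of the reciprocals of the g-integers up to `e^t` grows at most polynomially in `t`. -/
theorem sum_exp_neg_lg_le {t : ℝ} (ht : 0 ≤ t) :
    ∑ a ∈ intsBelow sysD t, Real.exp (-lg sysD a) ≤ Real.exp 2 * (1 + t) ^ 8 := by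
  have hp := isGPrimeSystem_sysD
  simp only [exp_neg_lg hp]
  refine (sum_prod_pow_le inv_sysD_nonneg inv_sysD_le fun a ha =>
    support_subset_of_lg_le ((mem_intsBelow hp).1 ha)).trans ?_
  rw [← exp_log_bound ht]
  have := sum_inv_sysD_le (Real.one_le_exp ht)
  rw [Real.log_exp] at this
  gcongr

theorem sum_inv_le_sum_exp_neg_lg {t : ℝ} (ht : 0 ≤ t) :
    ∑ i ∈ Finset.range ⌊PiB (Real.exp t)⌋₊, (sysD i)⁻¹ ≤
      ∑ a ∈ intsBelow sysD t, Real.exp (-lg sysD a) := by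
  have hp := isGPrimeSystem_sysD
  set emb : ℕ → (ℕ →₀ ℕ) := fun i => Finsupp.single i 1
  have hinj : Function.Injective emb := Finsupp.single_left_injective one_ne_zero
  have h : ∀ i, (sysD i)⁻¹ = Real.exp (-lg sysD (emb i)) := fun i => by
    rw [lg_single, Nat.cast_one, one_mul, Real.exp_neg,
      Real.exp_log (by linarith [two_le_sysD i])]
  simp only [h]
  rw [← Finset.sum_image (f := fun a => Real.exp (-lg sysD a)) hinj.injOn]
  refine Finset.sum_le_sum_of_subset_of_nonneg (fun a ha => ?_) fun _ _ _ => (Real.exp_pos _).le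
  obtain ⟨i, hi, rfl⟩ := Finset.mem_image.1 ha
  rw [mem_intsBelow hp, lg_single, Nat.cast_one, one_mul, log_sysD_le_iff ht]
  exact Finset.mem_range.1 hi

theorem sum_powersBelow_sysD {t : ℝ} (ht : 0 ≤ t) (F : ℕ × ℕ → ℝ) :
    ∑ j ∈ powersBelow sysD t, F j = ∑ i ∈ Finset.range ⌊PiB (Real.exp t)⌋₊,
      ∑ m ∈ Finset.Icc 1 ⌊t / Real.log (sysD i)⌋₊, F (i, m) := by
  have hp := isGPrimeSystem_sysD
  refine Finset.sum_finset_product _ _ _ fun j => ?_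
  rw [mem_powersBelow hp, Finset.mem_range, Finset.mem_Icc, ← log_sysD_le_iff ht,
    Nat.le_floor_iff (div_nonneg ht (hp.log_pos _).le), le_div_iff₀ (hp.log_pos _)]
  constructor
  · rintro ⟨h1, h2⟩
    refine ⟨?_, h1, h2⟩
    have : (1 : ℝ) ≤ j.2 := by exact_mod_cast h1
    nlinarith [hp.log_pos j.1]
  · rintro ⟨-, h1, h2⟩; exact ⟨h1, h2⟩

theorem floor_PiB_le {x : ℝ} (hx : 1 ≤ x) : (⌊PiB x⌋₊ : ℝ) ≤ x :=
  (Nat.floor_le (PiB_nonneg hx)).trans (by linarith [PiB_le hx])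

theorem integral_qd_log {t : ℝ} (ht : 0 ≤ t) :
    ∫ u in (1 : ℝ)..Real.exp t, qd (Real.log u) = ∫ v in (0 : ℝ)..t, qd v * Real.exp v := by
  have := intervalIntegral.integral_comp_mul_deriv' (a := 0) (b := t) (f := Real.exp)
    (f' := Real.exp) (g := fun u => qd (Real.log u)) (fun u _ => Real.hasDerivAt_exp u)
    Real.continuous_exp.continuousOn (continuousOn_qd_log.mono (by
      rintro _ ⟨u, hu, rfl⟩
      rw [Set.uIcc_of_le ht] at hu
      exact Real.one_le_exp hu.1))
  rw [Real.exp_zero] at this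
  rw [← this]
  refine intervalIntegral.integral_congr fun u _ => ?_
  simp

/-- The Chebyshev function of the discrete system is close to that of the continuous one. -/
theorem abs_chebyshev_sub_le {t : ℝ} (ht : 0 ≤ t) :
    |chebyshev sysD t - ∫ v in (0 : ℝ)..t, qd v * Real.exp v| ≤
      3 * (1 + t) * Real.exp (t / 2) := by
  have hp := isGPrimeSystem_sysD
  set n := ⌊PiB (Real.exp t)⌋₊
  have h1 := abs_sum_log_sysD_sub_le (Real.one_le_exp ht)
  rw [integral_qd_log ht, Real.log_exp] at h1
  have h2 : chebyshev sysD t =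
      ∑ i ∈ Finset.range n, ⌊t / Real.log (sysD i)⌋₊ * Real.log (sysD i) := by
    rw [chebyshev, sum_powersBelow_sysD ht]
    simp [n]
  have h3 : ∑ i ∈ Finset.range n, Real.log (sysD i) ≤ chebyshev sysD t := by
    rw [h2]
    refine Finset.sum_le_sum fun i hi => le_mul_of_one_le_left (hp.log_pos i).le ?_
    have h4 := (log_sysD_le_iff ht).2 (Finset.mem_range.1 hi)
    have : 1 ≤ ⌊t / Real.log (sysD i)⌋₊ := by
      rw [Nat.le_floor_iff (div_nonneg ht (hp.log_pos _).le), le_div_iff₀ (hp.log_pos _)]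
      simpa using h4
    exact_mod_cast this
  have h4 : chebyshev sysD t ≤ ∑ i ∈ Finset.range n, Real.log (sysD i) + t * Real.exp (t / 2) := by
    have h5 : ∀ i, ⌊t / Real.log (sysD i)⌋₊ * Real.log (sysD i) ≤
        Real.log (sysD i) + if Real.log (sysD i) ≤ t / 2 then t else 0 := fun i => by
      have hl := hp.log_pos i
      split_ifs with h
      · have := Nat.floor_le (div_nonneg ht hl.le)
        rw [le_div_iff₀ hl] at this
        linarith
      · have : ⌊t / Real.log (sysD i)⌋₊ ≤ 1 := by
          refine Nat.lt_succ_iff.1 ((Nat.floor_lt (div_nonneg ht hl.le)).2 ?_)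
          rw [div_lt_iff₀ hl]; push_cast; linarith
        have : (⌊t / Real.log (sysD i)⌋₊ : ℝ) ≤ 1 := by exact_mod_cast this
        nlinarith
    rw [h2]
    refine (Finset.sum_le_sum fun i _ => h5 i).trans ?_
    rw [Finset.sum_add_distrib]
    gcongr
    rw [← Finset.sum_filter, Finset.sum_const, nsmul_eq_mul, mul_comm]
    gcongr
    refine le_trans ?_ (floor_PiB_le (Real.one_le_exp (by linarith : 0 ≤ t / 2)))
    have : (Finset.range n).filter (fun i => Real.log (sysD i) ≤ t / 2) ⊆
        Finset.range ⌊PiB (Real.exp (t / 2))⌋₊ := fun i hi => by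
      rw [Finset.mem_range, ← log_sysD_le_iff (by linarith)]
      exact (Finset.mem_filter.1 hi).2
    have := Finset.card_le_card this
    rw [Finset.card_range] at this
    exact_mod_cast this
  have h5 : 1 ≤ Real.exp (t / 2) := Real.one_le_exp (by linarith)
  rw [abs_le] at h1 ⊢
  constructor <;> nlinarith

/-- The Mertens sum over the prime powers up to `e^t` grows at most polynomially in `t`. -/
theorem sum_log_mul_exp_le {t : ℝ} (ht : 0 ≤ t) :
    ∑ j ∈ powersBelow sysD t, Real.log (sysD j.1) * Real.exp (-(j.2 * Real.log (sysD j.1))) ≤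
      8 * (1 + t) ^ 2 := by
  have hp := isGPrimeSystem_sysD
  rw [sum_powersBelow_sysD ht]
  have h1 : ∀ i ∈ Finset.range ⌊PiB (Real.exp t)⌋₊,
      ∑ m ∈ Finset.Icc 1 ⌊t / Real.log (sysD i)⌋₊,
        Real.log (sysD i) * Real.exp (-(m * Real.log (sysD i))) ≤ 2 * t * (sysD i)⁻¹ := by
    intro i hi
    have hl := (log_sysD_le_iff ht).2 (Finset.mem_range.1 hi)
    have h0 := inv_sysD_nonneg i
    have h2 : ∀ m : ℕ, Real.exp (-(m * Real.log (sysD i))) = (sysD i)⁻¹ ^ m := fun m => by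
      rw [← mul_neg, Real.exp_nat_mul, Real.exp_neg, Real.exp_log (by linarith [two_le_sysD i])]
    have h3 : ∑ m ∈ Finset.Icc 1 ⌊t / Real.log (sysD i)⌋₊, (sysD i)⁻¹ ^ m ≤ 2 * (sysD i)⁻¹ := by
      rw [← Finset.Ico_add_one_right_eq_Icc, Finset.sum_Ico_eq_sum_range]
      simp only [pow_add, pow_one]
      rw [← Finset.mul_sum, mul_comm]
      gcongr
      have hx := inv_sysD_le i
      refine ((summable_geometric_of_lt_one h0 (by linarith)).sum_le_tsum _
        fun m _ => pow_nonneg h0 _).trans ?_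
      rw [tsum_geometric_of_lt_one h0 (by linarith), inv_le_comm₀ (by linarith) two_pos]
      linarith
    simp only [h2]
    rw [← Finset.mul_sum]
    have := hp.log_pos i
    calc _ ≤ t * (2 * (sysD i)⁻¹) := by gcongr
      _ = _ := by ring
  refine (Finset.sum_le_sum h1).trans ?_
  rw [← Finset.mul_sum]
  have h2 := sum_inv_sysD_le (Real.one_le_exp ht)
  rw [Real.log_exp] at h2
  have h3 := Real.log_le_sub_one_of_pos (by linarith : 0 < 1 + t)
  nlinarith

/-- The part above `e^ℓ` of the difference of the discrete and the continuous Chebyshev measure,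
convolved with the kernel `wk`. -/
noncomputable def tailKernel (p : ℕ → ℝ) (ℓ s : ℝ) : ℝ :=
  ∑ j ∈ powersBelow p s \ powersBelow p ℓ, Real.log (p j.1) *
    (Real.exp (-(j.2 * Real.log (p j.1))) * wk (s - j.2 * Real.log (p j.1))) -
  ∫ u in ℓ..s, qd u * wk (s - u)

theorem tailKernel_eq {p : ℕ → ℝ} (hp : IsGPrimeSystem p) {ℓ s : ℝ} (hℓs : ℓ ≤ s) {Ψ : ℝ → ℝ}
    (hΨ : ∀ t, Ψ t = chebyshev p t - ∫ v in (0 : ℝ)..t, qd v * Real.exp v) :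
    tailKernel p ℓ s = (Ψ s - Ψ ℓ) * Real.exp (-s) -
      ∫ u in ℓ..s, (Ψ u - Ψ ℓ) * (Real.exp (-u) * bj (s - u)) := by
  set g : ℝ → ℝ := fun u => Real.exp (-u) * wk (s - u)
  set g' : ℝ → ℝ := fun u => Real.exp (-u) * bj (s - u)
  set R : ℝ → ℝ := fun t => ∫ v in (0 : ℝ)..t, qd v * Real.exp v
  have hg : ∀ u, HasDerivAt g (g' u) u := fun u => by
    have h1 : HasDerivAt (fun u => Real.exp (-u)) (-Real.exp (-u)) u := by
      simpa using (hasDerivAt_neg u).exp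
    have h2 := (hasDerivAt_wk (s - u)).comp u ((hasDerivAt_id u).const_sub s)
    refine (h1.mul h2).congr_deriv ?_
    simp only [g', Function.comp_apply]; ring
  have hbj := continuous_bj
  have hg' : Continuous g' := by fun_prop
  have hqe : Continuous fun v => qd v * Real.exp v := by
    have := continuous_qd
    fun_prop
  have hR : ∀ u, HasDerivAt R (qd u * Real.exp u) u := hasDerivAt_integral_right hqe
  have h1 := sum_log_mul_eq hp hg hg' hℓs
  have h2 := intervalIntegral.integral_mul_deriv_eq_deriv_mul (a := ℓ) (b := s)
    (u := fun u => R u - R ℓ) (v := g)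
    (fun u _ => (hR u).sub_const (R ℓ)) (fun u _ => hg u) (hqe.intervalIntegrable _ _)
    (hg'.intervalIntegrable _ _)
  have h3 : ∫ u in ℓ..s, qd u * Real.exp u * g u = ∫ u in ℓ..s, qd u * wk (s - u) := by
    refine intervalIntegral.integral_congr fun u _ => ?_
    have : Real.exp u * Real.exp (-u) = 1 := by rw [← Real.exp_add]; simp
    simp only [g]
    linear_combination (qd u * wk (s - u)) * this
  have h4 : ∫ u in ℓ..s, (Ψ u - Ψ ℓ) * g' u =
      (∫ u in ℓ..s, (chebyshev p u - chebyshev p ℓ) * g' u) -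
        ∫ u in ℓ..s, (R u - R ℓ) * g' u := by
    have hRc : Continuous R := continuous_iff_continuousAt.2 fun u => (hR u).continuousAt
    rw [← intervalIntegral.integral_sub]
    · refine intervalIntegral.integral_congr fun u _ => ?_
      simp only [hΨ, R]; ring
    · exact ((monotone_chebyshev hp).intervalIntegrable.sub
        intervalIntegrable_const).mul_continuousOn hg'.continuousOn
    · exact ((hRc.sub continuous_const).mul hg').intervalIntegrable _ _
  have hgs : g s = Real.exp (-s) := by simp [g, wk_zero]
  rw [tailKernel, h1, ← h3, h4, ← hgs, hΨ s, hΨ ℓ]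
  rw [h2]
  simp only [sub_self, zero_mul, sub_zero, R]
  ring

theorem abs_tailKernel_le {ℓ s : ℝ} (hℓ : 0 ≤ ℓ) (hℓs : ℓ ≤ s) :
    |tailKernel sysD ℓ s| ≤ 6 * (1 + s) ^ 3 * Real.exp (-ℓ / 2) := by
  set Ψ : ℝ → ℝ := fun t => chebyshev sysD t - ∫ v in (0 : ℝ)..t, qd v * Real.exp v
  have hs : 0 ≤ s := hℓ.trans hℓs
  -- the bound for the difference of the Chebyshev functions, multiplied by `e^{-u}`
  have hb : ∀ u, ℓ ≤ u → u ≤ s → |(Ψ u - Ψ ℓ) * Real.exp (-u)| ≤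
      6 * (1 + s) * Real.exp (-ℓ / 2) := fun u h1 h2 => by
    have h3 := abs_chebyshev_sub_le (hℓ.trans h1)
    have h4 := abs_chebyshev_sub_le hℓ
    have h5 : Real.exp (ℓ / 2) ≤ Real.exp (u / 2) := Real.exp_le_exp.2 (by linarith)
    have h6 : |Ψ u - Ψ ℓ| ≤ 6 * (1 + s) * Real.exp (u / 2) := by
      refine (abs_sub _ _).trans ?_
      have h7 : 3 * (1 + u) * Real.exp (u / 2) ≤ 3 * (1 + s) * Real.exp (u / 2) := by gcongr
      have h8 : 3 * (1 + ℓ) * Real.exp (ℓ / 2) ≤ 3 * (1 + s) * Real.exp (u / 2) := by gcongr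
      linarith
    rw [abs_mul, abs_of_pos (Real.exp_pos _)]
    calc _ ≤ 6 * (1 + s) * Real.exp (u / 2) * Real.exp (-u) := by gcongr
      _ = 6 * (1 + s) * Real.exp (-u / 2) := by
        rw [mul_assoc, ← Real.exp_add]; congr 2; ring
      _ ≤ _ := by gcongr
  rw [tailKernel_eq isGPrimeSystem_sysD hℓs (Ψ := Ψ) fun _ => rfl]
  have h1 := hb s hℓs le_rfl
  have h2 : |∫ u in ℓ..s, (Ψ u - Ψ ℓ) * (Real.exp (-u) * bj (s - u))| ≤
      6 * (1 + s) * Real.exp (-ℓ / 2) * s * s := by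
    have h3 := intervalIntegral.norm_integral_le_of_norm_le_const (a := ℓ) (b := s)
      (f := fun u => (Ψ u - Ψ ℓ) * (Real.exp (-u) * bj (s - u)))
      (C := 6 * (1 + s) * Real.exp (-ℓ / 2) * s) fun u hu => by
        rw [Set.uIoc_of_le hℓs] at hu
        have h4 := abs_bj_le (t := s - u) (by linarith [hu.2])
        rw [Real.norm_eq_abs, ← mul_assoc, abs_mul]
        exact mul_le_mul (hb u hu.1.le hu.2) (h4.trans (by linarith [hu.1])) (abs_nonneg _)
          (by positivity)
    refine h3.trans ?_
    rw [abs_of_nonneg (by linarith)]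
    gcongr
    linarith
  refine (abs_sub _ _).trans ((add_le_add h1 h2).trans ?_)
  have h9 : 0 ≤ Real.exp (-ℓ / 2) := (Real.exp_pos _).le
  have : 6 * (1 + s) * Real.exp (-ℓ / 2) + 6 * (1 + s) * Real.exp (-ℓ / 2) * s * s =
    6 * ((1 + s) * (1 + s ^ 2)) * Real.exp (-ℓ / 2) := by ring
  rw [this]
  gcongr
  nlinarith

/-- The convolution quotient of the discrete and the continuous system: the function `e^{-t} F(e^t)`
for the distribution function `F` of `dN_D * exp^*(-dΠ_B)`. -/
noncomputable def quot (t : ℝ) : ℝ := intSum sysD wk t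

/-- The functional equation of the convolution quotient, with the primes split at `e^ℓ`. -/
theorem mul_quot {ℓ t : ℝ} (hℓ : 0 ≤ ℓ) (hℓt : ℓ ≤ t) :
    t * quot t = (∫ u in (0 : ℝ)..t, ek u * quot (t - u)) +
      (∑ j ∈ powersBelow sysD ℓ, Real.log (sysD j.1) * Real.exp (-(j.2 * Real.log (sysD j.1))) *
        quot (t - j.2 * Real.log (sysD j.1)) - ∫ u in (0 : ℝ)..ℓ, qd u * quot (t - u)) +
      ∑ a ∈ intsBelow sysD (t - ℓ), Real.exp (-lg sysD a) *
        tailKernel sysD ℓ (t - lg sysD a) := by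
  have hp := isGPrimeSystem_sysD
  have ht : 0 ≤ t := hℓ.trans hℓt
  have h1 : intSum sysD (fun s => s * wk s) t =
      (∫ u in (0 : ℝ)..t, ek u * quot (t - u)) - ∫ u in (0 : ℝ)..t, qd u * quot (t - u) := by
    rw [mul_wk, intSum_sub, intSum_cv hp continuous_ek continuous_wk ht,
      intSum_cv hp continuous_qd continuous_wk ht]
    rfl
  have h2 : ∫ u in (0 : ℝ)..t, qd u * quot (t - u) = (∫ u in (0 : ℝ)..ℓ, qd u * quot (t - u)) +
      ∫ u in ℓ..t, qd u * quot (t - u) :=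
    (intervalIntegral.integral_add_adjacent_intervals
      (intervalIntegrable_mul_intSum_sub hp continuous_qd continuous_wk le_rfl hℓ)
      (intervalIntegrable_mul_intSum_sub hp continuous_qd continuous_wk hℓ ht)).symm
  have h3 : ∫ u in ℓ..t, qd u * quot (t - u) = ∑ a ∈ intsBelow sysD (t - ℓ),
      Real.exp (-lg sysD a) * ∫ u in ℓ..(t - lg sysD a), qd u * wk (t - lg sysD a - u) :=
    integral_mul_intSum_sub hp continuous_qd continuous_wk hℓt
  have h4 : powerSum sysD quot t =
      ∑ j ∈ powersBelow sysD ℓ, Real.log (sysD j.1) * Real.exp (-(j.2 * Real.log (sysD j.1))) *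
        quot (t - j.2 * Real.log (sysD j.1)) +
      ∑ j ∈ powersBelow sysD t \ powersBelow sysD ℓ,
        Real.log (sysD j.1) * Real.exp (-(j.2 * Real.log (sysD j.1))) *
        quot (t - j.2 * Real.log (sysD j.1)) := by
    rw [powerSum, add_comm, Finset.sum_sdiff (powersBelow_mono hp hℓt)]
  have h5 : ∑ j ∈ powersBelow sysD t \ powersBelow sysD ℓ,
        Real.log (sysD j.1) * Real.exp (-(j.2 * Real.log (sysD j.1))) *
        quot (t - j.2 * Real.log (sysD j.1)) =
      ∑ a ∈ intsBelow sysD (t - ℓ), Real.exp (-lg sysD a) *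
        ∑ j ∈ powersBelow sysD (t - lg sysD a) \ powersBelow sysD ℓ, Real.log (sysD j.1) *
          (Real.exp (-(j.2 * Real.log (sysD j.1))) *
            wk (t - lg sysD a - j.2 * Real.log (sysD j.1))) := by
    simp only [quot, intSum, Finset.mul_sum]
    rw [Finset.sum_comm' (t' := intsBelow sysD (t - ℓ))
      (s' := fun a => powersBelow sysD (t - lg sysD a) \ powersBelow sysD ℓ)]
    · refine Finset.sum_congr rfl fun a _ => Finset.sum_congr rfl fun j _ => ?_
      rw [show t - j.2 * Real.log (sysD j.1) - lg sysD a =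
        t - lg sysD a - j.2 * Real.log (sysD j.1) by ring]
      ring
    · intro j a
      have hl := lg_nonneg hp a
      simp only [Finset.mem_sdiff, mem_powersBelow hp, mem_intsBelow hp, not_and, not_le]
      constructor
      · rintro ⟨⟨⟨h6, h7⟩, h8⟩, h9⟩
        have := h8 h6
        exact ⟨⟨⟨h6, by linarith⟩, h8⟩, by linarith⟩
      · rintro ⟨⟨⟨h6, h7⟩, h8⟩, h9⟩
        exact ⟨⟨⟨h6, by linarith⟩, h8⟩, by linarith⟩
  have h6 := mul_intSum hp wk t
  rw [h1, h2, h3] at h6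
  change t * quot t = _ + powerSum sysD quot t at h6
  rw [h4, h5] at h6
  rw [h6]
  simp only [tailKernel, mul_sub, Finset.sum_sub_distrib]
  ring

theorem abs_quot_le {t : ℝ} (ht : 0 ≤ t) : |quot t| ≤ Real.exp 2 * (1 + t) ^ 10 := by
  have hp := isGPrimeSystem_sysD
  have h1 : |quot t| ≤ ∑ a ∈ intsBelow sysD t, Real.exp (-lg sysD a) * (1 + t) ^ 2 := by
    refine (Finset.abs_sum_le_sum_abs _ _).trans (Finset.sum_le_sum fun a ha => ?_)
    rw [mem_intsBelow hp] at ha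
    have h2 := abs_wk_le (t := t - lg sysD a) (by linarith)
    have h3 := lg_nonneg hp a
    rw [abs_mul, abs_of_pos (Real.exp_pos _)]
    gcongr
    refine h2.trans ?_
    gcongr
    linarith
  rw [← Finset.sum_mul] at h1
  refine h1.trans ?_
  have := sum_exp_neg_lg_le ht
  calc _ ≤ Real.exp 2 * (1 + t) ^ 8 * (1 + t) ^ 2 := by gcongr
    _ = _ := by ring

/-! ### Decay of the convolution quotient -/

theorem one_add_pow_le_mul_exp (b : ℕ) :
    ∃ K : ℝ, 0 < K ∧ ∀ u, 0 ≤ u → (1 + u) ^ b ≤ K * Real.exp (u / 2) := by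
  refine ⟨2 ^ b * b.factorial * Real.exp (1 / 2), by positivity, fun u hu => ?_⟩
  have h := Real.pow_div_factorial_le_exp (x := (1 + u) / 2) (by linarith) b
  rw [div_le_iff₀ (by positivity), div_pow, div_le_iff₀ (by positivity), add_div,
    Real.exp_add] at h
  linarith

theorem rpow_sub_le {a t u : ℝ} {b : ℕ} (h1 : -b ≤ a) (hu : 0 ≤ u) (hut : u ≤ t) :
    (1 + (t - u)) ^ a ≤ (1 + t) ^ a * (1 + u) ^ b := by
  have ht : 0 ≤ t := hu.trans hut
  rcases le_total 0 a with ha | ha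
  · have h2 : (1 + (t - u)) ^ a ≤ (1 + t) ^ a :=
      Real.rpow_le_rpow (by linarith) (by linarith) ha
    exact h2.trans (le_mul_of_one_le_right (by positivity) (one_le_pow₀ (by linarith)))
  · have h2 : (1 + t) / (1 + u) ≤ 1 + (t - u) := by
      rw [div_le_iff₀ (by linarith)]; nlinarith
    have h3 := Real.rpow_le_rpow_of_nonpos (by positivity) h2 ha
    rw [Real.div_rpow (by linarith) (by linarith)] at h3
    refine h3.trans ?_
    rw [div_eq_mul_inv, ← Real.rpow_neg (by linarith)]
    gcongr
    rw [← Real.rpow_natCast]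
    exact Real.rpow_le_rpow_of_exponent_le (by linarith) (by linarith)

/-- One step of the bootstrap: a bound for the convolution quotient improves by a factor
`t ^ (-1/2)`. In the functional equation `mul_quot`, the primes up to `e^ℓ` with `ℓ` a small power
of `t` cost a power of `ℓ`, the larger ones contribute a term that is exponentially small in `ℓ`, and
dividing by `t` gains more than both. -/
theorem quot_bound_step {a : ℝ} {b : ℕ} (h1 : -b ≤ a)
    (h : ∃ C : ℝ, 0 ≤ C ∧ ∀ t, 0 ≤ t → |quot t| ≤ C * (1 + t) ^ a) :
    ∃ C : ℝ, 0 ≤ C ∧ ∀ t, 0 ≤ t → |quot t| ≤ C * (1 + t) ^ (a - 1 / 2) := by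
  obtain ⟨C, hC, hb⟩ := h
  have hp := isGPrimeSystem_sysD
  -- `t = ℓ ^ (2 * c)`, and the primes up to `e^ℓ` cost a factor `ℓ ^ c`
  set c := b + 2 with hc
  set N := 2 * c * (11 + b) with hN
  obtain ⟨K₁, hK₁, hKb⟩ := one_add_pow_le_mul_exp b
  obtain ⟨K₂, hK₂, hKN⟩ := one_add_pow_le_mul_exp N
  have hshift : ∀ t u, 0 ≤ u → u ≤ t → |quot (t - u)| ≤ C * (1 + t) ^ a * (1 + u) ^ b :=
    fun t u hu hut => by
    refine (hb _ (by linarith)).trans ?_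
    rw [mul_assoc]
    gcongr
    exact rpow_sub_le h1 hu hut
  set A := 2 * C * K₁ + 10 * 2 ^ c * C + 6 * Real.exp 2 * 2 ^ (11 + b) * K₂ with hA
  have hA0 : 0 ≤ A := by positivity
  refine ⟨2 * (A + C), by positivity, fun t ht => ?_⟩
  have hsplit : (1 + t) ^ (a - 1 / 2) * (1 + t) ^ (1 / 2 : ℝ) = (1 + t) ^ a := by
    rw [← Real.rpow_add (by linarith)]; congr 1; ring
  have hpos : 0 < (1 + t) ^ (a - 1 / 2) := by positivity
  rcases le_total t 1 with ht1 | ht1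
  · refine (hb t ht).trans ?_
    have h2 : (1 + t) ^ (1 / 2 : ℝ) ≤ 2 := by
      rw [← Real.sqrt_eq_rpow, Real.sqrt_le_left (by norm_num)]; linarith
    rw [← hsplit]
    calc C * ((1 + t) ^ (a - 1 / 2) * (1 + t) ^ (1 / 2 : ℝ)) ≤ C * ((1 + t) ^ (a - 1 / 2) * 2) := by
          gcongr
      _ = 2 * C * (1 + t) ^ (a - 1 / 2) := by ring
      _ ≤ _ := by gcongr; linarith
  set ℓ := t ^ (((2 * c : ℕ) : ℝ)⁻¹) with hℓ
  have hℓt' : ℓ ^ (2 * c) = t := Real.rpow_inv_natCast_pow ht (by omega)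
  have hℓ1 : 1 ≤ ℓ := Real.one_le_rpow ht1 (by positivity)
  have hℓt : ℓ ≤ t := by
    conv_rhs => rw [← hℓt']
    exact le_self_pow₀ hℓ1 (by omega)
  have hℓ0 : 0 ≤ ℓ := by linarith
  have hpa : 0 < (1 + t) ^ a := by positivity
  -- the contribution of `e`, whose decay makes up for the shift
  have e1 : |∫ u in (0 : ℝ)..t, ek u * quot (t - u)| ≤ 2 * C * K₁ * (1 + t) ^ a := by
    have h2 : ∀ u ∈ Set.Ioc 0 t,
        ‖ek u * quot (t - u)‖ ≤ C * K₁ * (1 + t) ^ a * Real.exp (-u / 2) := fun u hu => by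
      have h3 := hshift t u hu.1.le hu.2
      have h4 := hKb u hu.1.le
      rw [Real.norm_eq_abs, abs_mul, ek, abs_of_pos (Real.exp_pos _)]
      calc _ ≤ Real.exp (-u) * (C * (1 + t) ^ a * (K₁ * Real.exp (u / 2))) := by
            gcongr
            refine h3.trans ?_
            gcongr
        _ = C * K₁ * (1 + t) ^ a * (Real.exp (-u) * Real.exp (u / 2)) := by ring
        _ = _ := by rw [← Real.exp_add]; congr 2; ring
    have h5 := intervalIntegral.norm_integral_le_of_norm_le (μ := volume) ht
      (Eventually.of_forall h2) (by apply Continuous.intervalIntegrable; fun_prop)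
    have h6 : ∫ u in (0 : ℝ)..t, Real.exp (-u / 2) ≤ 2 := by
      rw [intervalIntegral.integral_eq_sub_of_hasDerivAt
        (f := fun u => -2 * Real.exp (-u / 2)) (fun u _ => by
          refine ((((hasDerivAt_neg u).div_const 2).exp).const_mul (-2)).congr_deriv ?_
          ring) (by apply Continuous.intervalIntegrable; fun_prop)]
      have := Real.exp_pos (-t / 2)
      simp; linarith
    rw [intervalIntegral.integral_const_mul, Real.norm_eq_abs] at h5
    refine h5.trans ?_
    calc _ ≤ C * K₁ * (1 + t) ^ a * 2 := by gcongr
      _ = _ := by ring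
  -- the prime powers up to `e^ℓ` and the corresponding part of the continuous system
  have e2 : |∑ j ∈ powersBelow sysD ℓ, Real.log (sysD j.1) *
      Real.exp (-(j.2 * Real.log (sysD j.1))) * quot (t - j.2 * Real.log (sysD j.1))| ≤
      8 * (1 + ℓ) ^ 2 * (C * (1 + t) ^ a * (1 + ℓ) ^ b) := by
    refine (Finset.abs_sum_le_sum_abs _ _).trans ?_
    refine le_trans ?_ (mul_le_mul_of_nonneg_right
      (sum_log_mul_exp_le hℓ0) (show 0 ≤ C * (1 + t) ^ a * (1 + ℓ) ^ b by positivity))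
    rw [Finset.sum_mul]
    refine Finset.sum_le_sum fun j hj => ?_
    rw [mem_powersBelow hp] at hj
    have h0 : 0 ≤ j.2 * Real.log (sysD j.1) :=
      mul_nonneg (Nat.cast_nonneg _) (hp.log_pos _).le
    have h2 := hshift t _ h0 (hj.2.trans hℓt)
    have h3 : 0 ≤ Real.log (sysD j.1) * Real.exp (-(j.2 * Real.log (sysD j.1))) :=
      mul_nonneg (hp.log_pos _).le (Real.exp_pos _).le
    rw [abs_mul, abs_of_nonneg h3]
    refine mul_le_mul_of_nonneg_left (h2.trans ?_) h3
    gcongr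
    exact hj.2
  have e3 : |∫ u in (0 : ℝ)..ℓ, qd u * quot (t - u)| ≤
      2 * (C * (1 + t) ^ a * (1 + ℓ) ^ b) * ℓ := by
    have h2 := intervalIntegral.norm_integral_le_of_norm_le_const (a := 0) (b := ℓ)
      (f := fun u => qd u * quot (t - u)) (C := 2 * (C * (1 + t) ^ a * (1 + ℓ) ^ b)) fun u hu => by
        rw [Set.uIoc_of_le hℓ0] at hu
        have h3 := hshift t u hu.1.le (hu.2.trans hℓt)
        rw [Real.norm_eq_abs, abs_mul]
        have h4 : |qd u| ≤ 2 := by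
          rw [qd, abs_le]
          constructor <;> linarith [Real.cos_le_one u, Real.neg_one_le_cos u]
        refine mul_le_mul h4 (h3.trans ?_) (abs_nonneg _) two_pos.le
        gcongr
        · have := hu.1
          linarith
        · exact hu.2
    rwa [sub_zero, abs_of_nonneg hℓ0] at h2
  -- the remaining part, which is exponentially small in `ℓ`
  have e4 : |∑ a ∈ intsBelow sysD (t - ℓ), Real.exp (-lg sysD a) *
      tailKernel sysD ℓ (t - lg sysD a)| ≤
      6 * Real.exp 2 * (1 + t) ^ 11 * Real.exp (-ℓ / 2) := by
    have h2 : |∑ a ∈ intsBelow sysD (t - ℓ), Real.exp (-lg sysD a) *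
        tailKernel sysD ℓ (t - lg sysD a)| ≤ ∑ a ∈ intsBelow sysD (t - ℓ),
        Real.exp (-lg sysD a) * (6 * (1 + t) ^ 3 * Real.exp (-ℓ / 2)) := by
      refine (Finset.abs_sum_le_sum_abs _ _).trans (Finset.sum_le_sum fun a ha => ?_)
      rw [mem_intsBelow hp] at ha
      have h3 := abs_tailKernel_le hℓ0 (s := t - lg sysD a) (by linarith)
      have h4 := lg_nonneg hp a
      rw [abs_mul, abs_of_pos (Real.exp_pos _)]
      gcongr
      refine h3.trans ?_
      gcongr
      · linarith
      · linarith
    rw [← Finset.sum_mul] at h2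
    refine h2.trans ?_
    have h5 := sum_exp_neg_lg_le (t := t - ℓ) (by linarith)
    have h6 : (1 + (t - ℓ)) ^ 8 ≤ (1 + t) ^ 8 := by gcongr; linarith
    calc _ ≤ Real.exp 2 * (1 + t) ^ 8 * (6 * (1 + t) ^ 3 * Real.exp (-ℓ / 2)) := by
          gcongr
          exact h5.trans (by gcongr)
      _ = _ := by ring
  have e5 : (1 + t) ^ 11 * Real.exp (-ℓ / 2) ≤ 2 ^ (11 + b) * K₂ * (1 + t) ^ a := by
    have h2 : t ^ (11 + b) ≤ K₂ * Real.exp (ℓ / 2) := by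
      refine le_trans ?_ (hKN ℓ hℓ0)
      rw [← hℓt', ← pow_mul]
      gcongr
      linarith
    have h3 : (1 + t) ^ (11 + b) ≤ 2 ^ (11 + b) * t ^ (11 + b) := by
      rw [← mul_pow]; gcongr; linarith
    have h4 : Real.exp (ℓ / 2) * Real.exp (-ℓ / 2) = 1 := by
      rw [← Real.exp_add]; simp [neg_div]
    have h5 : (1 + t) ^ (11 + b) * Real.exp (-ℓ / 2) ≤ 2 ^ (11 + b) * K₂ := by
      calc _ ≤ 2 ^ (11 + b) * (K₂ * Real.exp (ℓ / 2)) * Real.exp (-ℓ / 2) := by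
            gcongr
            exact h3.trans (by gcongr)
        _ = 2 ^ (11 + b) * K₂ * (Real.exp (ℓ / 2) * Real.exp (-ℓ / 2)) := by ring
        _ = _ := by rw [h4, mul_one]
    have h6 : (1 : ℝ) ≤ (1 + t) ^ b * (1 + t) ^ a := by
      rw [← Real.rpow_natCast, ← Real.rpow_add (by linarith)]
      exact Real.one_le_rpow (by linarith) (by linarith)
    rw [pow_add] at h5
    have h7 : 0 ≤ (1 + t) ^ 11 * Real.exp (-ℓ / 2) := by positivity
    calc _ ≤ (1 + t) ^ 11 * Real.exp (-ℓ / 2) * ((1 + t) ^ b * (1 + t) ^ a) :=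
          le_mul_of_one_le_right h7 h6
      _ = (1 + t) ^ 11 * (1 + t) ^ b * Real.exp (-ℓ / 2) * (1 + t) ^ a := by ring
      _ ≤ _ := by gcongr
  have hℓc : 1 ≤ ℓ ^ c := one_le_pow₀ hℓ1
  have htt : ℓ ^ c * ℓ ^ c = t := by rw [← pow_add, ← two_mul, hℓt']
  have h1ℓ : (1 + ℓ) ^ c ≤ 2 ^ c * ℓ ^ c := by
    rw [← mul_pow]; gcongr; linarith
  have e23 : 8 * (1 + ℓ) ^ 2 * (C * (1 + t) ^ a * (1 + ℓ) ^ b) +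
      2 * (C * (1 + t) ^ a * (1 + ℓ) ^ b) * ℓ ≤ 10 * 2 ^ c * C * (1 + t) ^ a * ℓ ^ c := by
    have h2 : ℓ ≤ (1 + ℓ) ^ 2 := by nlinarith
    calc _ ≤ 8 * (1 + ℓ) ^ 2 * (C * (1 + t) ^ a * (1 + ℓ) ^ b) +
          2 * (C * (1 + t) ^ a * (1 + ℓ) ^ b) * (1 + ℓ) ^ 2 := by gcongr
      _ = 10 * C * (1 + t) ^ a * (1 + ℓ) ^ c := by rw [hc, pow_add]; ring
      _ ≤ 10 * C * (1 + t) ^ a * (2 ^ c * ℓ ^ c) := by gcongr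
      _ = _ := by ring
  have hmain : t * |quot t| ≤ A * (1 + t) ^ a * ℓ ^ c := by
    have h2 : t * |quot t| = |t * quot t| := by rw [abs_mul, abs_of_nonneg ht]
    rw [h2, mul_quot hℓ0 hℓt]
    refine (abs_add_le _ _).trans ((add_le_add ((abs_add_le _ _).trans
      (add_le_add e1 ((abs_sub _ _).trans (add_le_add e2 e3)))) e4).trans ?_)
    have h3 : 6 * Real.exp 2 * (1 + t) ^ 11 * Real.exp (-ℓ / 2) ≤
        6 * Real.exp 2 * (2 ^ (11 + b) * K₂ * (1 + t) ^ a) := by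
      rw [mul_assoc]; gcongr
    have h4 : 2 * C * K₁ * (1 + t) ^ a ≤ 2 * C * K₁ * (1 + t) ^ a * ℓ ^ c :=
      le_mul_of_one_le_right (by positivity) hℓc
    have h5 : 6 * Real.exp 2 * (2 ^ (11 + b) * K₂ * (1 + t) ^ a) ≤
        6 * Real.exp 2 * (2 ^ (11 + b) * K₂ * (1 + t) ^ a) * ℓ ^ c :=
      le_mul_of_one_le_right (by positivity) hℓc
    have h6 : A * (1 + t) ^ a * ℓ ^ c = 2 * C * K₁ * (1 + t) ^ a * ℓ ^ c +
      10 * 2 ^ c * C * (1 + t) ^ a * ℓ ^ c +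
      6 * Real.exp 2 * (2 ^ (11 + b) * K₂ * (1 + t) ^ a) * ℓ ^ c := by rw [hA]; ring
    rw [h6]
    linarith
  have hsq : (1 + t) ^ (1 / 2 : ℝ) ≤ 2 * ℓ ^ c := by
    rw [← Real.sqrt_eq_rpow, Real.sqrt_le_left (by positivity)]
    nlinarith
  have h7 : ℓ ^ c * |quot t| ≤ A * (1 + t) ^ a := by
    have : ℓ ^ c * (ℓ ^ c * |quot t|) ≤ ℓ ^ c * (A * (1 + t) ^ a) := by
      rw [← mul_assoc, htt]; linarith
    exact le_of_mul_le_mul_left this (by linarith)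
  have h8 : ℓ ^ c * |quot t| ≤ ℓ ^ c * (2 * A * (1 + t) ^ (a - 1 / 2)) := by
    refine h7.trans ?_
    rw [← hsplit]
    calc A * ((1 + t) ^ (a - 1 / 2) * (1 + t) ^ (1 / 2 : ℝ)) ≤
          A * ((1 + t) ^ (a - 1 / 2) * (2 * ℓ ^ c)) := by gcongr
      _ = _ := by ring
  refine (le_of_mul_le_mul_left h8 (by linarith)).trans ?_
  gcongr
  linarith

/-- The convolution quotient decays faster than `t ^ (-3)`: iterate the bootstrap step from the
trivial bound of degree `10`. -/
theorem quot_bound : ∃ C : ℝ, 0 ≤ C ∧ ∀ t, 0 ≤ t → |quot t| ≤ C * (1 + t) ^ (-4 : ℝ) := by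
  have h : ∀ n : ℕ, n ≤ 28 →
      ∃ C : ℝ, 0 ≤ C ∧ ∀ t, 0 ≤ t → |quot t| ≤ C * (1 + t) ^ (10 - n / 2 : ℝ) := by
    intro n
    induction n with
    | zero =>
      intro _
      refine ⟨Real.exp 2, (Real.exp_pos _).le, fun t ht => (abs_quot_le ht).trans (le_of_eq ?_)⟩
      rw [← Real.rpow_natCast]; norm_num
    | succ n ih =>
      intro hn
      have hn' : (n : ℝ) ≤ 28 := by exact_mod_cast (by omega : n ≤ 28)
      obtain ⟨C, hC, h⟩ := quot_bound_step (b := 10) (by push_cast; linarith) (ih (by omega))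
      refine ⟨C, hC, fun t ht => (h t ht).trans (le_of_eq ?_)⟩
      congr 2; push_cast; ring
  obtain ⟨C, hC, h⟩ := h 28 le_rfl
  refine ⟨C, hC, fun t ht => (h t ht).trans (le_of_eq ?_)⟩
  norm_num

/-! ### The counting functions of the two discrete systems -/

theorem hasDerivAt_one_add_rpow {r : ℝ} (hr : 1 < r) {u : ℝ} (hu : 0 ≤ u) :
    HasDerivAt (fun u : ℝ => -((1 + u) ^ (1 - r) / (r - 1))) ((1 + u) ^ (-r)) u := by
  have := ((((hasDerivAt_id u).const_add 1).rpow_const (p := 1 - r)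
    (Or.inl (by simp only [id]; linarith))).div_const (r - 1)).neg
  refine this.congr_deriv ?_
  simp only [id]
  have : r - 1 ≠ 0 := by linarith
  rw [show 1 - r - 1 = -r by ring]
  field_simp
  ring

theorem integral_one_add_rpow_le {r : ℝ} (hr : 1 < r) {a b : ℝ} (ha : 0 ≤ a) (hab : a ≤ b) :
    ∫ u in a..b, (1 + u) ^ (-r) ≤ (1 + a) ^ (1 - r) / (r - 1) := by
  have hnn : ∀ u ∈ Set.uIcc a b, 0 ≤ u := fun u hu => by
    rw [Set.uIcc_of_le hab] at hu; exact ha.trans hu.1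
  rw [intervalIntegral.integral_eq_sub_of_hasDerivAt
    (fun u hu => hasDerivAt_one_add_rpow hr (hnn u hu))]
  · have : 0 ≤ (1 + b) ^ (1 - r) / (r - 1) :=
      div_nonneg (Real.rpow_nonneg (by linarith) _) (by linarith)
    linarith
  · refine ContinuousOn.intervalIntegrable fun u hu => ContinuousAt.continuousWithinAt ?_
    exact ContinuousAt.rpow_const (by fun_prop) (Or.inl (by linarith [hnn u hu]))

/-- Integrals of functions with a power decay converge, with a rate. -/
theorem exists_integral_limit {g : ℝ → ℝ} {C r : ℝ} (hr : 1 < r) (hC : 0 ≤ C)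
    (hi : ∀ b, 0 ≤ b → IntervalIntegrable g volume 0 b)
    (hg : ∀ u, 0 ≤ u → |g u| ≤ C * (1 + u) ^ (-r)) :
    ∃ I : ℝ, ∀ t, 0 ≤ t → |(∫ u in (0 : ℝ)..t, g u) - I| ≤ C / (r - 1) * (1 + t) ^ (1 - r) := by
  have hdiff : ∀ a b, 0 ≤ a → a ≤ b →
      |(∫ u in (0 : ℝ)..b, g u) - ∫ u in (0 : ℝ)..a, g u| ≤
        C / (r - 1) * (1 + a) ^ (1 - r) := fun a b ha hab => by
    rw [intervalIntegral.integral_interval_sub_left (hi b (ha.trans hab)) (hi a ha)]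
    have h1 := intervalIntegral.norm_integral_le_of_norm_le (μ := volume) (f := g) hab
      (g := fun u => C * (1 + u) ^ (-r))
      (Eventually.of_forall fun u hu => hg u (ha.trans hu.1.le)) (by
        refine ContinuousOn.intervalIntegrable fun u hu => ContinuousAt.continuousWithinAt ?_
        rw [Set.uIcc_of_le hab] at hu
        exact ContinuousAt.const_mul (ContinuousAt.rpow_const (by fun_prop)
          (Or.inl (by linarith [hu.1]))) C)
    rw [intervalIntegral.integral_const_mul] at h1
    refine h1.trans ((mul_le_mul_of_nonneg_left (integral_one_add_rpow_le hr ha hab) hC).trans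
      (le_of_eq ?_))
    ring
  have htend : Tendsto (fun a : ℝ => C / (r - 1) * (1 + a) ^ (1 - r)) atTop (nhds 0) := by
    have h1 : Tendsto (fun a : ℝ => (1 + a) ^ (1 - r)) atTop (nhds 0) := by
      have := (tendsto_rpow_neg_atTop (show 0 < r - 1 by linarith)).comp
        (tendsto_atTop_add_const_left atTop (1 : ℝ) tendsto_id)
      refine this.congr fun a => ?_
      simp
    simpa using h1.const_mul (C / (r - 1))
  have hcauchy : CauchySeq fun t : ℝ => ∫ u in (0 : ℝ)..t, g u := by
    rw [Metric.cauchySeq_iff']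
    intro ε hε
    obtain ⟨a, ha0, ha⟩ := ((eventually_ge_atTop 0).and (htend.eventually_lt_const hε)).exists
    exact ⟨a, fun b hb => (hdiff a b ha0 hb).trans_lt ha⟩
  obtain ⟨I, hI⟩ := cauchySeq_tendsto_of_complete hcauchy
  refine ⟨I, fun t ht => ?_⟩
  have h1 : Tendsto (fun b => |(∫ u in (0 : ℝ)..t, g u) - ∫ u in (0 : ℝ)..b, g u|) atTop
      (nhds |(∫ u in (0 : ℝ)..t, g u) - I|) := (hI.const_sub _).abs
  refine le_of_tendsto h1 ?_
  filter_upwards [eventually_ge_atTop t] with b hb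
  rw [abs_sub_comm]
  exact hdiff t b ht hb

/-- The function `e^{-t} N_D(e^t)`. -/
noncomputable def normCount (t : ℝ) : ℝ := intSum sysD ek t

theorem normCount_eq_card (t : ℝ) :
    normCount t = Real.exp (-t) * (intsBelow sysD t).card := by
  rw [normCount, intSum, mul_comm, ← nsmul_eq_mul, ← Finset.sum_const]
  refine Finset.sum_congr rfl fun a _ => ?_
  rw [ek, ← Real.exp_add]; congr 1; ring

theorem intervalIntegrable_intSum {W : ℝ → ℝ} (hW : Continuous W) {b : ℝ} (hb : 0 ≤ b) :
    IntervalIntegrable (intSum sysD W) volume 0 b := by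
  have h := intervalIntegrable_mul_intSum_sub isGPrimeSystem_sysD (κ := fun _ => 1)
    continuous_const hW (t := b) hb le_rfl
  have h2 := h.comp_sub_left b
  simpa using h2

theorem integral_mul_comp_sub (f g : ℝ → ℝ) (t : ℝ) :
    ∫ u in (0 : ℝ)..t, f u * g (t - u) = ∫ u in (0 : ℝ)..t, f (t - u) * g u := by
  have := congrFun (cv_comm f g) t
  simp only [cv] at this
  rw [this]
  exact intervalIntegral.integral_congr fun u _ => mul_comm _ _

/-- The integers of `q_1, q_2, …` are recovered from the convolution quotient by convolution with
`exp^*(dΠ_B)`. -/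
theorem normCount_eq {t : ℝ} (ht : 0 ≤ t) :
    normCount t = quot t + ∫ u in (0 : ℝ)..t, bh (t - u) * quot u := by
  rw [normCount, ← wk_add, intSum_add,
    intSum_cv isGPrimeSystem_sysD continuous_bh continuous_wk ht]
  change quot t + (∫ u in (0 : ℝ)..t, bh u * quot (t - u)) = _
  rw [integral_mul_comp_sub]

/-- The g-integers of `q_1, q_2, …` have a density, with the error term that `bh` has: the
convolution quotient decays faster. -/
theorem exists_normCount_asymptotic :
    ∃ c C : ℝ, 0 ≤ C ∧ ∀ t, 0 ≤ t → |normCount t - c| ≤ C * (1 + t) ^ (-(3 / 2) : ℝ) := by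
  obtain ⟨C, hC, hq⟩ := quot_bound
  obtain ⟨H, C₁, hC₁, hh⟩ := bh_asymptotic
  have hqi : ∀ b, 0 ≤ b → IntervalIntegrable quot volume 0 b := fun b hb =>
    intervalIntegrable_intSum continuous_wk hb
  obtain ⟨I, hI⟩ := exists_integral_limit (by norm_num) hC hqi hq
  refine ⟨H * I, C + C * C₁ + |H| * C, by positivity, fun t ht => ?_⟩
  set P := (1 + t) ^ (-(3 / 2) : ℝ) with hP
  have hP0 : 0 ≤ P := by positivity
  have hmono : ∀ x : ℝ, x ≤ -(3 / 2) → (1 + t) ^ x ≤ P := fun x hx =>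
    Real.rpow_le_rpow_of_exponent_le (by linarith) hx
  have h1 : |quot t| ≤ C * P := (hq t ht).trans (by gcongr; exact hmono _ (by norm_num))
  have h2 : |∫ u in (0 : ℝ)..t, (bh (t - u) - H) * quot u| ≤ C * C₁ * P := by
    have h3 : ∀ u ∈ Set.Ioc 0 t, ‖(bh (t - u) - H) * quot u‖ ≤
        C * C₁ * P * (1 + u) ^ (-2 : ℝ) := fun u hu => by
      have hu0 : 0 ≤ u := hu.1.le
      have h4 := hh (t - u) (by linarith [hu.2])
      have h5 := rpow_sub_le (a := -(3 / 2)) (b := 2) (by norm_num) hu0 hu.2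
      have h6 : (1 + u) ^ (2 : ℕ) * (1 + u) ^ (-4 : ℝ) = (1 + u) ^ (-2 : ℝ) := by
        rw [← Real.rpow_natCast, ← Real.rpow_add (by linarith)]; norm_num
      rw [Real.norm_eq_abs, abs_mul]
      calc _ ≤ C₁ * (P * (1 + u) ^ (2 : ℕ)) * (C * (1 + u) ^ (-4 : ℝ)) := by
            gcongr
            · exact h4.trans (by gcongr)
            · exact hq u hu0
        _ = C * C₁ * P * ((1 + u) ^ (2 : ℕ) * (1 + u) ^ (-4 : ℝ)) := by ring
        _ = _ := by rw [h6]
    have h7 := intervalIntegral.norm_integral_le_of_norm_le (μ := volume) ht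
      (Eventually.of_forall h3) (by
        refine ContinuousOn.intervalIntegrable fun u hu => ContinuousAt.continuousWithinAt ?_
        rw [Set.uIcc_of_le ht] at hu
        exact ContinuousAt.const_mul (ContinuousAt.rpow_const (by fun_prop)
          (Or.inl (by linarith [hu.1]))) _)
    have h8 := integral_one_add_rpow_le (r := 2) (by norm_num) le_rfl ht
    rw [intervalIntegral.integral_const_mul] at h7
    refine h7.trans (mul_le_of_le_one_right (by positivity) (h8.trans (le_of_eq ?_)))
    norm_num
  have h3 : |H * ((∫ u in (0 : ℝ)..t, quot u) - I)| ≤ |H| * C * P := by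
    rw [abs_mul, mul_assoc]
    gcongr
    refine (hI t ht).trans ?_
    have h4 : (1 + t) ^ (1 - 4 : ℝ) ≤ P := hmono _ (by norm_num)
    have h5 : C / (4 - 1) ≤ C := div_le_self hC (by norm_num)
    gcongr
  have h4 : ∫ u in (0 : ℝ)..t, bh (t - u) * quot u =
      (∫ u in (0 : ℝ)..t, (bh (t - u) - H) * quot u) + H * ∫ u in (0 : ℝ)..t, quot u := by
    have hb := continuous_bh
    rw [← intervalIntegral.integral_const_mul, ← intervalIntegral.integral_add]
    · exact intervalIntegral.integral_congr fun u _ => by ring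
    · exact (hqi t ht).continuousOn_mul (by fun_prop)
    · exact (hqi t ht).const_mul H
  rw [normCount_eq ht, h4]
  have e : quot t + ((∫ u in (0 : ℝ)..t, (bh (t - u) - H) * quot u) +
      H * ∫ u in (0 : ℝ)..t, quot u) - H * I = quot t +
      (∫ u in (0 : ℝ)..t, (bh (t - u) - H) * quot u) +
      H * ((∫ u in (0 : ℝ)..t, quot u) - I) := by ring
  rw [e]
  have := abs_add_le (quot t + ∫ u in (0 : ℝ)..t, (bh (t - u) - H) * quot u)
    (H * ((∫ u in (0 : ℝ)..t, quot u) - I))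
  have := abs_add_le (quot t) (∫ u in (0 : ℝ)..t, (bh (t - u) - H) * quot u)
  linarith

/-- The sum of the reciprocals of the g-integers of the system `q_1, q_2, …` up to `e^t`. -/
noncomputable def recipSum (t : ℝ) : ℝ := ∑ a ∈ intsBelow sysD t, Real.exp (-lg sysD a)

/-- Partial summation. -/
theorem recipSum_eq {t : ℝ} (ht : 0 ≤ t) :
    recipSum t = normCount t + ∫ u in (0 : ℝ)..t, normCount u := by
  have h1 : (fun _ => 1 : ℝ → ℝ) = ek + cv (fun _ => 1) ek := by
    funext t
    simp only [Pi.add_apply, cv, one_mul]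
    rw [intervalIntegral.integral_comp_sub_left ek t, sub_self, sub_zero,
      intervalIntegral.integral_eq_sub_of_hasDerivAt (f := fun u => -Real.exp (-u))
      (fun u _ => ((hasDerivAt_neg u).exp).neg.congr_deriv (by simp [ek]))
      (continuous_ek.intervalIntegrable _ _)]
    simp [ek]
  have h2 : recipSum t = intSum sysD (fun _ => 1) t := by simp [recipSum, intSum]
  rw [h2, h1, intSum_add, intSum_cv isGPrimeSystem_sysD continuous_const continuous_ek ht]
  congr 1
  rw [integral_mul_comp_sub]
  exact intervalIntegral.integral_congr fun u _ => one_mul _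

/-- The density of the g-integers of `q_1, q_2, …` is positive: otherwise the sum of the
reciprocals of the g-integers would converge, but the sum of the `1 / q_k` diverges. -/
theorem density_pos {c C : ℝ} (hC : 0 ≤ C)
    (h : ∀ t, 0 ≤ t → |normCount t - c| ≤ C * (1 + t) ^ (-(3 / 2) : ℝ)) : 0 < c := by
  by_contra hc
  push Not at hc
  have hle : ∀ t, 0 ≤ t → normCount t ≤ C * (1 + t) ^ (-(3 / 2) : ℝ) := fun t ht => by
    linarith [(abs_le.1 (h t ht)).2]
  have hS : ∀ t, 0 ≤ t → recipSum t ≤ 3 * C := fun t ht => by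
    rw [recipSum_eq ht]
    have h1 : normCount t ≤ C :=
      (hle t ht).trans (mul_le_of_le_one_right hC
        (Real.rpow_le_one_of_one_le_of_nonpos (by linarith) (by norm_num)))
    have h2 : ∫ u in (0 : ℝ)..t, normCount u ≤
        ∫ u in (0 : ℝ)..t, C * (1 + u) ^ (-(3 / 2) : ℝ) := by
      refine intervalIntegral.integral_mono_on ht (intervalIntegrable_intSum continuous_ek ht) ?_
        fun u hu => hle u hu.1
      refine ContinuousOn.intervalIntegrable fun u hu => ContinuousAt.continuousWithinAt ?_
      rw [Set.uIcc_of_le ht] at hu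
      exact ContinuousAt.const_mul (ContinuousAt.rpow_const (by fun_prop)
          (Or.inl (by linarith [hu.1]))) _
    rw [intervalIntegral.integral_const_mul] at h2
    have h3 := integral_one_add_rpow_le (r := 3 / 2) (by norm_num) le_rfl ht
    have h4 : (1 + (0 : ℝ)) ^ (1 - 3 / 2 : ℝ) / (3 / 2 - 1) = 2 := by norm_num
    rw [h4] at h3
    nlinarith
  obtain ⟨n, hn⟩ := (tendsto_sum_inv_sysD.eventually_gt_atTop (3 * C)).exists
  have ht := Real.log_nonneg (one_le_q n)
  have h1 := sum_inv_le_sum_exp_neg_lg ht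
  rw [Real.exp_log (by linarith [one_le_q n]), PiB_q, Nat.floor_natCast] at h1
  have h2 := hS _ ht
  rw [recipSum] at h2
  linarith

theorem exists_recipSum_asymptotic {c C : ℝ} (hC : 0 ≤ C)
    (h : ∀ t, 0 ≤ t → |normCount t - c| ≤ C * (1 + t) ^ (-(3 / 2) : ℝ)) :
    ∃ G C' : ℝ, 0 ≤ C' ∧
      ∀ t, 0 ≤ t → |recipSum t - (c + c * t + G)| ≤ C' * (1 + t) ^ (-(1 / 2) : ℝ) := by
  have hn : ∀ b, 0 ≤ b → IntervalIntegrable normCount volume 0 b := fun b hb =>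
    intervalIntegrable_intSum continuous_ek hb
  have hi : ∀ b, 0 ≤ b → IntervalIntegrable (fun u => normCount u - c) volume 0 b := fun b hb =>
    (hn b hb).sub intervalIntegrable_const
  obtain ⟨G, hG⟩ := exists_integral_limit (by norm_num) hC hi h
  refine ⟨G, 3 * C, by positivity, fun t ht => ?_⟩
  have h1 := h t ht
  have h2 := hG t ht
  rw [intervalIntegral.integral_sub (hn t ht) intervalIntegrable_const,
    intervalIntegral.integral_const, smul_eq_mul, sub_zero] at h2
  have h3 : (1 + t) ^ (-(3 / 2) : ℝ) ≤ (1 + t) ^ (-(1 / 2) : ℝ) :=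
    Real.rpow_le_rpow_of_exponent_le (by linarith) (by norm_num)
  have h4 : C / (3 / 2 - 1) * (1 + t) ^ (1 - 3 / 2 : ℝ) = 2 * C * (1 + t) ^ (-(1 / 2) : ℝ) := by
    rw [show (1 - 3 / 2 : ℝ) = -(1 / 2) by norm_num]; ring
  rw [h4] at h2
  rw [recipSum_eq ht]
  have e : normCount t + (∫ u in (0 : ℝ)..t, normCount u) - (c + c * t + G) =
    (normCount t - c) + ((∫ u in (0 : ℝ)..t, normCount u) - t * c - G) := by ring
  rw [e]
  refine (abs_add_le _ _).trans ?_
  have : C * (1 + t) ^ (-(3 / 2) : ℝ) ≤ C * (1 + t) ^ (-(1 / 2) : ℝ) := by gcongr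
  linarith

/-- A g-integer of `q_1, q_1, q_2, q_2, …` is a pair of g-integers of `q_1, q_2, …`. -/
noncomputable def pairEquiv : (ℕ →₀ ℕ) ≃ (ℕ →₀ ℕ) × (ℕ →₀ ℕ) :=
  (Finsupp.equivCongrLeft Equiv.natSumNatEquivNat.symm).trans Finsupp.sumFinsuppEquivProdFinsupp

theorem gInt_pairEquiv_symm (x : (ℕ →₀ ℕ) × (ℕ →₀ ℕ)) :
    gInt sysP (pairEquiv.symm x) = gInt sysD x.1 * gInt sysD x.2 := by
  have h : pairEquiv.symm x =
      Finsupp.equivMapDomain Equiv.natSumNatEquivNat (Finsupp.sumElim x.1 x.2) := rfl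
  rw [h, gInt, Finsupp.prod_equivMapDomain, Finsupp.prod_sumElim]
  congr 1
  · refine Finsupp.prod_congr fun i _ => ?_
    simp [sysP_eq]
  · refine Finsupp.prod_congr fun i _ => ?_
    have : (2 * i + 1) / 2 = i := by omega
    simp [sysP_eq, this]

theorem lg_pairEquiv_symm (x : (ℕ →₀ ℕ) × (ℕ →₀ ℕ)) :
    lg sysP (pairEquiv.symm x) = lg sysD x.1 + lg sysD x.2 := by
  have hp := isGPrimeSystem_sysD
  rw [lg, gInt_pairEquiv_symm, Real.log_mul (gInt_pos hp _).ne' (gInt_pos hp _).ne']; rfl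

/-- Dirichlet's hyperbola method for the g-integers of `q_1, q_1, q_2, q_2, …`. -/
theorem card_intsBelow_sysP (t : ℝ) :
    ((intsBelow sysP t).card : ℝ) = 2 * ∑ a ∈ intsBelow sysD (t / 2),
      ((intsBelow sysD (t - lg sysD a)).card : ℝ) - ((intsBelow sysD (t / 2)).card : ℝ) ^ 2 := by
  classical
  have hp := isGPrimeSystem_sysD
  have hl := lg_nonneg hp
  set T := (intsBelow sysD t ×ˢ intsBelow sysD t).filter fun x => lg sysD x.1 + lg sysD x.2 ≤ t
  have hT : ∀ x, x ∈ T ↔ lg sysD x.1 + lg sysD x.2 ≤ t := fun x => by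
    rw [Finset.mem_filter, Finset.mem_product, mem_intsBelow hp, mem_intsBelow hp]
    exact ⟨fun h => h.2, fun h => ⟨⟨by linarith [hl x.2], by linarith [hl x.1]⟩, h⟩⟩
  have h1 : (intsBelow sysP t).card = T.card := by
    refine Finset.card_equiv pairEquiv fun a => ?_
    rw [mem_intsBelow isGPrimeSystem_sysP, hT, ← lg_pairEquiv_symm,
      Equiv.symm_apply_apply]
  set T₁ := T.filter fun x => lg sysD x.1 ≤ t / 2
  set T₂ := T.filter fun x => lg sysD x.2 ≤ t / 2
  have hU : T₁ ∪ T₂ = T := by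
    ext x
    simp only [T₁, T₂, Finset.mem_union, Finset.mem_filter, hT]
    constructor
    · rintro (h | h) <;> exact h.1
    · intro h
      rcases le_total (lg sysD x.1) (t / 2) with h2 | h2
      · exact Or.inl ⟨h, h2⟩
      · exact Or.inr ⟨h, by linarith⟩
  have hI : T₁ ∩ T₂ = intsBelow sysD (t / 2) ×ˢ intsBelow sysD (t / 2) := by
    ext x
    simp only [T₁, T₂, Finset.mem_inter, Finset.mem_filter, hT, Finset.mem_product,
      mem_intsBelow hp]
    constructor
    · rintro ⟨h2, h3⟩; exact ⟨h2.2, h3.2⟩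
    · rintro ⟨h2, h3⟩; exact ⟨⟨by linarith, h2⟩, ⟨by linarith, h3⟩⟩
  have hc₁ : T₁.card = ∑ a ∈ intsBelow sysD (t / 2), (intsBelow sysD (t - lg sysD a)).card := by
    rw [← Finset.card_sigma]
    refine Finset.card_bij' (fun x _ => ⟨x.1, x.2⟩) (fun y _ => (y.1, y.2)) ?_ ?_ ?_ ?_
    · intro x hx
      simp only [T₁, Finset.mem_filter, hT] at hx
      simp only [Finset.mem_sigma, mem_intsBelow hp]
      exact ⟨hx.2, by linarith⟩
    · intro y hy
      simp only [Finset.mem_sigma, mem_intsBelow hp] at hy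
      simp only [T₁, Finset.mem_filter, hT]
      exact ⟨by linarith, hy.1⟩
    · intro x _; rfl
    · intro y _; rfl
  have hc₂ : T₂.card = T₁.card := by
    refine Finset.card_equiv (Equiv.prodComm _ _) fun x => ?_
    simp only [T₁, T₂, Finset.mem_filter, hT, Equiv.prodComm_apply, Prod.fst_swap, Prod.snd_swap,
      add_comm]
  have h2 := Finset.card_union_add_card_inter T₁ T₂
  rw [hU, hI, hc₂, ← h1, Finset.card_product, hc₁] at h2
  have h3 : ((intsBelow sysP t).card : ℝ) + (intsBelow sysD (t / 2)).card *
      (intsBelow sysD (t / 2)).card = ∑ a ∈ intsBelow sysD (t / 2),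
      ((intsBelow sysD (t - lg sysD a)).card : ℝ) + ∑ a ∈ intsBelow sysD (t / 2),
      ((intsBelow sysD (t - lg sysD a)).card : ℝ) := by exact_mod_cast h2
  linarith

theorem exp_neg_mul_card_sysP (t : ℝ) :
    Real.exp (-t) * (intsBelow sysP t).card =
      2 * ∑ a ∈ intsBelow sysD (t / 2), Real.exp (-lg sysD a) * normCount (t - lg sysD a) -
        normCount (t / 2) ^ 2 := by
  rw [card_intsBelow_sysP t, mul_sub, normCount_eq_card, mul_pow, ← Real.exp_nat_mul]
  congr 1
  · rw [mul_left_comm, Finset.mul_sum]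
    congr 1
    refine Finset.sum_congr rfl fun a _ => ?_
    rw [normCount_eq_card, ← mul_assoc, ← Real.exp_add]
    congr 2; ring
  · congr 2; push_cast; ring

/-- The hyperbola method: the g-integers of `q_1, q_1, q_2, q_2, …` are the pairs of g-integers of
`q_1, q_2, …`, so that their count is governed by `N_D` and by the sum of the reciprocals. -/
theorem sysP_count_asymptotic {c C : ℝ} (hC : 0 ≤ C)
    (h : ∀ t, 0 ≤ t → |normCount t - c| ≤ C * (1 + t) ^ (-(3 / 2) : ℝ)) :
    ∃ b K : ℝ, 0 ≤ K ∧ ∀ t, 0 ≤ t →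
      |Real.exp (-t) * (intsBelow sysP t).card - (c ^ 2 * t + b)| ≤
        K * (1 + t / 2) ^ (-(1 / 2) : ℝ) := by
  have hp := isGPrimeSystem_sysD
  obtain ⟨G, C', hC', hG⟩ := exists_recipSum_asymptotic hC h
  set A := |c| + |G| + C' with hA
  have hA0 : 0 ≤ A := by positivity
  refine ⟨c ^ 2 + 2 * c * G, 2 * |c| * C' + 2 * (A * C) + C * (C + 2 * |c|), by positivity,
    fun t ht => ?_⟩
  have ht2 : 0 ≤ t / 2 := by linarith
  set P := (1 + t / 2) ^ (-(1 / 2) : ℝ) with hP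
  set P₃ := (1 + t / 2) ^ (-(3 / 2) : ℝ) with hP₃
  have hP0 : 0 ≤ P := by positivity
  have hP30 : 0 ≤ P₃ := by positivity
  have hP31 : P₃ ≤ 1 := Real.rpow_le_one_of_one_le_of_nonpos (by linarith) (by norm_num)
  have hP3P : P₃ ≤ P := Real.rpow_le_rpow_of_exponent_le (by linarith) (by norm_num)
  have hPP : (1 + t / 2) * P₃ = P := by
    rw [hP₃, ← Real.rpow_one_add' (by linarith) (by norm_num), hP]; norm_num
  have hS := hG (t / 2) ht2
  have hSle : recipSum (t / 2) ≤ A * (1 + t / 2) := by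
    have h1 : P ≤ 1 := Real.rpow_le_one_of_one_le_of_nonpos (by linarith) (by norm_num)
    have h2 := (abs_le.1 hS).2
    have h3 := le_abs_self c
    have h4 := le_abs_self G
    have h5 := abs_nonneg G
    have h6 : C' * P ≤ C' := mul_le_of_le_one_right hC' h1
    have h7 : c * (1 + t / 2) ≤ |c| * (1 + t / 2) := by gcongr
    have h8 : |G| + C' ≤ (|G| + C') * (1 + t / 2) :=
      le_mul_of_one_le_right (by positivity) (by linarith)
    nlinarith
  set E := ∑ a ∈ intsBelow sysD (t / 2), Real.exp (-lg sysD a) * (normCount (t - lg sysD a) - c)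
  have hE : |E| ≤ A * C * P := by
    have h1 : |E| ≤ ∑ a ∈ intsBelow sysD (t / 2), Real.exp (-lg sysD a) * (C * P₃) := by
      refine (Finset.abs_sum_le_sum_abs _ _).trans (Finset.sum_le_sum fun a ha => ?_)
      rw [mem_intsBelow hp] at ha
      rw [abs_mul, abs_of_pos (Real.exp_pos _)]
      refine mul_le_mul_of_nonneg_left ((h _ (by linarith)).trans ?_) (Real.exp_pos _).le
      refine mul_le_mul_of_nonneg_left ?_ hC
      exact Real.rpow_le_rpow_of_nonpos (by linarith) (by linarith) (by norm_num)
    rw [← Finset.sum_mul] at h1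
    refine h1.trans ?_
    change recipSum (t / 2) * (C * P₃) ≤ _
    calc _ ≤ A * (1 + t / 2) * (C * P₃) := by gcongr
      _ = A * C * ((1 + t / 2) * P₃) := by ring
      _ = _ := by rw [hPP]
  have hmain : ∑ a ∈ intsBelow sysD (t / 2), Real.exp (-lg sysD a) * normCount (t - lg sysD a) =
      c * recipSum (t / 2) + E := by
    rw [recipSum, Finset.mul_sum, ← Finset.sum_add_distrib]
    exact Finset.sum_congr rfl fun a _ => by ring
  set δ := normCount (t / 2) - c
  have hδ : |δ| ≤ C * P₃ := h _ ht2
  have hδ2 : |δ * (δ + 2 * c)| ≤ C * (C + 2 * |c|) * P := by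
    have h1 : |δ| ≤ C := hδ.trans (mul_le_of_le_one_right hC hP31)
    have h2 : |δ + 2 * c| ≤ C + 2 * |c| := (abs_add_le _ _).trans (by
      rw [abs_mul, abs_two]; linarith)
    rw [abs_mul]
    calc _ ≤ C * P₃ * (C + 2 * |c|) := by gcongr
      _ ≤ C * P * (C + 2 * |c|) := by gcongr
      _ = _ := by ring
  rw [exp_neg_mul_card_sysP t, hmain]
  have e : 2 * (c * recipSum (t / 2) + E) - normCount (t / 2) ^ 2 -
      (c ^ 2 * t + (c ^ 2 + 2 * c * G)) =
      2 * c * (recipSum (t / 2) - (c + c * (t / 2) + G)) + 2 * E - δ * (δ + 2 * c) := by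
    simp only [δ]; ring
  rw [e]
  have h1 : |2 * c * (recipSum (t / 2) - (c + c * (t / 2) + G))| ≤ 2 * |c| * (C' * P) := by
    rw [abs_mul, abs_mul, abs_two]; gcongr
  have h2 : |2 * E| ≤ 2 * (A * C * P) := by rw [abs_mul, abs_two]; gcongr
  refine (abs_sub _ _).trans ((add_le_add ((abs_add_le _ _).trans (add_le_add h1 h2))
    hδ2).trans (le_of_eq ?_))
  ring

theorem intCount_eq_card {p : ℕ → ℝ} (hp : IsGPrimeSystem p) {x : ℝ} (hx : 0 < x) :
    intCount p x = (intsBelow p (Real.log x)).card := by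
  have : {a : ℕ →₀ ℕ | gInt p a ≤ x} = (intsBelow p (Real.log x) : Set (ℕ →₀ ℕ)) := by
    ext a
    rw [Finset.mem_coe, mem_intsBelow hp, lg, Real.log_le_log_iff (gInt_pos hp a) hx]
    rfl
  rw [intCount, this, Set.ncard_coe_finset]

/-- The asymptotic formulas for the counting functions of both discrete systems. -/
theorem intCount_asymptotics : ∃ c b : ℝ, 0 < c ∧
    ((fun x : ℝ => intCount sysD x - c * x) =O[atTop]
      fun x : ℝ => x / Real.log x ^ (3 / 2 : ℝ)) ∧
    ((fun x : ℝ => intCount sysP x - (c ^ 2 * (x * Real.log x) + b * x)) =O[atTop]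
      fun x : ℝ => x / Real.log x ^ (1 / 2 : ℝ)) := by
  obtain ⟨c, C, hC, h⟩ := exists_normCount_asymptotic
  obtain ⟨b, K, hK, hb⟩ := sysP_count_asymptotic hC h
  refine ⟨c, b, density_pos hC h, IsBigO.of_bound C ?_, IsBigO.of_bound (2 * K) ?_⟩
  · filter_upwards [eventually_gt_atTop 1] with x hx
    have hx0 : 0 < x := by linarith
    have hl := Real.log_pos hx
    have h1 := h _ hl.le
    rw [normCount_eq_card, Real.exp_neg, Real.exp_log hx0] at h1
    rw [intCount_eq_card isGPrimeSystem_sysD hx0, Real.norm_eq_abs, Real.norm_eq_abs,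
      abs_of_pos (div_pos hx0 (Real.rpow_pos_of_pos hl _))]
    have e : ((intsBelow sysD (Real.log x)).card : ℝ) - c * x =
        x * (x⁻¹ * (intsBelow sysD (Real.log x)).card - c) := by field_simp
    rw [e, abs_mul, abs_of_pos hx0]
    calc _ ≤ x * (C * (1 + Real.log x) ^ (-(3 / 2) : ℝ)) := by gcongr
      _ ≤ x * (C * (Real.log x) ^ (-(3 / 2) : ℝ)) := by
          gcongr x * (C * ?_)
          exact Real.rpow_le_rpow_of_nonpos hl (by linarith) (by norm_num)
      _ = _ := by rw [Real.rpow_neg hl.le]; ring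
  · filter_upwards [eventually_gt_atTop 1] with x hx
    have hx0 : 0 < x := by linarith
    have hl := Real.log_pos hx
    have h1 := hb _ hl.le
    rw [Real.exp_neg, Real.exp_log hx0] at h1
    rw [intCount_eq_card isGPrimeSystem_sysP hx0, Real.norm_eq_abs, Real.norm_eq_abs,
      abs_of_pos (div_pos hx0 (Real.rpow_pos_of_pos hl _))]
    have e : ((intsBelow sysP (Real.log x)).card : ℝ) - (c ^ 2 * (x * Real.log x) + b * x) =
        x * (x⁻¹ * (intsBelow sysP (Real.log x)).card - (c ^ 2 * Real.log x + b)) := by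
      field_simp
    rw [e, abs_mul, abs_of_pos hx0]
    have h2 : (1 + Real.log x / 2) ^ (-(1 / 2) : ℝ) ≤ 2 * Real.log x ^ (-(1 / 2) : ℝ) := by
      have h3 : (1 + Real.log x / 2) ^ (-(1 / 2) : ℝ) ≤ (4⁻¹ * Real.log x) ^ (-(1 / 2) : ℝ) :=
        Real.rpow_le_rpow_of_nonpos (by positivity) (by linarith) (by norm_num)
      have h4 : (4⁻¹ : ℝ) ^ (-(1 / 2) : ℝ) = 2 := by
        rw [Real.rpow_neg (by norm_num), ← Real.inv_rpow (by norm_num), inv_inv,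
          ← Real.sqrt_eq_rpow]
        rw [show (4 : ℝ) = 2 ^ 2 by norm_num, Real.sqrt_sq (by norm_num)]
      rwa [Real.mul_rpow (by norm_num) hl.le, h4] at h3
    calc _ ≤ x * (K * (1 + Real.log x / 2) ^ (-(1 / 2) : ℝ)) := by gcongr
      _ ≤ x * (K * (2 * (Real.log x) ^ (-(1 / 2) : ℝ))) := by gcongr
      _ = _ := by rw [Real.rpow_neg hl.le]; ring

/-! ### Measures on the half-line `[1, ∞)` and their zeta functions -/

/-- A measure on `[1, ∞)` whose zeta function converges absolutely for `Re s > 1`. -/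
structure HasZeta (μ : Measure ℝ) : Prop where
  null : μ (Set.Iio 1) = 0
  integrable : ∀ s : ℂ, 1 < s.re → Integrable (fun u : ℝ => (u : ℂ) ^ (-s)) μ

theorem measurable_cpow (s : ℂ) : Measurable fun u : ℝ => (u : ℂ) ^ (-s) :=
  (Complex.measurable_ofReal).pow_const _

theorem ae_one_le {μ : Measure ℝ} (h : μ (Set.Iio 1) = 0) : ∀ᵐ u ∂μ, 1 ≤ u := by
  rw [ae_iff]; simpa [Set.Iio_def] using h

theorem norm_cpow {u : ℝ} (hu : 1 ≤ u) (s : ℂ) : ‖(u : ℂ) ^ (-s)‖ = u ^ (-s.re) := by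
  rw [Complex.norm_cpow_eq_rpow_re_of_pos (by linarith), Complex.neg_re]

/-- Convergence of the zeta function at `2` makes the measure locally finite. -/
theorem HasZeta.measure_Iic_lt_top {μ : Measure ℝ} (h : HasZeta μ) (x : ℝ) :
    μ (Set.Iic x) < ⊤ := by
  have hi := h.integrable 2 (by norm_num)
  have hy : 0 < max x 1 := by positivity
  have h1 := hi.measure_norm_ge_lt_top (ε := max x 1 ^ (-2 : ℝ)) (by positivity)
  refine (measure_mono_ae (t := {u : ℝ | max x 1 ^ (-2 : ℝ) ≤ ‖(u : ℂ) ^ (-2 : ℂ)‖}) ?_).trans_lt h1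
  filter_upwards [ae_one_le h.null] with u hu hux
  have hux : u ≤ x := hux
  change _ ≤ ‖_‖
  rw [norm_cpow hu]
  exact Real.rpow_le_rpow_of_nonpos (by linarith) (hux.trans (le_max_left _ _)) (by norm_num)

theorem HasZeta.sfinite {μ : Measure ℝ} (h : HasZeta μ) : SFinite μ := by
  have : IsLocallyFiniteMeasure μ :=
    ⟨fun x => ⟨Set.Iic (x + 1), Iic_mem_nhds (by linarith), h.measure_Iic_lt_top _⟩⟩
  infer_instance

theorem hasZeta_dirac {x : ℝ} (hx : 1 ≤ x) : HasZeta (Measure.dirac x) :=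
  ⟨by rw [Measure.dirac_apply' _ measurableSet_Iio]; simpa using hx,
    fun _ _ => integrable_dirac (by simp)⟩

theorem zeta_dirac (x : ℝ) (s : ℂ) : zeta (Measure.dirac x) s = (x : ℂ) ^ (-s) :=
  integral_dirac _ _

theorem HasZeta.add {μ ν : Measure ℝ} (hμ : HasZeta μ) (hν : HasZeta ν) : HasZeta (μ + ν) :=
  ⟨by simp [hμ.null, hν.null], fun s hs => (hμ.integrable s hs).add_measure (hν.integrable s hs)⟩

theorem zeta_add {μ ν : Measure ℝ} (hμ : HasZeta μ) (hν : HasZeta ν) {s : ℂ} (hs : 1 < s.re) :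
    zeta (μ + ν) s = zeta μ s + zeta ν s :=
  integral_add_measure (hμ.integrable s hs) (hν.integrable s hs)

theorem HasZeta.smul {μ : Measure ℝ} (hμ : HasZeta μ) {c : ENNReal} (hc : c ≠ ⊤) :
    HasZeta (c • μ) :=
  ⟨by simp [hμ.null], fun s hs => (hμ.integrable s hs).smul_measure hc⟩

theorem zeta_smul (μ : Measure ℝ) (c : ENNReal) (s : ℂ) :
    zeta (c • μ) s = c.toReal * zeta μ s := by
  rw [zeta, integral_smul_measure, Complex.real_smul]; rfl

/-- Functions that are multiplicative on `[1, ∞)` integrate multiplicatively against a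
multiplicative convolution. -/
theorem integral_mconv_of_mul {𝕜 : Type*} [RCLike 𝕜] {f : ℝ → 𝕜} (hf : Measurable f)
    (hmul : ∀ x y, 1 ≤ x → 1 ≤ y → f (x * y) = f x * f y) {μ ν : Measure ℝ} [SFinite μ] [SFinite ν]
    (hμ0 : μ (Set.Iio 1) = 0) (hν0 : ν (Set.Iio 1) = 0) (hμ : Integrable f μ)
    (hν : Integrable f ν) :
    Integrable f (Measure.mconv μ ν) ∧ ∫ u, f u ∂(Measure.mconv μ ν) =
      (∫ u, f u ∂μ) * ∫ u, f u ∂ν := by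
  have hae : (fun z : ℝ × ℝ => f z.1 * f z.2) =ᵐ[μ.prod ν] fun z => f (z.1 * z.2) := by
    have h1 : ∀ᵐ z ∂μ.prod ν, 1 ≤ z.1 := Measure.quasiMeasurePreserving_fst.ae (ae_one_le hμ0)
    have h2 : ∀ᵐ z ∂μ.prod ν, 1 ≤ z.2 := Measure.quasiMeasurePreserving_snd.ae (ae_one_le hν0)
    filter_upwards [h1, h2] with z hz1 hz2
    exact (hmul _ _ hz1 hz2).symm
  have hi := (hμ.mul_prod hν).congr hae
  have hm : Measurable fun z : ℝ × ℝ => z.1 * z.2 := by fun_prop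
  refine ⟨(integrable_map_measure hf.aestronglyMeasurable hm.aemeasurable).2 hi, ?_⟩
  rw [Measure.mconv, integral_map hm.aemeasurable hf.aestronglyMeasurable, ← integral_congr_ae hae,
    integral_prod_mul]

theorem mconv_Iio_one {μ ν : Measure ℝ} [SFinite μ] [SFinite ν] (hμ0 : μ (Set.Iio 1) = 0)
    (hν0 : ν (Set.Iio 1) = 0) : Measure.mconv μ ν (Set.Iio 1) = 0 := by
  have hm : Measurable fun z : ℝ × ℝ => z.1 * z.2 := by fun_prop
  rw [Measure.mconv, Measure.map_apply hm measurableSet_Iio]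
  have h1 : ∀ᵐ z ∂μ.prod ν, 1 ≤ z.1 := Measure.quasiMeasurePreserving_fst.ae (ae_one_le hμ0)
  have h2 : ∀ᵐ z ∂μ.prod ν, 1 ≤ z.2 := Measure.quasiMeasurePreserving_snd.ae (ae_one_le hν0)
  refine measure_mono_null ?_ (ae_iff.1 (h1.and h2))
  intro z (hz : z.1 * z.2 < 1) (h3 : 1 ≤ z.1 ∧ 1 ≤ z.2)
  nlinarith [h3.1, h3.2]

theorem cpow_mul_of_one_le (s : ℂ) (x y : ℝ) (hx : 1 ≤ x) (hy : 1 ≤ y) :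
    ((x * y : ℝ) : ℂ) ^ (-s) = (x : ℂ) ^ (-s) * (y : ℂ) ^ (-s) := by
  rw [Complex.ofReal_mul]
  exact Complex.mul_cpow_ofReal_nonneg (by linarith) (by linarith) _

theorem HasZeta.mconv {μ ν : Measure ℝ} (hμ : HasZeta μ) (hν : HasZeta ν) :
    HasZeta (Measure.mconv μ ν) := by
  have := hμ.sfinite
  have := hν.sfinite
  exact ⟨mconv_Iio_one hμ.null hν.null, fun s hs => (integral_mconv_of_mul (measurable_cpow s)
    (cpow_mul_of_one_le s) hμ.null hν.null (hμ.integrable s hs) (hν.integrable s hs)).1⟩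

theorem zeta_mconv {μ ν : Measure ℝ} (hμ : HasZeta μ) (hν : HasZeta ν) {s : ℂ} (hs : 1 < s.re) :
    zeta (Measure.mconv μ ν) s = zeta μ s * zeta ν s := by
  have := hμ.sfinite
  have := hν.sfinite
  exact (integral_mconv_of_mul (measurable_cpow s)
    (cpow_mul_of_one_le s) hμ.null hν.null (hμ.integrable s hs) (hν.integrable s hs)).2

theorem sfinite_convPow {P : Measure ℝ} [SFinite P] (n : ℕ) : SFinite (convPow P n) := by
  induction n with
  | zero => rw [convPow]; infer_instance
  | succ n ih => rw [convPow]; infer_instance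

theorem convPow_Iio_one {P : Measure ℝ} (hP : HasZeta P) (n : ℕ) :
    convPow P n (Set.Iio 1) = 0 := by
  induction n with
  | zero => exact (hasZeta_dirac le_rfl).null
  | succ n ih =>
    have := hP.sfinite
    have := sfinite_convPow (P := P) n
    exact mconv_Iio_one ih hP.null

theorem integral_convPow_of_mul {𝕜 : Type*} [RCLike 𝕜] {f : ℝ → 𝕜} (hf : Measurable f)
    (hmul : ∀ x y, 1 ≤ x → 1 ≤ y → f (x * y) = f x * f y) (h1 : f 1 = 1) {P : Measure ℝ}
    (hP : HasZeta P) (hi : Integrable f P) (n : ℕ) :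
    Integrable f (convPow P n) ∧ ∫ u, f u ∂(convPow P n) = (∫ u, f u ∂P) ^ n := by
  induction n with
  | zero => exact ⟨integrable_dirac (by simp), by rw [convPow, integral_dirac, h1, pow_zero]⟩
  | succ n ih =>
    have := hP.sfinite
    have := sfinite_convPow (P := P) n
    have h := integral_mconv_of_mul hf hmul (convPow_Iio_one hP n) hP.null ih.1 hi
    exact ⟨h.1, by rw [convPow, h.2, ih.2, pow_succ]⟩

theorem integrable_convPow {P : Measure ℝ} (hP : HasZeta P) (n : ℕ) {s : ℂ} (hs : 1 < s.re) :
    Integrable (fun u : ℝ => (u : ℂ) ^ (-s)) (convPow P n) :=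
  (integral_convPow_of_mul (measurable_cpow s) (cpow_mul_of_one_le s) (by simp) hP
    (hP.integrable s hs) n).1

theorem zeta_convPow {P : Measure ℝ} (hP : HasZeta P) (n : ℕ) {s : ℂ} (hs : 1 < s.re) :
    zeta (convPow P n) s = zeta P s ^ n :=
  (integral_convPow_of_mul (measurable_cpow s) (cpow_mul_of_one_le s) (by simp) hP
    (hP.integrable s hs) n).2

theorem integral_norm_convPow {P : Measure ℝ} (hP : HasZeta P) (n : ℕ) {s : ℂ} (hs : 1 < s.re) :
    ∫ u : ℝ, ‖(u : ℂ) ^ (-s)‖ ∂(convPow P n) = (∫ u : ℝ, ‖(u : ℂ) ^ (-s)‖ ∂P) ^ n :=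
  (integral_convPow_of_mul (f := fun u : ℝ => ‖(u : ℂ) ^ (-s)‖) (measurable_cpow s).norm
    (fun x y hx hy => by rw [cpow_mul_of_one_le s x y hx hy, norm_mul]) (by simp) hP
    (hP.integrable s hs).norm n).2

/-- A sub-series of the exponential of `P`, along an injective sequence `k` of exponents. -/
theorem hasZeta_sum_convPow {P : Measure ℝ} (hP : HasZeta P) {k : ℕ → ℕ}
    (hk : Function.Injective k) :
    HasZeta (Measure.sum fun n => (((k n).factorial : ENNReal)⁻¹) • convPow P (k n)) := by
  have hc : ∀ n : ℕ, ((n.factorial : ENNReal)⁻¹) ≠ ⊤ := fun n => by simp [Nat.factorial_ne_zero]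
  refine ⟨?_, fun s hs => integrable_sum_measure
    (fun n => (integrable_convPow hP _ hs).smul_measure (hc _)) ?_⟩
  · rw [Measure.sum_apply _ measurableSet_Iio]
    simp [convPow_Iio_one hP]
  · have h1 : Summable fun n : ℕ => (∫ u : ℝ, ‖(u : ℂ) ^ (-s)‖ ∂P) ^ n / n.factorial :=
      Real.summable_pow_div_factorial _
    refine (h1.comp_injective hk).congr fun n => ?_
    rw [integral_smul_measure, integral_norm_convPow hP _ hs]
    simp [div_eq_inv_mul]

theorem hasSum_zeta_sum_convPow {P : Measure ℝ} (hP : HasZeta P) {k : ℕ → ℕ}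
    (hk : Function.Injective k) {s : ℂ} (hs : 1 < s.re) :
    HasSum (fun n => zeta P s ^ k n / (k n).factorial)
      (zeta (Measure.sum fun n => (((k n).factorial : ENNReal)⁻¹) • convPow P (k n)) s) := by
  have h := hasSum_integral_measure ((hasZeta_sum_convPow hP hk).integrable s hs)
  refine (h.congr_fun fun n => ?_)
  rw [integral_smul_measure, Complex.real_smul, ← zeta_convPow hP _ hs, zeta]
  simp [div_eq_inv_mul]

theorem injective_two_mul : Function.Injective fun n : ℕ => 2 * n := fun a b h => by
  simpa using h

theorem injective_two_mul_add_one : Function.Injective fun n : ℕ => 2 * n + 1 := fun a b h => by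
  simpa using h

theorem hasZeta_convExp {P : Measure ℝ} (hP : HasZeta P) : HasZeta (convExp P) :=
  hasZeta_sum_convPow hP (k := id) Function.injective_id

theorem hasZeta_convCosh {P : Measure ℝ} (hP : HasZeta P) : HasZeta (convCosh P) :=
  hasZeta_sum_convPow hP injective_two_mul

theorem hasZeta_convSinh {P : Measure ℝ} (hP : HasZeta P) : HasZeta (convSinh P) :=
  hasZeta_sum_convPow hP injective_two_mul_add_one

theorem zeta_convExp {P : Measure ℝ} (hP : HasZeta P) {s : ℂ} (hs : 1 < s.re) :
    zeta (convExp P) s = Complex.exp (zeta P s) := by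
  have h1 := hasSum_zeta_sum_convPow hP (k := id) Function.injective_id hs
  have h2 := NormedSpace.expSeries_div_hasSum_exp (zeta P s)
  rw [← Complex.exp_eq_exp_ℂ] at h2
  exact h1.unique h2

theorem zeta_convCosh {P : Measure ℝ} (hP : HasZeta P) {s : ℂ} (hs : 1 < s.re) :
    zeta (convCosh P) s = Complex.cosh (zeta P s) :=
  (hasSum_zeta_sum_convPow hP injective_two_mul hs).unique (Complex.hasSum_cosh _)

theorem zeta_convSinh {P : Measure ℝ} (hP : HasZeta P) {s : ℂ} (hs : 1 < s.re) :
    zeta (convSinh P) s = Complex.sinh (zeta P s) :=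
  (hasSum_zeta_sum_convPow hP injective_two_mul_add_one hs).unique (Complex.hasSum_sinh _)

/-- The weight `u^{-2}`, which makes the measures with a zeta function finite. -/
noncomputable def invSq (u : ℝ) : ENNReal := ENNReal.ofReal (u ^ 2)⁻¹

theorem measurable_invSq : Measurable invSq := by unfold invSq; fun_prop

theorem map_exp_map_log {ρ : Measure ℝ} (h : ∀ᵐ u ∂ρ, 1 ≤ u) :
    (ρ.map Real.log).map Real.exp = ρ := by
  rw [Measure.map_map Real.measurable_exp Real.measurable_log]
  conv_rhs => rw [← Measure.map_id (μ := ρ)]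
  refine Measure.map_congr ?_
  filter_upwards [h] with u hu
  exact Real.exp_log (by linarith)

theorem HasZeta.withDensity_invSq_cancel {μ : Measure ℝ} (h : HasZeta μ) :
    (μ.withDensity invSq).withDensity invSq⁻¹ = μ := by
  refine withDensity_inv_same measurable_invSq ?_ ?_
  · filter_upwards [ae_one_le h.null] with u hu
    have : 0 < (u ^ 2)⁻¹ := by positivity
    simpa [invSq] using by positivity
  · exact Eventually.of_forall fun u => ENNReal.ofReal_ne_top

theorem HasZeta.isFiniteMeasure_withDensity {μ : Measure ℝ} (h : HasZeta μ) :
    IsFiniteMeasure (μ.withDensity invSq) := by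
  have hi := (h.integrable 2 (by norm_num)).norm
  refine isFiniteMeasure_withDensity_ofReal (f := fun u : ℝ => (u ^ 2)⁻¹) ?_
  refine (hi.congr ?_).2
  filter_upwards [ae_one_le h.null] with u hu
  rw [norm_cpow hu]
  simp [Real.rpow_neg (zero_le_one.trans hu)]

theorem charFun_map_log {μ : Measure ℝ} (h : HasZeta μ) (ξ : ℝ) :
    charFun ((μ.withDensity invSq).map Real.log) ξ = zeta μ (2 - ξ * Complex.I) := by
  rw [charFun_apply_real, integral_map Real.measurable_log.aemeasurable (by fun_prop),
    integral_withDensity_eq_integral_toReal_smul measurable_invSq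
      (Eventually.of_forall fun u => ENNReal.ofReal_lt_top), zeta]
  refine integral_congr_ae ?_
  filter_upwards [ae_one_le h.null] with u hu
  have hu0 : (u : ℂ) ≠ 0 := by exact_mod_cast (zero_lt_one.trans_le hu).ne'
  rw [invSq, ENNReal.toReal_ofReal (by positivity), Complex.real_smul, neg_sub, sub_eq_add_neg,
    Complex.cpow_add _ _ hu0, Complex.cpow_def_of_ne_zero hu0 (ξ * Complex.I),
    ← Complex.ofReal_log (by linarith), Complex.cpow_neg, mul_comm]
  congr 1
  · congr 1; ring
  · push_cast; congr 1; exact_mod_cast (Complex.cpow_natCast (u : ℂ) 2).symm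

/-- A measure on `[1, ∞)` is determined by its zeta function: on the line `Re s = 2` this is the
characteristic function of the finite measure `u^{-2} dμ` in the variable `log u`. -/
theorem HasZeta.ext {μ ν : Measure ℝ} (hμ : HasZeta μ) (hν : HasZeta ν)
    (h : ∀ s : ℂ, 1 < s.re → zeta μ s = zeta ν s) : μ = ν := by
  have := hμ.isFiniteMeasure_withDensity
  have := hν.isFiniteMeasure_withDensity
  have h1 : (μ.withDensity invSq).map Real.log = (ν.withDensity invSq).map Real.log := by
    refine Measure.ext_of_charFun (funext fun ξ => ?_)
    rw [charFun_map_log hμ, charFun_map_log hν, h _ (by simp)]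
  have hae : ∀ {ρ : Measure ℝ}, HasZeta ρ → ∀ᵐ u ∂(ρ.withDensity invSq), 1 ≤ u := fun hρ =>
    (withDensity_absolutelyContinuous _ _).ae_le (ae_one_le hρ.null)
  rw [← hμ.withDensity_invSq_cancel, ← hν.withDensity_invSq_cancel, ← map_exp_map_log (hae hμ),
    ← map_exp_map_log (hae hν), h1]

/-! ### Measures with a density in the logarithm, and Laplace transforms -/

/-- The Laplace transform of a function on the half-line. -/
noncomputable def lap (g : ℝ → ℝ) (w : ℂ) : ℂ :=
  ∫ t in Set.Ioi (0 : ℝ), (g t : ℂ) * Complex.exp (-w * t)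

theorem norm_exp_neg_mul (w : ℂ) (t : ℝ) : ‖Complex.exp (-w * t)‖ = Real.exp (-w.re * t) := by
  rw [Complex.norm_exp]; simp

theorem one_add_mul_exp_le {b : ℝ} (hb : 0 < b) {t : ℝ} (ht : 0 ≤ t) :
    (1 + t) * Real.exp (-b * t) ≤ (1 + 2 / b) * Real.exp (-(b / 2) * t) := by
  have h1 : t ≤ 2 / b * Real.exp (b / 2 * t) := by
    have h2 := Real.add_one_le_exp (b / 2 * t)
    calc t = 2 / b * (b / 2 * t) := by field_simp
      _ ≤ _ := by gcongr; linarith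
  have h3 : 1 ≤ Real.exp (b / 2 * t) := Real.one_le_exp (by positivity)
  calc (1 + t) * Real.exp (-b * t) ≤ ((1 + 2 / b) * Real.exp (b / 2 * t)) * Real.exp (-b * t) := by
        gcongr; linarith
    _ = _ := by rw [mul_assoc, ← Real.exp_add]; congr 2; ring

theorem integrableOn_one_add_mul_exp {b : ℝ} (hb : 0 < b) :
    IntegrableOn (fun t : ℝ => (1 + t) * Real.exp (-b * t)) (Set.Ioi 0) := by
  refine Integrable.mono' ((exp_neg_integrableOn_Ioi 0 (half_pos hb)).const_mul (1 + 2 / b))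
    (by fun_prop) ((ae_restrict_iff' measurableSet_Ioi).2 (Eventually.of_forall fun t ht => ?_))
  have ht : 0 < t := ht
  rw [Real.norm_of_nonneg (by positivity)]
  exact one_add_mul_exp_le hb ht.le

theorem integrableOn_lap {g : ℝ → ℝ} (hg : Continuous g) (hb : ∀ t, 0 ≤ t → |g t| ≤ 1 + t) {w : ℂ}
    (hw : 0 < w.re) :
    IntegrableOn (fun t : ℝ => (g t : ℂ) * Complex.exp (-w * t)) (Set.Ioi 0) := by
  refine Integrable.mono' (integrableOn_one_add_mul_exp hw)
    (Continuous.aestronglyMeasurable (by fun_prop))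
    ((ae_restrict_iff' measurableSet_Ioi).2 (Eventually.of_forall fun t ht => ?_))
  have ht : 0 < t := ht
  rw [norm_mul, norm_exp_neg_mul, Complex.norm_real]
  exact mul_le_mul_of_nonneg_right (hb t ht.le) (Real.exp_pos _).le

theorem hasDerivAt_lap {g : ℝ → ℝ} (hg : Continuous g) (hb : ∀ t, 0 ≤ t → |g t| ≤ 1) {w : ℂ}
    (hw : 0 < w.re) : HasDerivAt (lap g) (-lap (fun t => t * g t) w) w := by
  have hδ : 0 < w.re / 2 := by positivity
  have hre : ∀ z ∈ Metric.ball w (w.re / 2), w.re / 2 < z.re := fun z hz => by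
    have h1 := (Complex.abs_re_le_norm (z - w)).trans_lt (mem_ball_iff_norm.1 hz)
    rw [Complex.sub_re] at h1
    linarith [(abs_lt.1 h1).1]
  have h := (hasDerivAt_integral_of_dominated_loc_of_deriv_le (𝕜 := ℂ)
    (μ := volume.restrict (Set.Ioi (0 : ℝ)))
    (F := fun z t => (g t : ℂ) * Complex.exp (-z * t))
    (F' := fun z t => (g t : ℂ) * (Complex.exp (-z * t) * (-(t : ℂ))))
    (bound := fun t => (1 + t) * Real.exp (-(w.re / 2) * t))
    (Metric.ball_mem_nhds w hδ)
    (Eventually.of_forall fun z => Continuous.aestronglyMeasurable (by fun_prop))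
    (integrableOn_lap hg (fun t ht => (hb t ht).trans (by linarith)) hw)
    (Continuous.aestronglyMeasurable (by fun_prop))
    ((ae_restrict_iff' measurableSet_Ioi).2 (Eventually.of_forall fun t ht z hz => ?_))
    (integrableOn_one_add_mul_exp hδ)
    (Eventually.of_forall fun t z _ => ?_)).2
  · refine h.congr_deriv ?_
    rw [lap, ← integral_neg]
    refine integral_congr_ae (Eventually.of_forall fun t => ?_)
    simp only; push_cast; ring
  · have ht : 0 < t := ht
    rw [norm_mul, norm_mul, norm_exp_neg_mul, Complex.norm_real, norm_neg, Complex.norm_real,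
      Real.norm_of_nonneg ht.le, Real.norm_eq_abs]
    have h1 : Real.exp (-z.re * t) ≤ Real.exp (-(w.re / 2) * t) := by
      gcongr; exact (hre z hz).le
    calc |g t| * (Real.exp (-z.re * t) * t) ≤ 1 * (Real.exp (-(w.re / 2) * t) * (1 + t)) := by
          gcongr
          · exact hb t ht.le
          · linarith
      _ = _ := by ring
  · have h1 : HasDerivAt (fun z : ℂ => -z * t) (-(t : ℂ)) z := by
      simpa using (hasDerivAt_id z).neg.mul_const (t : ℂ)
    exact h1.cexp.const_mul _

theorem lap_one {w : ℂ} (hw : 0 < w.re) : lap (fun _ => 1) w = 1 / w := by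
  have h := integral_exp_mul_complex_Ioi (a := -w) (by simpa using hw) 0
  simp only [lap, Complex.ofReal_one, one_mul, h]
  simp [neg_div_neg_eq]

theorem lap_id {w : ℂ} (hw : 0 < w.re) : lap (fun t => t) w = 1 / w ^ 2 := by
  have h0 : w ≠ 0 := fun h => by simp [h] at hw
  have h1 := hasDerivAt_lap (g := fun _ => 1) continuous_const (fun _ _ => by simp) hw
  have h2 : HasDerivAt (lap fun _ => 1) (-(w ^ 2)⁻¹) w := by
    refine (hasDerivAt_inv h0).congr_of_eventuallyEq ?_
    filter_upwards [(isOpen_lt continuous_const Complex.continuous_re).mem_nhds hw] with z hz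
    rw [lap_one hz, one_div]
  have h3 := h1.unique h2
  simp only [mul_one] at h3
  rw [neg_injective h3, one_div]

theorem sq_add_one_ne_zero {w : ℂ} (hw : 0 < w.re) : w ^ 2 + 1 ≠ 0 := fun h => by
  have h1 : (w + Complex.I) * (w - Complex.I) = 0 := by
    linear_combination h - Complex.I_sq
  rcases mul_eq_zero.1 h1 with h2 | h2
  · have := congrArg Complex.re h2
    simp at this; linarith
  · have := congrArg Complex.re h2
    simp at this; linarith

theorem lap_qd {w : ℂ} (hw : 0 < w.re) : lap qd w = 1 / w - w / (w ^ 2 + 1) := by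
  have h0 : w ≠ 0 := fun h => by simp [h] at hw
  have hp : w + Complex.I ≠ 0 := fun h => by
    have := congrArg Complex.re h
    simp at this; linarith
  have hm : w - Complex.I ≠ 0 := fun h => by
    have := congrArg Complex.re h
    simp at this; linarith
  have h1 := integrableOn_exp_mul_complex_Ioi (a := -w) (by simpa using hw) 0
  have h2 := integrableOn_exp_mul_complex_Ioi (a := -(w + Complex.I)) (by simpa using hw) 0
  have h3 := integrableOn_exp_mul_complex_Ioi (a := -(w - Complex.I)) (by simpa using hw) 0
  have e : ∀ t : ℝ, (qd t : ℂ) * Complex.exp (-w * t) = Complex.exp (-w * t) -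
      (1 / 2 : ℂ) * (Complex.exp (-(w + Complex.I) * t) + Complex.exp (-(w - Complex.I) * t)) :=
    fun t => by
      rw [qd, show -(w + Complex.I) * t = -w * t + -(t : ℂ) * Complex.I by ring,
        show -(w - Complex.I) * t = -w * t + (t : ℂ) * Complex.I by ring, Complex.exp_add,
        Complex.exp_add]
      push_cast
      rw [Complex.cos]
      ring
  have h23 : IntegrableOn (fun t : ℝ => Complex.exp (-(w + Complex.I) * t) +
      Complex.exp (-(w - Complex.I) * t)) (Set.Ioi 0) := h2.add h3
  simp only [lap, e]
  rw [integral_sub h1 (h23.const_mul _), integral_const_mul, integral_add h2 h3,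
    integral_exp_mul_complex_Ioi (by simpa using hw),
    integral_exp_mul_complex_Ioi (by simpa using hw),
    integral_exp_mul_complex_Ioi (by simpa using hw)]
  have h4 : w ^ 2 + 1 = (w + Complex.I) * (w - Complex.I) := by
    linear_combination Complex.I_sq
  rw [h4]
  simp only [Complex.ofReal_zero, mul_zero, Complex.exp_zero]
  field_simp
  ring

theorem norm_lap_rho_le {x : ℝ} (hx : 0 < x) : ‖lap rho x‖ ≤ x⁻¹ := by
  have h : ‖lap rho x‖ ≤ ∫ t in Set.Ioi (0 : ℝ), Real.exp (-x * t) := by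
    refine norm_integral_le_of_norm_le (exp_neg_integrableOn_Ioi 0 hx)
      ((ae_restrict_iff' measurableSet_Ioi).2 (Eventually.of_forall fun t ht => ?_))
    have ht : 0 < t := ht
    rw [norm_mul, norm_exp_neg_mul, Complex.norm_real, Real.norm_of_nonneg (rho_nonneg ht.le),
      Complex.ofReal_re]
    exact mul_le_of_le_one_left (Real.exp_pos _).le (rho_le_one ht.le)
  rw [integral_exp_mul_Ioi (by linarith)] at h
  simpa [neg_div_neg_eq] using h

/-- The Laplace transform of `(1 - cos t) / t` is the logarithm of `(1 + w⁻²) ^ (1 / 2)`: the two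
functions have the same derivative, and both vanish at infinity. -/
theorem exp_two_mul_lap_rho {w : ℂ} (hw : 0 < w.re) :
    Complex.exp (2 * lap rho w) = 1 + 1 / w ^ 2 := by
  set U : Set ℂ := {z | 0 < z.re}
  have hU : IsOpen U := isOpen_lt continuous_const Complex.continuous_re
  have hUc : IsPreconnected U := (convex_halfSpace_re_gt 0).isPreconnected
  set E : ℂ → ℂ := fun z => Complex.exp (2 * lap rho z) * (z ^ 2 / (z ^ 2 + 1)) with hE
  have hder : ∀ z ∈ U, HasDerivAt E 0 z := fun z hz => by
    have hz : 0 < z.re := hz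
    have h0 : z ≠ 0 := fun h => by simp [h] at hz
    have h1 := hasDerivAt_lap continuous_rho (fun t ht => by
      rw [abs_of_nonneg (rho_nonneg ht)]; exact rho_le_one ht) hz
    have h2 : (fun t => t * rho t) = qd := funext mul_rho
    rw [h2, lap_qd hz] at h1
    have h3 := sq_add_one_ne_zero hz
    refine ((h1.const_mul 2).cexp.mul (((hasDerivAt_pow 2 z).div
      ((hasDerivAt_pow 2 z).add_const 1) h3))).congr_deriv ?_
    simp only [Pi.div_apply]
    field_simp
    push_cast
    ring
  have hconst : ∀ x : ℝ, 0 < x → E x = E w := fun x hx =>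
    hU.is_const_of_deriv_eq_zero hUc
      (fun z hz => (hder z hz).differentiableAt.differentiableWithinAt)
      (fun z hz => (hder z hz).deriv) (show 0 < (x : ℂ).re by simpa using hx) hw
  have hlim : Tendsto (fun x : ℝ => E x) atTop (nhds 1) := by
    have h1 : Tendsto (fun x : ℝ => lap rho x) atTop (nhds 0) :=
      squeeze_zero_norm' ((eventually_gt_atTop 0).mono fun x hx => norm_lap_rho_le hx)
        tendsto_inv_atTop_zero
    have h2 : Tendsto (fun x : ℝ => Complex.exp (2 * lap rho x)) atTop (nhds 1) := by
      have := (Complex.continuous_exp.tendsto 0).comp (by simpa using h1.const_mul 2)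
      simpa [Function.comp_def] using this
    have h3 : Tendsto (fun x : ℝ => (1 + (x⁻¹) ^ 2 : ℝ)⁻¹) atTop (nhds 1) := by
      have := ((tendsto_inv_atTop_zero (𝕜 := ℝ)).pow 2).const_add 1
      simpa using this.inv₀ (by simp)
    have h4 := h2.mul ((Complex.continuous_ofReal.tendsto 1).comp h3)
    simp only [Complex.ofReal_one, mul_one] at h4
    refine h4.congr' ((eventually_gt_atTop 0).mono fun x hx => ?_)
    have hx0 : (x : ℂ) ≠ 0 := by exact_mod_cast hx.ne'
    have h5 : (x : ℂ) ^ 2 + 1 ≠ 0 := sq_add_one_ne_zero (by simpa using hx)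
    have h6 : 1 + ((x : ℂ)⁻¹) ^ 2 = (x ^ 2 + 1) / x ^ 2 := by field_simp
    simp only [hE, Function.comp, Complex.ofReal_inv, Complex.ofReal_add, Complex.ofReal_pow,
      Complex.ofReal_one, h6, inv_div]
  have hEw : E w = 1 := tendsto_nhds_unique (tendsto_const_nhds.congr'
    ((eventually_gt_atTop 0).mono fun x hx => (hconst x hx).symm)) hlim
  have h0 : w ≠ 0 := fun h => by simp [h] at hw
  have h3 := sq_add_one_ne_zero hw
  simp only [hE] at hEw
  field_simp at hEw
  field_simp
  linear_combination hEw

/-- The measure on `(1, ∞)` with density `g (log u)`. -/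
noncomputable def logMeasure (g : ℝ → ℝ) : Measure ℝ :=
  (volume.restrict (Set.Ioi 1)).withDensity fun u => ENNReal.ofReal (g (Real.log u))

theorem measurable_ofReal_comp_log {g : ℝ → ℝ} (hg : Continuous g) :
    Measurable fun u : ℝ => ENNReal.ofReal (g (Real.log u)) :=
  ENNReal.measurable_ofReal.comp (hg.measurable.comp Real.measurable_log)

theorem logMeasure_Iio_one (g : ℝ → ℝ) : logMeasure g (Set.Iio 1) = 0 := by
  refine withDensity_absolutelyContinuous _ _ ?_
  rw [Measure.restrict_apply measurableSet_Iio]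
  convert measure_empty (μ := (volume : Measure ℝ))
  ext x; simp only [Set.mem_inter_iff, Set.mem_Iio, Set.mem_Ioi, Set.mem_empty_iff_false, iff_false]
  intro h; linarith [h.1, h.2]

theorem image_exp_Ioi : Real.exp '' Set.Ioi 0 = Set.Ioi 1 := by
  ext u
  simp only [Set.mem_image, Set.mem_Ioi]
  constructor
  · rintro ⟨t, ht, rfl⟩; exact Real.one_lt_exp_iff.2 ht
  · intro hu; exact ⟨Real.log u, Real.log_pos hu, Real.exp_log (by linarith)⟩

theorem exp_smul_cpow_exp {g : ℝ → ℝ} (hg0 : ∀ t, 0 ≤ t → 0 ≤ g t) (s : ℂ) {t : ℝ} (ht : 0 ≤ t) :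
    |Real.exp t| • ((ENNReal.ofReal (g (Real.log (Real.exp t)))).toReal •
      ((Real.exp t : ℝ) : ℂ) ^ (-s)) = (g t : ℂ) * Complex.exp (-(s - 1) * t) := by
  rw [Real.log_exp, ENNReal.toReal_ofReal (hg0 t ht), abs_of_pos (Real.exp_pos t),
    Complex.real_smul, Complex.real_smul,
    Complex.cpow_def_of_ne_zero (by exact_mod_cast (Real.exp_pos t).ne'), ← Complex.ofReal_log
    (Real.exp_pos t).le, Real.log_exp, Complex.ofReal_exp,
    show -(s - 1) * (t : ℂ) = t + t * -s by ring, Complex.exp_add]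
  ring

theorem hasZeta_logMeasure {g : ℝ → ℝ} (hg : Continuous g) (hg0 : ∀ t, 0 ≤ t → 0 ≤ g t)
    (hb : ∀ t, 0 ≤ t → g t ≤ 1 + t) : HasZeta (logMeasure g) := by
  refine ⟨logMeasure_Iio_one g, fun s hs => ?_⟩
  rw [logMeasure, integrable_withDensity_iff_integrable_smul' (measurable_ofReal_comp_log hg)
    (Eventually.of_forall fun _ => ENNReal.ofReal_lt_top), ← IntegrableOn, ← image_exp_Ioi,
    integrableOn_image_iff_integrableOn_abs_deriv_smul measurableSet_Ioi
      (fun x _ => (Real.hasDerivAt_exp x).hasDerivWithinAt) Real.exp_injective.injOn]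
  refine (integrableOn_lap (w := s - 1) hg (fun t ht => ?_) (by simpa using hs)).congr_fun
    (fun t ht => (exp_smul_cpow_exp hg0 s (le_of_lt ht)).symm) measurableSet_Ioi
  rw [abs_of_nonneg (hg0 t ht)]; exact hb t ht

theorem zeta_logMeasure {g : ℝ → ℝ} (hg : Continuous g) (hg0 : ∀ t, 0 ≤ t → 0 ≤ g t) (s : ℂ) :
    zeta (logMeasure g) s = lap g (s - 1) := by
  rw [zeta, logMeasure, integral_withDensity_eq_integral_toReal_smul (measurable_ofReal_comp_log hg)
    (Eventually.of_forall fun _ => ENNReal.ofReal_lt_top), ← image_exp_Ioi,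
    integral_image_eq_integral_abs_deriv_smul measurableSet_Ioi
      (fun x _ => (Real.hasDerivAt_exp x).hasDerivWithinAt) Real.exp_injective.injOn]
  exact setIntegral_congr_fun measurableSet_Ioi fun t ht => exp_smul_cpow_exp hg0 s (le_of_lt ht)

theorem setIntegral_logMeasure {g : ℝ → ℝ} (hg : Continuous g) (hg0 : ∀ t, 0 ≤ t → 0 ≤ g t)
    (f : ℝ → ℝ) {x : ℝ} (hx : 1 ≤ x) :
    ∫ u in Set.Iic x, f u ∂(logMeasure g) = ∫ u in (1 : ℝ)..x, g (Real.log u) * f u := by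
  rw [logMeasure, setIntegral_withDensity_eq_setIntegral_toReal_smul (measurable_ofReal_comp_log hg)
    (Eventually.of_forall fun _ => ENNReal.ofReal_lt_top) _ measurableSet_Iic,
    Measure.restrict_restrict measurableSet_Iic, Set.Iic_inter_Ioi,
    intervalIntegral.integral_of_le hx]
  refine setIntegral_congr_fun measurableSet_Ioc fun u hu => ?_
  simp only [smul_eq_mul, ENNReal.toReal_ofReal (hg0 _ (Real.log_nonneg hu.1.le))]

theorem distFun_logMeasure {g : ℝ → ℝ} (hg : Continuous g) (hg0 : ∀ t, 0 ≤ t → 0 ≤ g t)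
    {x : ℝ} (hx : 1 ≤ x) :
    distFun (logMeasure g) x = ∫ u in (1 : ℝ)..x, g (Real.log u) := by
  have h := setIntegral_logMeasure hg hg0 (fun _ => 1) hx
  rw [setIntegral_const, smul_eq_mul, mul_one] at h
  simpa [distFun] using h

/-! ### The continuous system -/

theorem dPiB_eq : dPiB = logMeasure rho := rfl

theorem hasZeta_dPiB : HasZeta dPiB := by
  rw [dPiB_eq]
  exact hasZeta_logMeasure continuous_rho (fun _ ht => rho_nonneg ht)
    fun t ht => (rho_le_one ht).trans (by linarith)

theorem hasZeta_dPiC : HasZeta dPiC := hasZeta_dPiB.smul (by simp)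

theorem zeta_dPiB (s : ℂ) : zeta dPiB s = lap rho (s - 1) := by
  rw [dPiB_eq, zeta_logMeasure continuous_rho (fun _ ht => rho_nonneg ht) s]

/-- The zeta function of the continuous system. It has zeros at `1 ± i`, on the boundary of its
half-plane, and a double pole at `1`. -/
theorem exp_zeta_dPiC {s : ℂ} (hs : 1 < s.re) :
    Complex.exp (zeta dPiC s) = 1 + 1 / (s - 1) ^ 2 := by
  rw [dPiC, zeta_smul, zeta_dPiB]
  exact exp_two_mul_lap_rho (by simpa using hs)

theorem distFun_dPiC {x : ℝ} (hx : 1 ≤ x) : distFun dPiC x = PiC x := by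
  have h := distFun_logMeasure continuous_rho (fun _ ht => rho_nonneg ht) hx
  rw [distFun, dPiC, dPiB_eq, measureReal_ennreal_smul_apply, ← distFun, h]
  rfl

theorem hasZeta_dNC : HasZeta dNC := hasZeta_convExp hasZeta_dPiC

theorem zeta_dNC {s : ℂ} (hs : 1 < s.re) : zeta dNC s = 1 + 1 / (s - 1) ^ 2 := by
  rw [dNC, zeta_convExp hasZeta_dPiC hs, exp_zeta_dPiC hs]

theorem hasZeta_logMeasure_id : HasZeta (logMeasure fun t => t) :=
  hasZeta_logMeasure continuous_id (fun _ ht => ht) fun t _ => by linarith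

/-- The integers of the continuous system are explicit: `dN = δ_1 + log u du`. -/
theorem dNC_eq : dNC = Measure.dirac 1 + logMeasure fun t => t := by
  refine hasZeta_dNC.ext ((hasZeta_dirac le_rfl).add hasZeta_logMeasure_id) fun s hs => ?_
  rw [zeta_dNC hs, zeta_add (hasZeta_dirac le_rfl) hasZeta_logMeasure_id hs, zeta_dirac,
    zeta_logMeasure (g := fun t => t) continuous_id (fun _ ht => ht), lap_id (by simpa using hs)]
  simp

theorem distFun_dNC {x : ℝ} (hx : 1 ≤ x) : distFun dNC x = x * Real.log x - x + 2 := by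
  have h := distFun_logMeasure (g := fun t => t) continuous_id (fun _ ht => ht) hx
  rw [distFun, integral_log, Real.log_one] at h
  have h2 : (Measure.dirac (1 : ℝ)).real (Set.Iic x) = 1 := by
    simp [Measure.real, Measure.dirac_apply' _ measurableSet_Iic, hx]
  rw [distFun, dNC_eq,
    measureReal_add_apply (h₂ := (hasZeta_logMeasure_id.measure_Iic_lt_top x).ne), h2, h]
  ring

theorem isConvInverse_dNC : IsConvInverse dNC (measureMoebiusSum dPiC) := by
  have hA := hasZeta_convCosh hasZeta_dPiC
  have hB := hasZeta_convSinh hasZeta_dPiC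
  refine ⟨convCosh dPiC, convSinh dPiC, hA.null, hB.null,
    fun x => ⟨hA.measure_Iic_lt_top x, hB.measure_Iic_lt_top x⟩, fun _ => rfl, ?_⟩
  have hBN := hB.mconv hasZeta_dNC
  refine (hA.mconv hasZeta_dNC).ext (hBN.add (hasZeta_dirac le_rfl)) fun s hs => ?_
  rw [zeta_add hBN (hasZeta_dirac le_rfl) hs, zeta_mconv hA hasZeta_dNC hs,
    zeta_mconv hB hasZeta_dNC hs, zeta_dirac, zeta_convCosh hasZeta_dPiC hs,
    zeta_convSinh hasZeta_dPiC hs, dNC, zeta_convExp hasZeta_dPiC hs, Complex.ofReal_one,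
    Complex.one_cpow]
  have h1 := Complex.cosh_sub_sinh (zeta dPiC s)
  have h2 : Complex.exp (-zeta dPiC s) * Complex.exp (zeta dPiC s) = 1 := by
    rw [← Complex.exp_add]; simp
  linear_combination Complex.exp (zeta dPiC s) * h1 + h2

theorem not_distFun_dNC_isBigO : ¬ (distFun dNC =O[atTop] fun x : ℝ => x) := fun h => by
  obtain ⟨C, hC⟩ := h.bound
  obtain ⟨x, ⟨h1, h2⟩, h3⟩ := ((hC.and (eventually_ge_atTop 1)).and
    (Real.tendsto_log_atTop.eventually_gt_atTop (C + 1))).exists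
  rw [distFun_dNC h2, Real.norm_of_nonneg (by linarith : (0:ℝ) ≤ x)] at h1
  have h4 := (le_abs_self _).trans h1
  nlinarith

/-! ### The Chebyshev functions of both systems -/

theorem integral_qd_mul_exp (t : ℝ) : ∫ v in (0 : ℝ)..t, qd v * Real.exp v =
    Real.exp t * (1 - (Real.cos t + Real.sin t) / 2) - 1 / 2 := by
  have hd : ∀ v, HasDerivAt (fun v => Real.exp v * (1 - (Real.cos v + Real.sin v) / 2))
      (qd v * Real.exp v) v := fun v => by
    refine ((Real.hasDerivAt_exp v).mul (((Real.hasDerivAt_cos v).add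
      (Real.hasDerivAt_sin v)).div_const 2 |>.const_sub 1)).congr_deriv ?_
    simp only [qd, Pi.add_apply]; ring
  rw [intervalIntegral.integral_eq_sub_of_hasDerivAt (fun v _ => hd v)
    ((continuous_qd.mul Real.continuous_exp).intervalIntegrable _ _)]
  simp; ring

theorem measurePsi_dPiC {x : ℝ} (hx : 1 ≤ x) : measurePsi dPiC x =
    x * (2 - (Real.cos (Real.log x) + Real.sin (Real.log x))) - 1 := by
  have h := setIntegral_logMeasure continuous_rho (fun _ ht => rho_nonneg ht) Real.log hx
  have h1 := integral_qd_log (Real.log_nonneg hx)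
  rw [Real.exp_log (by linarith), integral_qd_mul_exp, Real.exp_log (by linarith)] at h1
  have h2 : ∫ u in Set.Iic x, Real.log u ∂dPiB = ∫ u in (1 : ℝ)..x, qd (Real.log u) := by
    rw [dPiB_eq, h]
    exact intervalIntegral.integral_congr fun u _ => log_mul_densityB u
  rw [measurePsi, dPiC, Measure.restrict_smul, integral_smul_measure, h2, h1]
  simp; ring

/-- A function asymptotic to `x (2 - cos - sin)` at `log x` has order of magnitude `x`, because
`|cos + sin| ≤ √2 < 2`. -/
theorem isTheta_id_of_asymptotic {F : ℝ → ℝ}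
    (h : (fun x => F x - x * (2 - (Real.cos (Real.log x) + Real.sin (Real.log x))))
      =o[atTop] fun x : ℝ => x) : F =Θ[atTop] fun x : ℝ => x := by
  have hcs : ∀ t : ℝ, |Real.cos t + Real.sin t| ≤ 3 / 2 := fun t => by
    rw [abs_le]
    constructor <;> nlinarith [Real.sin_sq_add_cos_sq t, sq_nonneg (Real.cos t - Real.sin t),
      sq_nonneg (Real.cos t + Real.sin t)]
  have h1 := h.bound (show (0 : ℝ) < 1 / 4 by norm_num)
  constructor
  · refine IsBigO.of_bound 4 ?_
    filter_upwards [h1, eventually_ge_atTop 0] with x hx hx0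
    have := abs_le.1 (hcs (Real.log x))
    rw [Real.norm_of_nonneg hx0, Real.norm_eq_abs] at *
    rw [abs_le] at hx ⊢
    constructor <;> nlinarith [hx.1, hx.2, this.1, this.2]
  · refine IsBigO.of_bound 4 ?_
    filter_upwards [h1, eventually_ge_atTop 0] with x hx hx0
    have := abs_le.1 (hcs (Real.log x))
    rw [Real.norm_of_nonneg hx0, Real.norm_eq_abs] at *
    have h3 := (abs_le.1 hx).1
    nlinarith [le_abs_self (F x), this.1, this.2]

theorem measurePsi_dPiC_isTheta : measurePsi dPiC =Θ[atTop] fun x : ℝ => x := by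
  refine isTheta_id_of_asymptotic ?_
  have h : (fun _ : ℝ => (-1 : ℝ)) =o[atTop] fun x : ℝ => x :=
    isLittleO_const_id_atTop (-1 : ℝ)
  refine h.congr' ((eventually_ge_atTop 1).mono fun x hx => ?_) EventuallyEq.rfl
  simp only [measurePsi_dPiC hx]; ring

theorem psi_eq_chebyshev {p : ℕ → ℝ} (hp : IsGPrimeSystem p) {x : ℝ} (hx : 0 < x) :
    psi p x = chebyshev p (Real.log x) := by
  have h : {j : ℕ × ℕ | 1 ≤ j.2 ∧ p j.1 ^ j.2 ≤ x} = ↑(powersBelow p (Real.log x)) := by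
    ext j
    simp only [Finset.mem_coe, mem_powersBelow hp, Set.mem_ofPred_eq]
    refine and_congr_right fun _ => ?_
    rw [← Real.log_pow, Real.log_le_log_iff (pow_pos (zero_lt_one.trans (hp.one_lt _)) _) hx]
  rw [psi, chebyshev, h, finsum_mem_coe_finset]

/-- Each g-prime of `sysD` appears twice in `sysP`. -/
theorem chebyshev_sysP (t : ℝ) : chebyshev sysP t = 2 * chebyshev sysD t := by
  have h : ∀ r : ℕ, r < 2 → ∑ j ∈ (powersBelow sysP t).filter (fun j => j.1 % 2 = r),
      Real.log (sysP j.1) = chebyshev sysD t := fun r hr => by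
    refine Finset.sum_nbij' (fun j => (j.1 / 2, j.2)) (fun j => (2 * j.1 + r, j.2)) ?_ ?_ ?_ ?_ ?_
    · intro j hj
      rw [Finset.mem_filter, mem_powersBelow isGPrimeSystem_sysP] at hj
      rw [mem_powersBelow isGPrimeSystem_sysD]
      exact hj.1
    · intro j hj
      rw [mem_powersBelow isGPrimeSystem_sysD] at hj
      rw [Finset.mem_filter, mem_powersBelow isGPrimeSystem_sysP]
      simp only [sysP_eq, show (2 * j.1 + r) / 2 = j.1 by omega]
      exact ⟨hj, by omega⟩
    · intro j hj
      have := (Finset.mem_filter.1 hj).2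
      ext
      · simp only; omega
      · rfl
    · intro j hj
      ext
      · simp only; omega
      · rfl
    · intro j hj; rfl
  have h0 := h 0 (by norm_num)
  have h1 := h 1 (by norm_num)
  rw [chebyshev, ← Finset.sum_filter_add_sum_filter_not _ (fun j : ℕ × ℕ => j.1 % 2 = 0), h0]
  have : ∀ j : ℕ × ℕ, ¬ j.1 % 2 = 0 ↔ j.1 % 2 = 1 := fun j => by omega
  simp only [this, h1]
  ring

theorem psi_sysP_isTheta : psi sysP =Θ[atTop] fun x : ℝ => x := by
  refine isTheta_id_of_asymptotic ?_
  have hbound : (fun x => psi sysP x - x * (2 - (Real.cos (Real.log x) + Real.sin (Real.log x))))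
      =O[atTop] fun x : ℝ => (1 + Real.log x) * x ^ (1 / 2 : ℝ) := by
    refine IsBigO.of_bound 7 ?_
    filter_upwards [eventually_ge_atTop 1] with x hx
    have hx0 : 0 < x := by linarith
    have hl := Real.log_nonneg hx
    have h1 := abs_chebyshev_sub_le hl
    have h2 : Real.exp (Real.log x / 2) = x ^ (1 / 2 : ℝ) := by
      rw [Real.rpow_def_of_pos hx0]; congr 1; ring
    rw [integral_qd_mul_exp, Real.exp_log hx0, h2] at h1
    have h3 : 1 ≤ (1 + Real.log x) * x ^ (1 / 2 : ℝ) :=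
      one_le_mul_of_one_le_of_one_le (by linarith) (Real.one_le_rpow hx (by norm_num))
    rw [psi_eq_chebyshev isGPrimeSystem_sysP hx0, chebyshev_sysP, Real.norm_eq_abs,
      Real.norm_of_nonneg (by linarith)]
    rw [abs_le] at h1 ⊢
    constructor <;> nlinarith [h1.1, h1.2]
  refine hbound.trans_isLittleO ?_
  have h1 : (fun x : ℝ => 1 + Real.log x) =o[atTop] fun x : ℝ => x ^ (1 / 2 : ℝ) := by
    refine IsLittleO.add ?_ (isLittleO_log_rpow_atTop (by norm_num))
    exact (isLittleO_const_left.2 (Or.inr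
      (tendsto_norm_atTop_atTop.comp (tendsto_rpow_atTop (by norm_num)))))
  refine (h1.mul_isBigO (isBigO_refl (fun x : ℝ => x ^ (1 / 2 : ℝ)) atTop)).congr'
    EventuallyEq.rfl ((eventually_gt_atTop 0).mono fun x hx => ?_)
  simp only [← Real.rpow_add hx]
  norm_num

/-! ### Oscillation from the behaviour on the line `Im s = 1` -/

theorem setIntegral_indicator_Ici {E : Type*} [NormedAddCommGroup E] [NormedSpace ℝ E] (g : ℝ → E)
    {u : ℝ} (hu : 1 ≤ u) :
    ∫ x in Set.Ioi 1, (Set.Ici u).indicator g x = ∫ x in Set.Ioi u, g x := by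
  have h : ∫ x in Set.Ioi 1, (Set.Ici u).indicator g x =
      ∫ x in Set.Ioi 1, (Set.Ioi u).indicator g x :=
    integral_congr_ae (ae_restrict_of_ae (indicator_ae_eq_of_ae_eq_set Ioi_ae_eq_Ici.symm))
  rw [h, setIntegral_indicator measurableSet_Ioi, Set.Ioi_inter_Ioi, max_eq_right hu]

/-- The zeta function is a Mellin transform of the distribution function. -/
theorem HasZeta.zeta_eq_integral {μ : Measure ℝ} (h : HasZeta μ) {s : ℂ} (hs : 1 < s.re) :
    IntegrableOn (fun x : ℝ => (distFun μ x : ℂ) * (x : ℂ) ^ (-s - 1)) (Set.Ioi 1) ∧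
      zeta μ s = s * ∫ x in Set.Ioi (1 : ℝ), (distFun μ x : ℂ) * (x : ℂ) ^ (-s - 1) := by
  have := h.sfinite
  have hs0 : s ≠ 0 := fun h => by simp [h] at hs; linarith
  have hre : (-s - 1).re < -1 := by simp; linarith
  set g : ℝ → ℂ := fun x => (x : ℂ) ^ (-s - 1) with hg
  have hgm : Measurable g := Complex.measurable_ofReal.pow_const _
  set f : ℝ → ℝ → ℂ := fun u x => (Set.Ici u).indicator g x with hf
  have hmeas : Measurable (Function.uncurry f) := by
    have : Function.uncurry f = fun z : ℝ × ℝ => if z.1 ≤ z.2 then g z.2 else 0 := by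
      funext z; simp [hf, Function.uncurry, Set.indicator_apply]
    rw [this]
    exact Measurable.ite (measurableSet_le measurable_fst measurable_snd)
      (hgm.comp measurable_snd) measurable_const
  have hint : ∀ u, Integrable (f u) (volume.restrict (Set.Ioi 1)) := fun u =>
    (integrableOn_Ioi_cpow_of_lt hre one_pos).indicator measurableSet_Ici
  have hnorm : ∀ u : ℝ, 1 ≤ u → ∫ x in Set.Ioi 1, ‖f u x‖ = ‖(u : ℂ) ^ (-s)‖ * (1 / s.re) :=
    fun u hu => by
      have e : ∀ x, ‖f u x‖ = (Set.Ici u).indicator (fun x => ‖g x‖) x := fun x =>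
        norm_indicator_eq_indicator_norm _ _
      simp only [e]
      rw [setIntegral_indicator_Ici _ hu, norm_cpow hu]
      have e2 : ∀ x ∈ Set.Ioi u, ‖g x‖ = x ^ (-s.re - 1) := fun x hx => by
        have hx : u < x := hx
        rw [hg]
        simp only
        rw [Complex.norm_cpow_eq_rpow_re_of_pos (by linarith)]
        simp
      rw [setIntegral_congr_fun measurableSet_Ioi e2,
        integral_Ioi_rpow_of_lt (by linarith) (by linarith)]
      have : s.re ≠ 0 := by linarith
      rw [show -s.re - 1 + 1 = -s.re by ring]
      field_simp
  have hprod : Integrable (Function.uncurry f) (μ.prod (volume.restrict (Set.Ioi 1))) := by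
    refine (integrable_prod_iff hmeas.aestronglyMeasurable).2 ⟨Eventually.of_forall hint, ?_⟩
    refine ((h.integrable s hs).norm.mul_const (1 / s.re)).congr ?_
    filter_upwards [ae_one_le h.null] with u hu
    exact (hnorm u hu).symm
  have hinner : ∀ x, ∫ u, f u x ∂μ = (distFun μ x : ℂ) * (x : ℂ) ^ (-s - 1) := fun x => by
    have : ∀ u, f u x = (Set.Iic x).indicator (fun _ => g x) u := fun u => by
      simp [hf, Set.indicator_apply]
    simp only [this]
    rw [integral_indicator_const _ measurableSet_Iic, Complex.real_smul]
    rfl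
  refine ⟨(hprod.integral_prod_right).congr (Eventually.of_forall hinner), ?_⟩
  have hswap := integral_integral_swap hprod
  rw [integral_congr_ae (Eventually.of_forall hinner)] at hswap
  rw [← hswap, ← integral_const_mul, zeta]
  refine integral_congr_ae ?_
  filter_upwards [ae_one_le h.null] with u hu
  rw [setIntegral_indicator_Ici _ hu, integral_Ioi_cpow_of_lt hre (by linarith),
    show -s - 1 + 1 = -s by ring]
  field_simp

theorem norm_zeta_sub_le {A B : Measure ℝ} (hA : HasZeta A) (hB : HasZeta B) {K η : ℝ}
    (hF : ∀ x, 1 ≤ x → |distFun A x - distFun B x| ≤ K + η * x) {s : ℂ} (hs : 1 < s.re) :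
    ‖zeta A s - zeta B s‖ ≤ ‖s‖ * (K / s.re + η / (s.re - 1)) := by
  obtain ⟨hiA, hzA⟩ := hA.zeta_eq_integral hs
  obtain ⟨hiB, hzB⟩ := hB.zeta_eq_integral hs
  rw [hzA, hzB, ← mul_sub, ← integral_sub hiA hiB, norm_mul]
  have h1 := (integrableOn_Ioi_rpow_of_lt (show -s.re - 1 < -1 by linarith) one_pos).const_mul K
  have h2 := (integrableOn_Ioi_rpow_of_lt (show -s.re < -1 by linarith) one_pos).const_mul η
  have hval : ∫ x in Set.Ioi (1 : ℝ), (K * x ^ (-s.re - 1) + η * x ^ (-s.re)) =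
      K / s.re + η / (s.re - 1) := by
    rw [integral_add h1 h2, integral_const_mul, integral_const_mul,
      integral_Ioi_rpow_of_lt (by linarith) one_pos, integral_Ioi_rpow_of_lt (by linarith) one_pos]
    have h3 : s.re ≠ 0 := by linarith
    have h4 : s.re - 1 ≠ 0 := by linarith
    have h5 : -s.re + 1 ≠ 0 := by linarith
    simp only [Real.one_rpow, sub_add_cancel]
    field_simp
    ring
  refine mul_le_mul_of_nonneg_left ?_ (norm_nonneg _)
  rw [← hval]
  refine norm_integral_le_of_norm_le (h1.add h2)
    ((ae_restrict_iff' measurableSet_Ioi).2 (Eventually.of_forall fun x hx => ?_))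
  have hx : 1 < x := hx
  have hx0 : 0 < x := by linarith
  have h3 : x ^ (-s.re) = x * x ^ (-s.re - 1) := by
    rw [Real.rpow_sub_one hx0.ne']; field_simp
  rw [← sub_mul, norm_mul, ← Complex.ofReal_sub, Complex.norm_real,
    Complex.norm_cpow_eq_rpow_re_of_pos hx0, Real.norm_eq_abs, h3]
  simp only [Complex.sub_re, Complex.neg_re, Complex.one_re]
  refine (mul_le_mul_of_nonneg_right (hF x hx.le) (Real.rpow_nonneg hx0.le _)).trans (le_of_eq ?_)
  ring

/-- The point `1 + ε + i`. -/
noncomputable def nearLine (ε : ℝ) : ℂ := 1 + ε + Complex.I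

theorem nearLine_re (ε : ℝ) : (nearLine ε).re = 1 + ε := by simp [nearLine]

theorem norm_nearLine_le {ε : ℝ} (h0 : 0 < ε) (h1 : ε < 1) : ‖nearLine ε‖ ≤ 3 := by
  refine (norm_add_le _ _).trans ?_
  have : ‖(1 : ℂ) + ε‖ ≤ 1 + ε := by
    refine (norm_add_le _ _).trans ?_
    simp [abs_of_pos h0]
  rw [Complex.norm_I]; linarith

/-- A simple pole of the Mellin transform at `1 + i`, in the weak sense of a lower bound, forces
the distribution function to be as large as `x` infinitely often. -/
theorem isOmegaId_of_le_norm_zeta {A B : Measure ℝ} (hA : HasZeta A) (hB : HasZeta B) {F : ℝ → ℝ}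
    (hF : ∀ x, F x = distFun A x - distFun B x) {c : ℝ} (hc : 0 < c)
    (h : ∀ ε : ℝ, 0 < ε → ε < 1 → c / ε ≤ ‖zeta A (nearLine ε) - zeta B (nearLine ε)‖) :
    IsOmegaId F := by
  by_contra hno
  obtain ⟨X, hX⟩ : ∃ X : ℝ, ∀ x, X ≤ x → |F x| < c / 6 * x := by
    have h1 : ¬ ∃ᶠ x in atTop, c / 6 * x ≤ |F x| := fun h2 => hno ⟨c / 6, by positivity, h2⟩
    rw [not_frequently] at h1
    exact eventually_atTop.1 (h1.mono fun x hx => not_le.1 hx)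
  have hmono : ∀ {μ : Measure ℝ}, HasZeta μ → ∀ {x : ℝ}, x ≤ X → distFun μ x ≤ distFun μ X :=
    fun hμ x hx => measureReal_mono (Set.Iic_subset_Iic.2 hx) (hμ.measure_Iic_lt_top X).ne
  have hnn : ∀ (μ : Measure ℝ) (x : ℝ), 0 ≤ distFun μ x := fun _ _ => measureReal_nonneg
  set K := distFun A X + distFun B X
  have hK : 0 ≤ K := add_nonneg (hnn A X) (hnn B X)
  have hb : ∀ x, 1 ≤ x → |distFun A x - distFun B x| ≤ K + c / 6 * x := fun x hx => by
    have hcx : 0 ≤ c / 6 * x := by positivity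
    rcases le_total x X with h2 | h2
    · have h3 := hmono hA h2
      have h4 := hmono hB h2
      have h5 := hnn A x
      have h6 := hnn B x
      have h7 := hnn A X
      have h8 := hnn B X
      rw [abs_le]; constructor <;> simp only [K] <;> linarith
    · rw [← hF]; linarith [hX x h2]
  have key : ∀ ε : ℝ, 0 < ε → ε < 1 → c ≤ 6 * K * ε := fun ε h0 h1 => by
    have h2 := (h ε h0 h1).trans (norm_zeta_sub_le hA hB hb (by rw [nearLine_re]; linarith))
    rw [nearLine_re, add_sub_cancel_left] at h2
    have h3 : ‖nearLine ε‖ * (K / (1 + ε) + c / 6 / ε) ≤ 3 * (K + c / 6 / ε) := by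
      gcongr
      · exact norm_nearLine_le h0 h1
      · exact div_le_self hK (by linarith)
    have h4 := mul_le_mul_of_nonneg_right (h2.trans h3) h0.le
    have h5 : 3 * (K + c / 6 / ε) * ε = 3 * K * ε + c / 2 := by field_simp; ring
    rw [div_mul_cancel₀ _ h0.ne', h5] at h4
    linarith
  have h1 := key (min (1 / 2) (c / (12 * (K + 1)))) (by positivity)
    ((min_le_left _ _).trans_lt (by norm_num))
  have h2 : 6 * K * min (1 / 2) (c / (12 * (K + 1))) ≤ 6 * K * (c / (12 * (K + 1))) := by
    gcongr; exact min_le_right _ _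
  have h3 : 6 * K * (c / (12 * (K + 1))) ≤ c / 2 := by
    rw [← mul_div_assoc, div_le_div_iff₀ (by positivity) (by norm_num)]
    nlinarith
  linarith

theorem norm_one_add_le {ε : ℝ} (h0 : 0 < ε) (h1 : ε < 1) :
    ‖1 + 1 / (nearLine ε - 1) ^ 2‖ ≤ 3 * ε := by
  set w : ℂ := ε + Complex.I
  have hw : nearLine ε - 1 = w := by simp only [nearLine, w]; ring
  have hre : w.re = ε := by simp [w]
  have him : w.im = 1 := by simp [w]
  have hw0 : w ≠ 0 := fun h => by rw [h] at him; simp at him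
  have hw1 : 1 ≤ ‖w‖ := by
    have := Complex.abs_im_le_norm w
    rwa [him, abs_one] at this
  have h2 : 1 + 1 / w ^ 2 = (ε * (ε + 2 * Complex.I)) / w ^ 2 := by
    have : w ^ 2 + 1 = ε * (ε + 2 * Complex.I) := by
      simp only [w]; linear_combination Complex.I_sq
    rw [← this]; field_simp
  rw [hw, h2, norm_div, norm_pow, norm_mul, Complex.norm_real, Real.norm_of_nonneg h0.le]
  refine (div_le_self (by positivity) (one_le_pow₀ hw1)).trans ?_
  rw [mul_comm]
  gcongr
  refine (norm_add_le _ _).trans ?_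
  rw [norm_mul, Complex.norm_real, Real.norm_of_nonneg h0.le]
  simp; linarith

/-- The zero of the zeta function of the continuous system at `1 + i` makes its reciprocal as large
as `1 / ε` at distance `ε`. -/
theorem le_norm_exp_neg_zeta {ε : ℝ} (h0 : 0 < ε) (h1 : ε < 1) :
    1 / 3 / ε ≤ ‖Complex.exp (-zeta dPiC (nearLine ε))‖ := by
  have h2 := norm_one_add_le h0 h1
  rw [← exp_zeta_dPiC (by rw [nearLine_re]; linarith)] at h2
  rw [Complex.exp_neg, norm_inv, div_div, one_div]
  exact inv_anti₀ (norm_pos_iff.2 (Complex.exp_ne_zero _)) h2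

theorem isOmegaId_measureMoebiusSum : IsOmegaId (measureMoebiusSum dPiC) := by
  refine isOmegaId_of_le_norm_zeta (hasZeta_convCosh hasZeta_dPiC) (hasZeta_convSinh hasZeta_dPiC)
    (fun _ => rfl) (show (0 : ℝ) < 1 / 3 by norm_num) fun ε h0 h1 => ?_
  have hs : 1 < (nearLine ε).re := by rw [nearLine_re]; linarith
  rw [zeta_convCosh hasZeta_dPiC hs, zeta_convSinh hasZeta_dPiC hs, Complex.cosh_sub_sinh]
  exact le_norm_exp_neg_zeta h0 h1

/-! ### Dirichlet series over g-integers and the Möbius function -/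

/-- The completely multiplicative function on exponent vectors with value `z i` at the `i`-th
g-prime. -/
noncomputable def multExt (z : ℕ → ℂ) (a : ℕ →₀ ℕ) : ℂ := a.prod fun i e => z i ^ e

theorem multExt_add (z : ℕ → ℂ) (a b : ℕ →₀ ℕ) :
    multExt z (a + b) = multExt z a * multExt z b :=
  Finsupp.prod_add_index' (fun _ => pow_zero _) fun _ _ _ => pow_add _ _ _

theorem multExt_single (z : ℕ → ℂ) (i : ℕ) : multExt z (Finsupp.single i 1) = z i :=
  (Finsupp.prod_single_index (h := fun i e => z i ^ e) (pow_zero _)).trans (pow_one _)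

theorem multExt_zero (z : ℕ → ℂ) : multExt z 0 = 1 := Finsupp.prod_zero_index

open Classical in
/-- The part of the series `∑ c a * multExt z a` over the exponent vectors that vanish on `S`. -/
noncomputable def coprimeSum (z : ℕ → ℂ) (c : (ℕ →₀ ℕ) → ℂ) (S : Finset ℕ) : ℂ :=
  ∑' a, if ∀ i ∈ S, a i = 0 then c a * multExt z a else 0

theorem summable_coprime {z : ℕ → ℂ} {c : (ℕ →₀ ℕ) → ℂ} (hz : Summable fun a => ‖multExt z a‖)
    (hc : ∀ a, ‖c a‖ ≤ 1) (P : (ℕ →₀ ℕ) → Prop) [DecidablePred P] :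
    Summable fun a => if P a then c a * multExt z a else 0 := by
  refine Summable.of_norm_bounded hz fun a => ?_
  split_ifs
  · rw [norm_mul]; exact mul_le_of_le_one_left (norm_nonneg _) (hc a)
  · simp

open Classical in
/-- Separating the exponent vectors that are zero at `i` from the others. -/
theorem coprimeSum_eq_insert_add {z : ℕ → ℂ} {c : (ℕ →₀ ℕ) → ℂ}
    (hz : Summable fun a => ‖multExt z a‖) (hc : ∀ a, ‖c a‖ ≤ 1) {S : Finset ℕ} {i : ℕ}
    (hi : i ∉ S) :
    coprimeSum z c S = coprimeSum z c (insert i S) +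
      z i * coprimeSum z (fun a => c (a + Finsupp.single i 1)) S := by
  set e : (ℕ →₀ ℕ) → (ℕ →₀ ℕ) := fun a => a + Finsupp.single i 1
  have he : Function.Injective e := fun a b h => add_right_cancel h
  have h1 : coprimeSum z c S = coprimeSum z c (insert i S) +
      ∑' a, if (∀ j ∈ S, a j = 0) ∧ a i ≠ 0 then c a * multExt z a else 0 := by
    rw [coprimeSum, coprimeSum, ← Summable.tsum_add (summable_coprime hz hc _)
      (summable_coprime hz hc _)]
    refine tsum_congr fun a => ?_
    simp only [Finset.mem_insert, forall_eq_or_imp]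
    by_cases h1 : a i = 0 <;> by_cases h2 : ∀ j ∈ S, a j = 0 <;> simp [h1, h2]
  rw [h1]
  congr 1
  rw [coprimeSum, ← tsum_mul_left, ← he.tsum_eq]
  · refine tsum_congr fun a => ?_
    have h2 : (∀ j ∈ S, (e a) j = 0) ↔ ∀ j ∈ S, a j = 0 := forall₂_congr fun j hj => by
      have : i ≠ j := fun h => hi (h ▸ hj)
      simp [e, this]
    have h3 : (e a) i ≠ 0 := by simp [e]
    simp only [h2, ne_eq, h3, not_false_eq_true, and_true]
    split_ifs
    · simp only [e]
      rw [multExt_add, multExt_single]; ring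
    · simp
  · intro a ha
    rw [Function.mem_support, ne_eq, ite_eq_right_iff, Classical.not_imp] at ha
    refine ⟨a - Finsupp.single i 1, tsub_add_cancel_of_le (Finsupp.single_le_iff.2 ?_)⟩
    exact Nat.one_le_iff_ne_zero.2 ha.1.2

theorem abs_moebius_le (a : ℕ →₀ ℕ) : |moebius a| ≤ 1 := by
  unfold moebius; split_ifs <;> simp

theorem moebius_zero : moebius 0 = 1 := by simp [moebius]

theorem moebius_add_single {a : ℕ →₀ ℕ} {i : ℕ} :
    moebius (a + Finsupp.single i 1) = if a i = 0 then -moebius a else 0 := by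
  classical
  by_cases h : a i = 0
  · have h1 : (∀ j, (a + Finsupp.single i 1 : ℕ →₀ ℕ) j ≤ 1) ↔ ∀ j, a j ≤ 1 :=
      forall_congr' fun j => by
      by_cases hj : i = j
      · subst hj; simp [h]
      · simp [hj]
    have h2 : (a + Finsupp.single i 1).support = insert i a.support := by
      ext j
      by_cases hj : i = j
      · subst hj; simp
      · simp [Ne.symm hj]
    simp only [moebius, h1, h2, h, if_true]
    rw [Finset.card_insert_of_notMem (by simpa using h), pow_succ]
    split_ifs <;> simp
  · rw [if_neg h, moebius, if_neg]
    intro h1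
    have := h1 i
    simp at this
    exact h this

section EulerProduct

variable {z : ℕ → ℂ}

theorem coprimeSum_one_insert (hz : Summable fun a => ‖multExt z a‖) {S : Finset ℕ} {i : ℕ}
    (hi : i ∉ S) :
    (1 - z i) * coprimeSum z (fun _ => 1) S = coprimeSum z (fun _ => 1) (insert i S) := by
  linear_combination coprimeSum_eq_insert_add hz (c := fun _ => 1) (by simp) hi

theorem coprimeSum_moebius_insert (hz : Summable fun a => ‖multExt z a‖) {S : Finset ℕ} {i : ℕ}
    (hi : i ∉ S) : coprimeSum z (fun a => moebius a) S =
      (1 - z i) * coprimeSum z (fun a => moebius a) (insert i S) := by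
  rw [coprimeSum_eq_insert_add hz (c := fun a => moebius a)
    (fun a => by simpa using abs_moebius_le a) hi]
  have : coprimeSum z (fun a => moebius (a + Finsupp.single i 1)) S =
      -coprimeSum z (fun a => moebius a) (insert i S) := by
    rw [coprimeSum, coprimeSum, ← tsum_neg]
    refine tsum_congr fun a => ?_
    simp only [Finset.mem_insert, forall_eq_or_imp, moebius_add_single]
    by_cases h1 : a i = 0
    · by_cases h2 : ∀ j ∈ S, a j = 0
      · rw [if_pos h2, if_pos h1, if_pos ⟨h1, h2⟩]; push_cast; ring
      · rw [if_neg h2, if_neg fun h => h2 h.2, neg_zero]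
    · simp [h1]
  rw [this]; ring

theorem prod_mul_coprimeSum_one (hz : Summable fun a => ‖multExt z a‖) (n : ℕ) :
    (∏ i ∈ Finset.range n, (1 - z i)) * coprimeSum z (fun _ => 1) ∅ =
      coprimeSum z (fun _ => 1) (Finset.range n) := by
  induction n with
  | zero => simp
  | succ n ih =>
    rw [Finset.prod_range_succ_comm, mul_assoc, ih,
      coprimeSum_one_insert hz Finset.notMem_range_self, Finset.range_add_one]

theorem coprimeSum_moebius_eq (hz : Summable fun a => ‖multExt z a‖) (n : ℕ) :
    coprimeSum z (fun a => moebius a) ∅ =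
      (∏ i ∈ Finset.range n, (1 - z i)) * coprimeSum z (fun a => moebius a) (Finset.range n) := by
  induction n with
  | zero => simp
  | succ n ih =>
    rw [ih, coprimeSum_moebius_insert hz Finset.notMem_range_self, Finset.prod_range_succ,
      mul_assoc, Finset.range_add_one]

theorem tendsto_coprimeSum (hz : Summable fun a => ‖multExt z a‖) {c : (ℕ →₀ ℕ) → ℂ}
    (hc : ∀ a, ‖c a‖ ≤ 1) (h0 : c 0 = 1) :
    Tendsto (fun n => coprimeSum z c (Finset.range n)) atTop (nhds 1) := by
  classical
  have h1 : ∑' a : ℕ →₀ ℕ, (if a = 0 then (1 : ℂ) else 0) = 1 := tsum_ite_eq _ _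
  conv => rhs; rw [← h1]
  refine tendsto_tsum_of_dominated_convergence hz (fun a => ?_) (Eventually.of_forall fun n a => ?_)
  · by_cases ha : a = 0
    · subst ha
      simp [multExt_zero, h0]
    · obtain ⟨i, hi⟩ := Finsupp.ne_iff.1 ha
      rw [if_neg ha]
      refine tendsto_const_nhds.congr' ((eventually_gt_atTop i).mono fun n hn => ?_)
      exact (if_neg fun h => hi (h i (Finset.mem_range.2 hn))).symm
  · split_ifs
    · rw [norm_mul]; exact mul_le_of_le_one_left (norm_nonneg _) (hc a)
    · simp

/-- The Dirichlet series of the Möbius function is the inverse of the zeta function: removing the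
first `n` Euler factors from each of the two leaves series that tend to `1`, and the factors removed
are inverse to each other. -/
theorem tsum_moebius_mul_tsum (hz : Summable fun a => ‖multExt z a‖) :
    (∑' a, (moebius a : ℂ) * multExt z a) * ∑' a, multExt z a = 1 := by
  have hμ : coprimeSum z (fun a => moebius a) ∅ = ∑' a, (moebius a : ℂ) * multExt z a := by
    simp [coprimeSum]
  have h1 : coprimeSum z (fun _ => 1) ∅ = ∑' a, multExt z a := by simp [coprimeSum]
  rw [← hμ, ← h1]
  have hlim := (tendsto_coprimeSum hz (c := fun a => moebius a)
    (fun a => by simpa using abs_moebius_le a) (by simp [moebius_zero])).mul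
    (tendsto_coprimeSum hz (c := fun _ => 1) (by simp) rfl)
  rw [one_mul] at hlim
  refine tendsto_nhds_unique (tendsto_const_nhds.congr fun n => ?_) hlim
  rw [coprimeSum_moebius_eq hz n, ← prod_mul_coprimeSum_one hz n]
  ring

/-- Lower bounds for the partial Euler products carry over to the Dirichlet series of the Möbius
function. -/
theorem le_norm_tsum_moebius (hz : Summable fun a => ‖multExt z a‖) {b : ℕ → ℝ} {β : ℝ}
    (hb : Tendsto b atTop (nhds β)) {k : ℕ → ℕ} (hk : Tendsto k atTop atTop)
    (h : ∀ n, b n ≤ ‖∏ i ∈ Finset.range (k n), (1 - z i)‖) :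
    β ≤ ‖∑' a, (moebius a : ℂ) * multExt z a‖ := by
  have hμ : coprimeSum z (fun a => moebius a) ∅ = ∑' a, (moebius a : ℂ) * multExt z a := by
    simp [coprimeSum]
  have hlim := ((tendsto_coprimeSum hz (c := fun a => moebius a)
    (fun a => by simpa using abs_moebius_le a) (by simp [moebius_zero])).comp hk).norm
  have h2 := hb.mul hlim
  rw [norm_one, mul_one] at h2
  refine le_of_tendsto h2 (Eventually.of_forall fun n => ?_)
  rw [← hμ, coprimeSum_moebius_eq hz (k n), norm_mul]
  exact mul_le_mul_of_nonneg_right (h n) (norm_nonneg _)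

end EulerProduct

/-! ### Measures carried by the g-integers -/

section WeightedMeasure

variable {p : ℕ → ℝ}

/-- The measure with mass `w a` at the g-integer with exponent vector `a`. -/
noncomputable def weightMeasure (p : ℕ → ℝ) (w : (ℕ →₀ ℕ) → ENNReal) : Measure ℝ :=
  Measure.sum fun a => w a • Measure.dirac (gInt p a)

theorem intMeasure_eq : intMeasure p = weightMeasure p 1 := by
  simp [intMeasure, weightMeasure]

theorem multExt_cpow (hp : IsGPrimeSystem p) (s : ℂ) (a : ℕ →₀ ℕ) :
    multExt (fun i => (p i : ℂ) ^ (-s)) a = (gInt p a : ℂ) ^ (-s) := by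
  induction a using Finsupp.induction_linear with
  | zero => simp [multExt_zero, gInt_zero]
  | add a b ha hb =>
    rw [multExt_add, ha, hb, gInt_add,
      cpow_mul_of_one_le s _ _ (one_le_gInt hp a) (one_le_gInt hp b)]
  | single i m =>
    induction m with
    | zero => simp [multExt_zero, gInt_zero]
    | succ m ih =>
      rw [Finsupp.single_add, multExt_add, gInt_add, cpow_mul_of_one_le s _ _ (one_le_gInt hp _)
        (one_le_gInt hp _), ih, multExt_single, gInt_single i 1, pow_one]

theorem hasZeta_weightMeasure (hp : IsGPrimeSystem p)
    (hs : ∀ s : ℂ, 1 < s.re → Summable fun a => ‖(gInt p a : ℂ) ^ (-s)‖)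
    {w : (ℕ →₀ ℕ) → ENNReal} (hw : ∀ a, w a ≤ 1) : HasZeta (weightMeasure p w) := by
  have hw' : ∀ a, w a ≠ ⊤ := fun a => ((hw a).trans_lt ENNReal.one_lt_top).ne
  refine ⟨?_, fun s h => integrable_sum_dirac hw' ?_⟩
  · rw [weightMeasure, Measure.sum_apply _ measurableSet_Iio]
    simp [Measure.dirac_apply' _ measurableSet_Iio, one_le_gInt hp]
  · refine Summable.of_nonneg_of_le (fun a => by positivity) (fun a => ?_) (hs s h)
    refine mul_le_of_le_one_left (norm_nonneg _) ?_
    exact ENNReal.toReal_le_of_le_ofReal zero_le_one (by simpa using hw a)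

theorem hasSum_zeta_weightMeasure (hp : IsGPrimeSystem p)
    (hs : ∀ s : ℂ, 1 < s.re → Summable fun a => ‖(gInt p a : ℂ) ^ (-s)‖)
    {w : (ℕ →₀ ℕ) → ENNReal} (hw : ∀ a, w a ≤ 1) {s : ℂ} (h : 1 < s.re) :
    HasSum (fun a => ((w a).toReal : ℂ) * (gInt p a : ℂ) ^ (-s)) (zeta (weightMeasure p w) s) := by
  have h1 := hasSum_integral_measure ((hasZeta_weightMeasure hp hs hw).integrable s h)
  refine h1.congr_fun fun a => ?_
  rw [integral_smul_measure, integral_dirac, Complex.real_smul]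

theorem finite_gInt_le (hp : IsGPrimeSystem p) (x : ℝ) : {a | gInt p a ≤ x}.Finite :=
  (finite_lg_le hp (Real.log x)).subset fun a ha => Real.log_le_log (gInt_pos hp a) ha

theorem distFun_weightMeasure (hp : IsGPrimeSystem p) {w : (ℕ →₀ ℕ) → ENNReal}
    (hw : ∀ a, w a ≤ 1) (x : ℝ) :
    distFun (weightMeasure p w) x = ∑ a ∈ (finite_gInt_le hp x).toFinset, (w a).toReal := by
  have hw' : ∀ a, w a ≠ ⊤ := fun a => ((hw a).trans_lt ENNReal.one_lt_top).ne
  rw [distFun, Measure.real, weightMeasure, Measure.sum_apply _ measurableSet_Iic,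
    tsum_eq_sum (s := (finite_gInt_le hp x).toFinset), ENNReal.toReal_sum]
  · refine Finset.sum_congr rfl fun a ha => ?_
    have ha : gInt p a ≤ x := by simpa using ha
    simp [Measure.dirac_apply' _ measurableSet_Iic, ha]
  · intro a _
    rw [Measure.smul_apply, smul_eq_mul]
    exact ENNReal.mul_ne_top (hw' a) (measure_ne_top _ _)
  · intro a ha
    have ha : x < gInt p a := by simpa using ha
    simp [Measure.dirac_apply' _ measurableSet_Iic, ha]

/-- The positive part of the measure `dM` of a discrete system. -/
noncomputable def moebiusPos (p : ℕ → ℝ) : Measure ℝ :=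
  weightMeasure p fun a => ENNReal.ofReal (moebius a)

/-- The negative part of the measure `dM` of a discrete system. -/
noncomputable def moebiusNeg (p : ℕ → ℝ) : Measure ℝ :=
  weightMeasure p fun a => ENNReal.ofReal (-moebius a)

theorem ofReal_moebius_le (a : ℕ →₀ ℕ) : ENNReal.ofReal (moebius a) ≤ 1 :=
  ENNReal.ofReal_le_one.2 ((le_abs_self _).trans (abs_moebius_le a))

theorem ofReal_neg_moebius_le (a : ℕ →₀ ℕ) : ENNReal.ofReal (-moebius a) ≤ 1 :=
  ENNReal.ofReal_le_one.2 ((neg_le_abs _).trans (abs_moebius_le a))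

theorem toReal_ofReal_sub (x : ℝ) :
    (ENNReal.ofReal x).toReal - (ENNReal.ofReal (-x)).toReal = x := by
  rw [ENNReal.toReal_ofReal', ENNReal.toReal_ofReal']
  exact max_zero_sub_eq_self x

theorem moebiusSum_eq (hp : IsGPrimeSystem p) (x : ℝ) :
    moebiusSum p x = distFun (moebiusPos p) x - distFun (moebiusNeg p) x := by
  rw [moebiusPos, moebiusNeg, distFun_weightMeasure hp ofReal_moebius_le,
    distFun_weightMeasure hp ofReal_neg_moebius_le, ← Finset.sum_sub_distrib, moebiusSum,
    ← finsum_mem_coe_finset, Set.Finite.coe_toFinset]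
  exact finsum_mem_congr rfl fun a _ => (toReal_ofReal_sub _).symm

theorem zeta_moebius_sub (hp : IsGPrimeSystem p)
    (hs : ∀ s : ℂ, 1 < s.re → Summable fun a => ‖(gInt p a : ℂ) ^ (-s)‖) {s : ℂ} (h : 1 < s.re) :
    zeta (moebiusPos p) s - zeta (moebiusNeg p) s =
      ∑' a, (moebius a : ℂ) * (gInt p a : ℂ) ^ (-s) := by
  refine ((hasSum_zeta_weightMeasure hp hs ofReal_moebius_le h).sub
    (hasSum_zeta_weightMeasure hp hs ofReal_neg_moebius_le h)).tsum_eq.symm.trans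
    (tsum_congr fun a => ?_)
  rw [← sub_mul, ← Complex.ofReal_sub, toReal_ofReal_sub]

theorem isConvInverse_intMeasure (hp : IsGPrimeSystem p)
    (hs : ∀ s : ℂ, 1 < s.re → Summable fun a => ‖(gInt p a : ℂ) ^ (-s)‖) :
    IsConvInverse (intMeasure p) (moebiusSum p) := by
  have hA : HasZeta (moebiusPos p) := hasZeta_weightMeasure hp hs ofReal_moebius_le
  have hB : HasZeta (moebiusNeg p) := hasZeta_weightMeasure hp hs ofReal_neg_moebius_le
  have hN : HasZeta (intMeasure p) := by
    rw [intMeasure_eq]; exact hasZeta_weightMeasure hp hs fun _ => le_rfl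
  refine ⟨_, _, hA.null, hB.null, fun x => ⟨hA.measure_Iic_lt_top x, hB.measure_Iic_lt_top x⟩,
    moebiusSum_eq hp, ?_⟩
  have hBN := hB.mconv hN
  refine (hA.mconv hN).ext (hBN.add (hasZeta_dirac le_rfl)) fun s h => ?_
  have hz : zeta (intMeasure p) s = ∑' a, (gInt p a : ℂ) ^ (-s) := by
    rw [intMeasure_eq, ← (hasSum_zeta_weightMeasure hp hs (w := 1) (fun _ => le_rfl) h).tsum_eq]
    simp
  have h1 := tsum_moebius_mul_tsum (z := fun i => (p i : ℂ) ^ (-s)) (by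
    simpa only [multExt_cpow hp] using hs s h)
  simp only [multExt_cpow hp] at h1
  rw [← hz, ← zeta_moebius_sub hp hs h] at h1
  rw [zeta_add hBN (hasZeta_dirac le_rfl) h, zeta_mconv hA hN h, zeta_mconv hB hN h, zeta_dirac,
    Complex.ofReal_one, Complex.one_cpow]
  linear_combination h1

end WeightedMeasure

/-! ### The Möbius function of the discrete system -/

theorem summable_norm_gInt_cpow {p : ℕ → ℝ} (hp : IsGPrimeSystem p) (h2 : ∀ i, 2 ≤ p i) {s : ℂ}
    (hs : 1 ≤ s.re) (hsum : Summable fun i => p i ^ (-s.re)) :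
    Summable fun a => ‖(gInt p a : ℂ) ^ (-s)‖ := by
  have h0 : ∀ i, 0 ≤ p i ^ (-s.re) := fun i => Real.rpow_nonneg (by linarith [h2 i]) _
  have hhalf : ∀ i, p i ^ (-s.re) ≤ 1 / 2 := fun i => by
    calc p i ^ (-s.re) ≤ p i ^ (-1 : ℝ) :=
          Real.rpow_le_rpow_of_exponent_le (by linarith [h2 i]) (by linarith)
      _ ≤ 2 ^ (-1 : ℝ) := Real.rpow_le_rpow_of_nonpos (by norm_num) (h2 i) (by norm_num)
      _ = 1 / 2 := by rw [Real.rpow_neg_one]; norm_num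
  have hnorm : ∀ a, ‖(gInt p a : ℂ) ^ (-s)‖ = a.prod fun i e => (p i ^ (-s.re)) ^ e := fun a => by
    rw [← multExt_cpow hp, multExt, Finsupp.prod, norm_prod, Finsupp.prod]
    refine Finset.prod_congr rfl fun i _ => ?_
    rw [norm_pow, norm_cpow (by linarith [h2 i])]
  refine summable_of_sum_le (c := Real.exp (2 * ∑' i, p i ^ (-s.re))) (fun a => norm_nonneg _)
    fun A => ?_
  obtain ⟨n, hn⟩ := (A.biUnion Finsupp.support).exists_nat_subset_range
  simp only [hnorm]
  refine (sum_prod_pow_le h0 hhalf fun a ha =>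
    (Finset.subset_biUnion_of_mem Finsupp.support ha).trans hn).trans ?_
  exact Real.exp_le_exp.2
    (mul_le_mul_of_nonneg_left (hsum.sum_le_tsum _ fun i _ => h0 i) (by norm_num))

theorem summable_sysP_rpow {σ : ℝ} (hσ : 1 < σ) : Summable fun i => sysP i ^ (-σ) := by
  have h1 : Summable fun i : ℕ => (2 : ℝ) ^ σ * ((i + 1 : ℕ) : ℝ) ^ (-σ) :=
    ((summable_nat_add_iff 1).2 (Real.summable_nat_rpow.2 (by linarith))).mul_left _
  have hle : ∀ i : ℕ, ((i + 1 : ℕ) : ℝ) / 2 ≤ sysP i := fun i => by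
    have h2 := add_one_le_q (i / 2 + 1)
    have h3 : i ≤ 2 * (i / 2) + 1 := by omega
    have h4 : (i : ℝ) ≤ 2 * ((i / 2 : ℕ) : ℝ) + 1 := by exact_mod_cast h3
    have h5 : sysP i = q (i / 2 + 1) := rfl
    rw [h5]
    push_cast at h2 ⊢
    linarith
  refine Summable.of_nonneg_of_le (fun i => Real.rpow_nonneg
    (zero_le_one.trans (isGPrimeSystem_sysP.one_lt i).le) _) (fun i => ?_) h1
  calc sysP i ^ (-σ) ≤ (((i + 1 : ℕ) : ℝ) / 2) ^ (-σ) :=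
        Real.rpow_le_rpow_of_nonpos (by positivity) (hle i) (by linarith)
    _ = _ := by
        rw [Real.div_rpow (by positivity) (by norm_num), Real.rpow_neg (by norm_num : (0 : ℝ) ≤ 2),
          div_inv_eq_mul, mul_comm]

theorem summable_sysP {s : ℂ} (hs : 1 < s.re) : Summable fun a => ‖(gInt sysP a : ℂ) ^ (-s)‖ :=
  summable_norm_gInt_cpow isGPrimeSystem_sysP (fun i => two_le_sysD (i / 2)) hs.le
    (summable_sysP_rpow hs)

theorem exp_le_norm_one_sub {z : ℂ} (hz : ‖z‖ ≤ 1 / 2) :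
    Real.exp (-z.re - ‖z‖ ^ 2) ≤ ‖1 - z‖ := by
  have h1 : ‖-z‖ < 1 := by rw [norm_neg]; linarith
  have h2 := Complex.norm_log_one_add_sub_self_le h1
  have h0 : 1 + -z ≠ 0 := fun h => by
    have : z = 1 := by linear_combination -h
    rw [this, norm_one] at hz; norm_num at hz
  rw [norm_neg] at h2
  have h3 : (1 - ‖z‖)⁻¹ ≤ 2 := by
    rw [inv_le_comm₀ (by linarith) (by norm_num)]; linarith
  have h4 := (Complex.abs_re_le_norm _).trans h2
  rw [Complex.sub_re, Complex.neg_re, Complex.log_re] at h4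
  have h5 := (abs_le.1 h4).1
  have h6 : ‖z‖ ^ 2 * (1 - ‖z‖)⁻¹ / 2 ≤ ‖z‖ ^ 2 := by nlinarith [sq_nonneg ‖z‖]
  rw [sub_eq_add_neg 1 z, ← Real.le_log_iff_exp_le (norm_pos_iff.2 h0)]
  linarith

theorem prod_range_sysP (F : ℝ → ℂ) (m : ℕ) :
    ∏ i ∈ Finset.range (2 * m), F (sysP i) = ∏ k ∈ Finset.range m, F (sysD k) ^ 2 := by
  induction m with
  | zero => simp
  | succ m ih =>
    rw [show 2 * (m + 1) = 2 * m + 1 + 1 by ring, Finset.prod_range_succ, Finset.prod_range_succ,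
      ih, Finset.prod_range_succ, sysP_eq, sysP_eq, show 2 * m / 2 = m by omega,
      show (2 * m + 1) / 2 = m by omega]
    ring

theorem sum_inv_sq_le (m : ℕ) :
    ∑ k ∈ Finset.range m, (((k : ℝ) + 2)⁻¹) ^ 2 ≤ 1 - ((m : ℝ) + 1)⁻¹ := by
  induction m with
  | zero => simp
  | succ m ih =>
    rw [Finset.sum_range_succ]
    have h1 : (((m : ℝ) + 2)⁻¹) ^ 2 ≤ ((m : ℝ) + 1)⁻¹ - ((m : ℝ) + 2)⁻¹ := by
      rw [inv_sub_inv (by positivity) (by positivity), inv_pow, inv_eq_one_div]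
      rw [div_le_div_iff₀ (by positivity) (by positivity)]
      ring_nf; nlinarith
    push_cast
    rw [show (m : ℝ) + 1 + 1 = m + 2 by ring]
    linarith

theorem norm_sysD_cpow_le {s : ℂ} (hs : 1 ≤ s.re) (k : ℕ) :
    ‖(sysD k : ℂ) ^ (-s)‖ ≤ ((k : ℝ) + 2)⁻¹ := by
  have h1 := add_one_le_q (k + 1)
  have h2 : (k : ℝ) + 2 ≤ sysD k := by
    have : sysD k = q (k + 1) := rfl
    rw [this]; push_cast at h1; linarith
  rw [norm_cpow (by linarith [two_le_sysD k])]
  calc sysD k ^ (-s.re) ≤ sysD k ^ (-1 : ℝ) :=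
        Real.rpow_le_rpow_of_exponent_le (by linarith [two_le_sysD k]) (by linarith)
    _ ≤ _ := by rw [Real.rpow_neg_one]; exact inv_anti₀ (by positivity) h2

theorem tendsto_integral_densityB_cpow {s : ℂ} (hs : 1 < s.re) :
    Tendsto (fun m : ℕ => ∫ u in (1 : ℝ)..q m, densityB u • (u : ℂ) ^ (-s)) atTop
      (nhds (zeta dPiB s)) := by
  have hm := measurable_ofReal_comp_log continuous_rho
  have hlt : ∀ μ : Measure ℝ, ∀ᵐ u ∂μ, ENNReal.ofReal (rho (Real.log u)) < ⊤ := fun _ =>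
    Eventually.of_forall fun _ => ENNReal.ofReal_lt_top
  have h1 := hasZeta_dPiB.integrable s hs
  rw [dPiB_eq, logMeasure, integrable_withDensity_iff_integrable_smul' hm (hlt _)] at h1
  rw [zeta, dPiB_eq, logMeasure, integral_withDensity_eq_integral_toReal_smul hm (hlt _)]
  refine (intervalIntegral_tendsto_integral_Ioi 1 h1 tendsto_q).congr fun m => ?_
  refine intervalIntegral.integral_congr fun u hu => ?_
  have hu1 : 1 ≤ u := uIcc_subset_Ici le_rfl (one_le_q m) hu
  rw [ENNReal.toReal_ofReal (rho_nonneg (Real.log_nonneg hu1))]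
  rfl

theorem norm_sum_cpow_sub_integral_le {s : ℂ} (hs : 1 < s.re) (m : ℕ) :
    ‖∑ k ∈ Finset.range m, (sysD k : ℂ) ^ (-s) -
      ∫ u in (1 : ℝ)..q m, densityB u • (u : ℂ) ^ (-s)‖ ≤ ‖s‖ := by
  have hs0 : s ≠ 0 := fun h => by simp [h] at hs; linarith
  have hc : ContinuousOn (fun u : ℝ => -s * (u : ℂ) ^ (-s - 1)) (Set.Ici 1) := fun u hu => by
    have hu : (1 : ℝ) ≤ u := hu
    exact ((Complex.continuousAt_ofReal_cpow_const u (-s - 1)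
      (Or.inr (by linarith))).const_mul _).continuousWithinAt
  refine (norm_sum_q_sub_integral_le (φ := fun u : ℝ => (u : ℂ) ^ (-s))
    (φ' := fun u : ℝ => -s * (u : ℂ) ^ (-s - 1))
    (fun u hu => hasDerivAt_ofReal_cpow_const (by linarith) (neg_ne_zero.2 hs0)) hc m).trans ?_
  have hq := one_le_q m
  calc ∫ u in (1 : ℝ)..q m, ‖-s * (u : ℂ) ^ (-s - 1)‖
      ≤ ∫ u in (1 : ℝ)..q m, ‖s‖ * (u ^ 2)⁻¹ := by
        refine intervalIntegral.integral_mono_on hq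
          ((hc.mono (uIcc_subset_Ici le_rfl hq)).norm.intervalIntegrable) ?_ fun u hu => ?_
        · refine ContinuousOn.intervalIntegrable fun u hu => ?_
          have : (1 : ℝ) ≤ u := uIcc_subset_Ici le_rfl hq hu
          exact (((continuous_pow 2).continuousAt.inv₀
            (by positivity)).const_mul _).continuousWithinAt
        · rw [norm_mul, norm_neg, Complex.norm_cpow_eq_rpow_re_of_pos (by linarith [hu.1])]
          refine mul_le_mul_of_nonneg_left ?_ (norm_nonneg _)
          rw [← Real.rpow_natCast, ← Real.rpow_neg (by linarith [hu.1])]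
          refine Real.rpow_le_rpow_of_exponent_le hu.1 ?_
          simp; linarith
    _ ≤ ‖s‖ := by
        rw [intervalIntegral.integral_const_mul]
        exact mul_le_of_le_one_right (norm_nonneg _) (integral_inv_sq_le hq)

/-- The partial Euler products of `1 / ζ_P` are bounded below by their continuous counterparts. The
constant `8` is twice the sum of the bound `‖s‖ ≤ 3` for the difference of the sum and the integral
and the bound `1` for the sum of the squares of the terms. -/
theorem le_norm_prod_sysP {s : ℂ} (hs : 1 < s.re) (hs3 : ‖s‖ ≤ 3) (m : ℕ) :
    Real.exp (-2 * (∫ u in (1 : ℝ)..q m, densityB u • (u : ℂ) ^ (-s)).re - 8) ≤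
      ‖∏ i ∈ Finset.range (2 * m), (1 - (sysP i : ℂ) ^ (-s))‖ := by
  rw [prod_range_sysP (fun x => 1 - (x : ℂ) ^ (-s)), norm_prod]
  have h1 : ∀ k ∈ Finset.range m,
      Real.exp (2 * (-((sysD k : ℂ) ^ (-s)).re - (((k : ℝ) + 2)⁻¹) ^ 2)) ≤
        ‖(1 - (sysD k : ℂ) ^ (-s)) ^ 2‖ := fun k _ => by
    have h2 := norm_sysD_cpow_le hs.le k
    have h3 : ((k : ℝ) + 2)⁻¹ ≤ 1 / 2 := by
      rw [one_div]; exact inv_anti₀ (by norm_num) (by linarith [Nat.cast_nonneg (α := ℝ) k])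
    have h4 := exp_le_norm_one_sub (h2.trans h3)
    rw [norm_pow, mul_comm, Real.exp_mul, Real.rpow_two]
    refine pow_le_pow_left₀ (Real.exp_pos _).le (le_trans (Real.exp_le_exp.2 ?_) h4) 2
    gcongr
  refine le_trans ?_ (Finset.prod_le_prod (fun k _ => (Real.exp_pos _).le) h1)
  rw [← Real.exp_sum, ← Finset.mul_sum, Finset.sum_sub_distrib, Finset.sum_neg_distrib]
  refine Real.exp_le_exp.2 ?_
  have h5 := (Complex.abs_re_le_norm _).trans (norm_sum_cpow_sub_integral_le hs m)
  rw [Complex.sub_re, Complex.re_sum] at h5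
  have h6 := (abs_le.1 h5).2
  have h7 := sum_inv_sq_le m
  have h8 : 0 ≤ ((m : ℝ) + 1)⁻¹ := by positivity
  linarith

theorem isOmegaId_moebiusSum_sysP : IsOmegaId (moebiusSum sysP) := by
  have hp := isGPrimeSystem_sysP
  have hsum : ∀ s : ℂ, 1 < s.re → Summable fun a => ‖(gInt sysP a : ℂ) ^ (-s)‖ :=
    fun s => summable_sysP
  refine isOmegaId_of_le_norm_zeta (hasZeta_weightMeasure hp hsum ofReal_moebius_le)
    (hasZeta_weightMeasure hp hsum ofReal_neg_moebius_le) (moebiusSum_eq hp)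
    (show 0 < Real.exp (-8) / 3 by positivity) fun ε h0 h1 => ?_
  have hs : 1 < (nearLine ε).re := by rw [nearLine_re]; linarith
  have hz := zeta_moebius_sub hp hsum hs
  rw [moebiusPos, moebiusNeg] at hz
  rw [hz]
  set s := nearLine ε
  have hlim : Tendsto (fun m : ℕ => Real.exp (-2 * (∫ u in (1 : ℝ)..q m,
      densityB u • (u : ℂ) ^ (-s)).re - 8)) atTop
      (nhds (Real.exp (-2 * (zeta dPiB s).re - 8))) :=
    (Real.continuous_exp.tendsto _).comp ((((Complex.continuous_re.tendsto _).comp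
      (tendsto_integral_densityB_cpow hs)).const_mul (-2)).sub_const 8)
  have h2 := le_norm_tsum_moebius (z := fun i => (sysP i : ℂ) ^ (-s))
    (by simpa only [multExt_cpow hp] using hsum s hs) hlim
    (tendsto_id.const_mul_atTop' (show 0 < 2 by norm_num)) fun m =>
      le_norm_prod_sysP hs (norm_nearLine_le h0 h1) m
  simp only [multExt_cpow hp] at h2
  refine le_trans ?_ h2
  have h3 := le_norm_exp_neg_zeta h0 h1
  rw [Complex.norm_exp, dPiC, zeta_smul] at h3
  have h4 : (-(((2 : ENNReal).toReal : ℂ) * zeta dPiB s)).re = -2 * (zeta dPiB s).re := by simp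
  rw [h4] at h3
  rw [sub_eq_add_neg, Real.exp_add]
  calc Real.exp (-8) / 3 / ε = 1 / 3 / ε * Real.exp (-8) := by ring
    _ ≤ _ := mul_le_mul_of_nonneg_right h3 (Real.exp_pos _).le

/-! ### Lower bounds for the counting function of the discrete system -/

theorem exists_le_intCount {p : ℕ → ℝ} (hp : IsGPrimeSystem p) {c b : ℝ} (hc : 0 < c)
    (h : (fun x : ℝ => intCount p x - (c ^ 2 * (x * Real.log x) + b * x))
        =O[atTop] fun x : ℝ => x / Real.log x ^ (1 / 2 : ℝ)) :
    ∃ c₀ : ℝ, 0 < c₀ ∧ ∀ x : ℝ, 1 ≤ x → c₀ * (x * Real.log x) ≤ intCount p x := by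
  obtain ⟨C, hC⟩ := h.bound
  obtain ⟨X, hX⟩ := eventually_atTop.1 ((hC.and (eventually_ge_atTop 1)).and
    (Real.tendsto_log_atTop.eventually_ge_atTop (max 1 (2 * (|C| + |b|) / c ^ 2))))
  have hone : ∀ x : ℝ, 1 ≤ x → 1 ≤ intCount p x := fun x hx => by
    have h1 : ({0} : Set (ℕ →₀ ℕ)) ⊆ {a | gInt p a ≤ x} := by
      rintro a rfl
      exact gInt_zero.trans_le hx
    have h2 := Set.ncard_le_ncard h1 (finite_gInt_le hp x)
    rw [Set.ncard_singleton] at h2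
    rw [intCount]
    exact_mod_cast h2
  set Y := max X 1
  have hY : 0 ≤ Y * Real.log Y :=
    mul_nonneg (by positivity) (Real.log_nonneg (le_max_right _ _))
  refine ⟨min (c ^ 2 / 2) (1 / (Y * Real.log Y + 1)), by positivity, fun x hx => ?_⟩
  have hlx := Real.log_nonneg hx
  rcases le_total x Y with hxY | hxY
  · refine le_trans ?_ (hone x hx)
    calc min (c ^ 2 / 2) (1 / (Y * Real.log Y + 1)) * (x * Real.log x)
        ≤ 1 / (Y * Real.log Y + 1) * (Y * Real.log Y) := by
          gcongr
          exact min_le_right _ _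
      _ ≤ 1 := by
          rw [one_div, inv_mul_le_one₀ (by positivity)]; linarith
  · obtain ⟨⟨h1, -⟩, h2⟩ := hX x ((le_max_left _ _).trans hxY)
    have h3 : 1 ≤ Real.log x := (le_max_left _ _).trans h2
    have h4 : 2 * (|C| + |b|) / c ^ 2 ≤ Real.log x := (le_max_right _ _).trans h2
    rw [div_le_iff₀ (by positivity)] at h4
    have h5 : ‖x / Real.log x ^ (1 / 2 : ℝ)‖ ≤ x := by
      rw [Real.norm_of_nonneg (by positivity)]
      exact div_le_self (by linarith) (Real.one_le_rpow h3 (by norm_num))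
    have h6 : C * ‖x / Real.log x ^ (1 / 2 : ℝ)‖ ≤ |C| * x :=
      (mul_le_mul_of_nonneg_right (le_abs_self C) (norm_nonneg _)).trans (by gcongr)
    have h7 := (abs_le.1 (h1.trans h6)).1
    have h8 : -(|b| * x) ≤ b * x := by nlinarith [neg_abs_le b]
    calc min (c ^ 2 / 2) (1 / (Y * Real.log Y + 1)) * (x * Real.log x)
        ≤ c ^ 2 / 2 * (x * Real.log x) := by
          gcongr; exact min_le_left _ _
      _ ≤ intCount p x := by nlinarith

theorem not_isBigO_id_of_le {F : ℝ → ℝ} {c : ℝ} (hc : 0 < c)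
    (h : ∀ x : ℝ, 1 ≤ x → c * (x * Real.log x) ≤ F x) :
    ¬ (F =O[atTop] fun x : ℝ => x) := fun hO => by
  obtain ⟨C, hC⟩ := hO.bound
  obtain ⟨x, ⟨h1, h2⟩, h3⟩ := ((hC.and (eventually_ge_atTop 1)).and
    (Real.tendsto_log_atTop.eventually_gt_atTop (C / c))).exists
  rw [Real.norm_of_nonneg (by linarith : (0 : ℝ) ≤ x)] at h1
  have h4 := (h x h2).trans ((le_abs_self _).trans h1)
  rw [div_lt_iff₀ hc] at h3
  nlinarith

end Beurling

theorem mainTheorem7 :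
    -- the objects are well defined
    (StrictMonoOn Beurling.PiB (Set.Ici 1) ∧
      (∀ x : ℝ, 1 ≤ x → Beurling.distFun Beurling.dPiC x = Beurling.PiC x) ∧
      (∀ k : ℕ, 1 ≤ k → 1 < Beurling.q k ∧ Beurling.PiB (Beurling.q k) = k) ∧
      Beurling.IsGPrimeSystem Beurling.sysD ∧ Beurling.IsGPrimeSystem Beurling.sysP ∧
      Beurling.IsConvInverse Beurling.dNC (Beurling.measureMoebiusSum Beurling.dPiC) ∧
      Beurling.IsConvInverse (Beurling.intMeasure Beurling.sysP)
        (Beurling.moebiusSum Beurling.sysP)) ∧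
    -- the asymptotic formulas for `Π_C` and `π_P`
    ((fun x : ℝ => Beurling.PiC x -
        x / Real.log x * (2 - √2 * Real.cos (Real.log x - Real.pi / 4)))
      =O[atTop] fun x : ℝ => x / Real.log x ^ 2) ∧
    ((fun x : ℝ => Beurling.primeCount Beurling.sysP x -
        x / Real.log x * (2 - √2 * Real.cos (Real.log x - Real.pi / 4)))
      =O[atTop] fun x : ℝ => x / Real.log x ^ 2) ∧
    -- two-sided Chebyshev bounds
    (Beurling.PiC =Θ[atTop] fun x : ℝ => x / Real.log x) ∧
    (Beurling.primeCount Beurling.sysP =Θ[atTop] fun x : ℝ => x / Real.log x) ∧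
    (Beurling.measurePsi Beurling.dPiC =Θ[atTop] fun x : ℝ => x) ∧
    (Beurling.psi Beurling.sysP =Θ[atTop] fun x : ℝ => x) ∧
    -- `M(x) = Ω(x)` for both systems
    Beurling.IsOmegaId (Beurling.measureMoebiusSum Beurling.dPiC) ∧
    Beurling.IsOmegaId (Beurling.moebiusSum Beurling.sysP) ∧
    -- the zeta function and the integer counting function of the continuous system
    (∀ s : ℂ, 1 < s.re →
      Integrable (fun u : ℝ => (u : ℂ) ^ (-s)) Beurling.dNC ∧
      Beurling.zeta Beurling.dNC s = 1 + 1 / (s - 1) ^ 2) ∧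
    (∀ x : ℝ, 1 ≤ x → Beurling.distFun Beurling.dNC x = x * Real.log x - x + 2) ∧
    -- the growth of the integer counting function of the discrete system
    (∃ c : ℝ, 0 < c ∧
      ∀ x : ℝ, 1 ≤ x → c * (x * Real.log x) ≤ Beurling.intCount Beurling.sysP x) ∧
    (∃ c b : ℝ, 0 < c ∧
      ((fun x : ℝ => Beurling.intCount Beurling.sysD x - c * x)
        =O[atTop] fun x : ℝ => x / Real.log x ^ (3 / 2 : ℝ)) ∧
      ((fun x : ℝ => Beurling.intCount Beurling.sysP x - (c ^ 2 * (x * Real.log x) + b * x))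
        =O[atTop] fun x : ℝ => x / Real.log x ^ (1 / 2 : ℝ))) ∧
    -- in particular neither counting function is `O(x)`
    (¬ (Beurling.distFun Beurling.dNC =O[atTop] fun x : ℝ => x)) ∧
    ¬ (Beurling.intCount Beurling.sysP =O[atTop] fun x : ℝ => x) := by
  have hinv := Beurling.isConvInverse_intMeasure Beurling.isGPrimeSystem_sysP
    fun s => Beurling.summable_sysP
  obtain ⟨c, b, hc, hD, hP⟩ := Beurling.intCount_asymptotics
  obtain ⟨c₀, hc₀, hle⟩ := Beurling.exists_le_intCount Beurling.isGPrimeSystem_sysP hc hP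
  refine ⟨⟨Beurling.strictMonoOn_PiB, fun x => Beurling.distFun_dPiC,
      fun k hk => ⟨?_, Beurling.PiB_q k⟩, Beurling.isGPrimeSystem_sysD,
      Beurling.isGPrimeSystem_sysP, Beurling.isConvInverse_dNC, hinv⟩,
    Beurling.PiC_asymptotic, Beurling.primeCount_sysP_asymptotic,
    Beurling.isTheta_of_asymptotic Beurling.PiC_asymptotic,
    Beurling.isTheta_of_asymptotic Beurling.primeCount_sysP_asymptotic,
    Beurling.measurePsi_dPiC_isTheta, Beurling.psi_sysP_isTheta,
    Beurling.isOmegaId_measureMoebiusSum, Beurling.isOmegaId_moebiusSum_sysP,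
    fun s hs => ⟨Beurling.hasZeta_dNC.integrable s hs, Beurling.zeta_dNC hs⟩,
    fun x => Beurling.distFun_dNC, ⟨c₀, hc₀, hle⟩, ⟨c, b, hc, hD, hP⟩,
    Beurling.not_distFun_dNC_isBigO, Beurling.not_isBigO_id_of_le hc₀ hle⟩
  have hk' : (1 : ℝ) ≤ k := by exact_mod_cast hk
  linarith [Beurling.add_one_le_q k]
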